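/- For $N\ge 1$, let $\mathrm{GOE}_N$ be the probability measure on real symmetric $N\times N$ matrices whose density with respect to Lebesgue measure is proportional to $\exp\{-\frac N4\operatorname{tr}V^2\}$, and let $\mathrm{GUE}_N$ be the probability measure on Hermitian $N\times N$ matrices whose density with respect to Lebesgue measure is proportional to $\exp\{-\frac N2\operatorname{tr}V^2\}$. For a Hermitian matrix $H$ and an interval $I\subset\mathbb R$, let $\mathcal N(H,I)$ be the number of eigenvalues of $H$ in $I$, counted with multiplicity, and let $|I|$ be the length of $I$. A deformed block-Gaussian matrix is a random matrix of the form $H=H_0+\bigoplus_{j=1}^k V(j)$, where $k,N_1,\dots,N_k$ are positive integers, $H_0$ is a deterministic square matrix of size $\sum_{j=1}^k N_j$, the random matrices $V(1),\dots,V(k)$ are independent, $V(j)$ is of size $N_j\times N_j$, and either $H_0$ is real symmetric and each $V(j)$ has the distribution $\mathrm{GOE}_{N_j}$ (orthogonal case), or $H_0$ is Hermitian and each $V(j)$ has the distribution $\mathrm{GUE}_{N_j}$ (unitary case). **Theorem.** There exists an absolute constant $C>0$ such that the following holds. Let $H$ be a deformed block-Gaussian matrix, in either the orthogonal case or the unitary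 case. Then for every integer $m\ge1$ and every interval $I\subset\mathbb R$, $$\mathbb E\prod_{\ell=0}^{m-1}\bigl(\mathcal N(H,I)-\ell\bigr)\le\Bigl(C\sum_{j=1}^kN_j\,|I|\Bigr)^m,$$ and, consequently, $$\mathbb P\{\mathcal N(H,I)\ge m\}\le\frac1{m!}\Bigl(C\sum_{j=1}^kN_j\,|I|\Bigr)^m.$$ -/

import Mathlib

open MeasureTheory ProbabilityTheory
open scoped NNReal ENNReal Nat

/-- The Hermitian `n × n` matrices over `𝕜` (real symmetric matrices when `𝕜 = ℝ`). -/
abbrev HermMat (n 𝕜 : Type*) [RCLike 𝕜] := selfAdjoint (Matrix n n 𝕜)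

/-- Matrices carry the product σ-algebra of their entries. -/
instance matrixMeasurableSpace (m n α : Type*) [MeasurableSpace α] :
    MeasurableSpace (Matrix m n α) :=
  inferInstanceAs (MeasurableSpace (m → n → α))

/-- The number of eigenvalues of `A` in `I`, counted with multiplicity. -/
noncomputable def eigCount {n 𝕜 : Type*} [RCLike 𝕜] [Fintype n] [DecidableEq n]
    (A : HermMat n 𝕜) (I : Set ℝ) : ℕ :=
  Set.ncard {i : n | Matrix.IsHermitian.eigenvalues (A := (A : Matrix n n 𝕜)) A.2 i ∈ I}

/-- The strictly upper triangular positions of an `N × N` matrix. -/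
abbrev UpperPos (N : ℕ) := {p : Fin N × Fin N // p.1 < p.2}

/-- The Hermitian matrix with the given (real) diagonal entries and the given entries above
the diagonal. -/
def hermOfCoords {𝕜 : Type*} [RCLike 𝕜] {N : ℕ} (x : (Fin N → ℝ) × (UpperPos N → 𝕜)) :
    HermMat (Fin N) 𝕜 :=
  ⟨Matrix.of fun i j =>
      if h : i < j then x.2 ⟨(i, j), h⟩
      else if h' : j < i then star (x.2 ⟨(j, i), h'⟩)
      else (x.1 i : 𝕜), by
    rw [selfAdjoint.mem_iff, Matrix.star_eq_conjTranspose]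
    ext i j
    rcases lt_trichotomy i j with h | h | h
    · simp [h, h.not_gt]
    · subst h; simp
    · simp [h, h.not_gt]⟩

/-- Lebesgue measure on the Hermitian `N × N` matrices: the product of Lebesgue measures in the
diagonal entries and in the entries above the diagonal. -/
noncomputable def hermLebesgue (𝕜 : Type*) [RCLike 𝕜] [MeasureSpace 𝕜] (N : ℕ) :
    Measure (HermMat (Fin N) 𝕜) :=
  Measure.map hermOfCoords (volume : Measure ((Fin N → ℝ) × (UpperPos N → 𝕜)))

/-- The weight `exp (-a tr A²)`. -/
noncomputable def gaussWeight {𝕜 : Type*} [RCLike 𝕜] {N : ℕ} (a : ℝ) (A : HermMat (Fin N) 𝕜) :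
    ℝ≥0∞ :=
  ENNReal.ofReal
    (Real.exp (-a * RCLike.re (Matrix.trace ((A : Matrix (Fin N) (Fin N) 𝕜) ^ 2))))

/-- The probability measure on Hermitian `N × N` matrices whose density with respect to
Lebesgue measure is proportional to `exp (-a tr A²)`. -/
noncomputable def gaussHerm (𝕜 : Type*) [RCLike 𝕜] [MeasureSpace 𝕜] (N : ℕ) (a : ℝ) :
    Measure (HermMat (Fin N) 𝕜) :=
  (∫⁻ A, gaussWeight a A ∂(hermLebesgue 𝕜 N))⁻¹ • (hermLebesgue 𝕜 N).withDensity (gaussWeight a)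

/-- The Gaussian Orthogonal Ensemble, with density proportional to `exp (-(N/4) tr V²)`. -/
noncomputable def GOE (N : ℕ) : Measure (HermMat (Fin N) ℝ) := gaussHerm ℝ N (N / 4)

/-- The Gaussian Unitary Ensemble, with density proportional to `exp (-(N/2) tr V²)`. -/
noncomputable def GUE (N : ℕ) : Measure (HermMat (Fin N) ℂ) := gaussHerm ℂ N (N / 2)

/-- The block-diagonal Hermitian matrix with diagonal blocks `V 1, …, V k`. -/
def hermBlockDiag {𝕜 : Type*} [RCLike 𝕜] {k : ℕ} {N : Fin k → ℕ}
    (V : ∀ j, HermMat (Fin (N j)) 𝕜) : HermMat (Σ j, Fin (N j)) 𝕜 :=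
  ⟨Matrix.blockDiagonal' fun j => (V j : Matrix (Fin (N j)) (Fin (N j)) 𝕜), by
    rw [selfAdjoint.mem_iff, Matrix.star_eq_conjTranspose, Matrix.blockDiagonal'_conjTranspose]
    congr 1
    funext j
    exact (V j).2⟩

/-! Let `M` count the eigenvalues in an interval of half-length `r`, and let `D = ∑ N j`. By
induction on `m`, the `m`-th factorial moment of `M` is at most `(384 r D) ^ m`, uniformly in the
deterministic part. Cut the interval into `Q` windows of half-width `η = r / Q`. Then `M (M - 1) ⋯
(M - m)` is at most the sum over windows of `1{window occupied} (M - 1) ⋯ (M - m)`, plus an error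
from windows holding two eigenvalues. Each of these has probability `O(η²)`, so the error disappears
as `Q → ∞`. Everything rests on `lintegral_one_le_eigCount_mul_le`: an occupied window costs a
factor `384 η D` and uses up one eigenvalue of `M`.

Detection (`sq_norm_conjTranspose_eigenvector_le`). A unit eigenvector with eigenvalue within `η` of
`e` has block components `x` whose squared norms sum to one. If `S` is the compression to a block of
the imaginary part of the resolvent at `e + iη`, then `⟪x, S x⟫ ≥ ‖x‖⁴ / (2η)`, and Khintchine's
inequality bounds `‖x‖²` by an average of `‖S w‖` over sign vectors `w`.

Decoupling. By interlacing, `M - 1` is at most the count for the compression of the matrix to the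
complement of `w`. This count ignores the cross part of the block, that is, its row and column in
the direction `w`.

Averaging over the cross part (`lintegral_norm_imResolvent_mul_le`). `‖S w‖` is at most a multiple
of the mean of `|⟨S, X'⟩|`, where `X'` is the cross part of an independent copy. Rotating the pair
of cross parts by an angle `θ` preserves the Gaussian law and turns the pairing into the
`θ`-derivative of the argument of a determinant. The cross part has rank at most two, so this
determinant is a trigonometric polynomial of degree two. By `integral_abs_re_logDeriv_le` its
argument varies by at most `4π`, whatever the rest of the matrix is.

Closing the induction (`lintegral_compress_le`). The compression is the limit of rank-one
deterministic perturbations `t w w*` as `t → ∞`, so by Fatou's lemma a moment bound uniform in the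
deterministic part passes to it. -/

/-! ### Eigenvalue counts and their variational description -/

section EigCount

variable {n 𝕜 : Type*} [RCLike 𝕜] [Fintype n] [DecidableEq n]

/-- The operator on Euclidean space defined by a Hermitian matrix. -/
noncomputable abbrev hermLin (A : HermMat n 𝕜) :
    EuclideanSpace 𝕜 n →ₗ[𝕜] EuclideanSpace 𝕜 n :=
  Matrix.toEuclideanLin (A : Matrix n n 𝕜)

omit [Fintype n] [DecidableEq n] in
lemma isHermitian_coe (A : HermMat n 𝕜) : (A : Matrix n n 𝕜).IsHermitian := A.2

lemma hermLin_isSymmetric (A : HermMat n 𝕜) : (hermLin A).IsSymmetric :=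
  Matrix.isSymmetric_toEuclideanLin_iff.2 (isHermitian_coe A)

lemma hermLin_eigenvectorBasis (A : HermMat n 𝕜) (i : n) :
    hermLin A ((isHermitian_coe A).eigenvectorBasis i)
      = ((isHermitian_coe A).eigenvalues i : 𝕜) • (isHermitian_coe A).eigenvectorBasis i := by
  have h := (isHermitian_coe A).mulVec_eigenvectorBasis i
  ext k
  have hk := congrFun h k
  simpa [Matrix.toLpLin_apply, RCLike.real_smul_eq_coe_mul] using hk

lemma inner_eigenvectorBasis_hermLin (A : HermMat n 𝕜) (i : n) (u : EuclideanSpace 𝕜 n) :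
    inner 𝕜 ((isHermitian_coe A).eigenvectorBasis i) (hermLin A u)
      = ((isHermitian_coe A).eigenvalues i : 𝕜) * inner 𝕜 ((isHermitian_coe A).eigenvectorBasis i) u := by
  rw [← hermLin_isSymmetric A, hermLin_eigenvectorBasis, inner_smul_left]
  simp

lemma norm_hermLin_sub_sq (A : HermMat n 𝕜) (c : ℝ) (u : EuclideanSpace 𝕜 n) :
    ‖hermLin A u - (c : 𝕜) • u‖ ^ 2 = ∑ i, ((isHermitian_coe A).eigenvalues i - c) ^ 2 *
      ‖inner 𝕜 ((isHermitian_coe A).eigenvectorBasis i) u‖ ^ 2 := by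
  rw [← (isHermitian_coe A).eigenvectorBasis.sum_sq_norm_inner_right]
  refine Finset.sum_congr rfl fun i _ => ?_
  rw [inner_sub_right, inner_eigenvectorBasis_hermLin, inner_smul_right, ← sub_mul, norm_mul,
    mul_pow, ← RCLike.ofReal_sub, RCLike.norm_ofReal, sq_abs]

lemma eigCount_eq_card (A : HermMat n 𝕜) (I : Set ℝ) [DecidablePred (· ∈ I)] :
    eigCount A I = (Finset.univ.filter fun i => (isHermitian_coe A).eigenvalues i ∈ I).card := by
  rw [eigCount, ← Set.ncard_coe_finset]
  congr 1
  ext i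
  simp

lemma eigCount_le_card (A : HermMat n 𝕜) (I : Set ℝ) : eigCount A I ≤ Fintype.card n := by
  classical
  rw [eigCount_eq_card]
  exact Finset.card_le_univ _

lemma eigCount_mono (A : HermMat n 𝕜) {I J : Set ℝ} (h : I ⊆ J) :
    eigCount A I ≤ eigCount A J :=
  Set.ncard_le_ncard (fun _ hi => h hi) (Set.toFinite _)

lemma eigCount_le_sum {ι : Type*} (s : Finset ι) (A : HermMat n 𝕜) {I : Set ℝ} {J : ι → Set ℝ}
    (h : I ⊆ ⋃ q ∈ s, J q) : eigCount A I ≤ ∑ q ∈ s, eigCount A (J q) := by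
  classical
  simp only [eigCount_eq_card]
  refine (Finset.card_le_card ?_).trans Finset.card_biUnion_le
  intro i hi
  have := h (by simpa using hi)
  simpa using this

/-- The eigenvectors with eigenvalues in an open interval span a subspace on which `A - c` is
a strict contraction of the radius of the interval. -/
lemma exists_subspace_of_eigCount (A : HermMat n 𝕜) (c : ℝ) {r : ℝ} (hr : 0 < r) :
    ∃ ρ < r, 0 ≤ ρ ∧ ∃ U : Submodule 𝕜 (EuclideanSpace 𝕜 n),
      Module.finrank 𝕜 U = eigCount A (Set.Ioo (c - r) (c + r)) ∧
      (∀ u ∈ U, ‖hermLin A u - (c : 𝕜) • u‖ ≤ ρ * ‖u‖) ∧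
      ∀ b : ℝ, b ∉ Set.Ioo (c - r) (c + r) → ∀ w, hermLin A w = (b : 𝕜) • w →
        ∀ u ∈ U, inner 𝕜 w u = 0 := by
  classical
  set v := (isHermitian_coe A).eigenvectorBasis with hv
  set ev := (isHermitian_coe A).eigenvalues with hev
  set S : Finset n := Finset.univ.filter fun i => ev i ∈ Set.Ioo (c - r) (c + r) with hS
  have hSm : ∀ i, i ∈ S ↔ |ev i - c| < r := fun i => by
    simp only [hS, Finset.mem_filter, Finset.mem_univ, true_and, Set.mem_Ioo, abs_lt]
    constructor <;> rintro ⟨h1, h2⟩ <;> constructor <;> linarith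
  -- Inserting `0` keeps the maximum defined and nonnegative when the window contains no eigenvalue.
  set R : Finset ℝ := insert 0 (S.image fun i => |ev i - c|) with hR
  have hne : R.Nonempty := ⟨0, by simp [hR]⟩
  have hρ0 : 0 ≤ R.max' hne := R.le_max' 0 (by simp [hR])
  refine ⟨R.max' hne, ?_, hρ0, Submodule.span 𝕜 (Set.range fun i : S => v i), ?_, ?_, ?_⟩
  · rw [Finset.max'_lt_iff]
    intro y hy
    rcases Finset.mem_insert.1 hy with rfl | hy
    · exact hr
    · obtain ⟨i, hi, rfl⟩ := Finset.mem_image.1 hy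
      exact (hSm i).1 hi
  · rw [finrank_span_eq_card, eigCount_eq_card, Fintype.card_coe]
    exact (v.orthonormal.comp (fun i : S => (i : n)) Subtype.val_injective).linearIndependent
  · intro u hu
    have h0 : ∀ i ∉ S, inner 𝕜 (v i) u = 0 := by
      intro i hi
      induction hu using Submodule.span_induction with
      | mem x hx =>
        obtain ⟨j, rfl⟩ := hx
        exact v.orthonormal.2 (fun h => hi (h ▸ j.2))
      | zero => simp
      | add x y _ _ hx hy => rw [inner_add_right, hx, hy, add_zero]
      | smul a x _ hx => rw [inner_smul_right, hx, mul_zero]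
    refine abs_le_of_sq_le_sq' ?_ (by positivity) |>.2
    rw [norm_hermLin_sub_sq, mul_pow, ← v.sum_sq_norm_inner_right u, Finset.mul_sum]
    refine Finset.sum_le_sum fun i _ => ?_
    by_cases hi : i ∈ S
    · refine mul_le_mul_of_nonneg_right ?_ (by positivity)
      rw [← sq_abs]
      refine pow_le_pow_left₀ (abs_nonneg _) (R.le_max' _ ?_) 2
      exact Finset.mem_insert_of_mem (Finset.mem_image_of_mem _ hi)
    · rw [← hv, h0 i hi]; simp
  · intro b hb w hw u hu
    induction hu using Submodule.span_induction with
    | mem x hx =>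
      obtain ⟨j, rfl⟩ := hx
      have h1 := hermLin_isSymmetric A w (v j)
      rw [hw, hv, hermLin_eigenvectorBasis, inner_smul_left, inner_smul_right, RCLike.conj_ofReal,
        ← sub_eq_zero, ← sub_mul, ← RCLike.ofReal_sub] at h1
      rcases mul_eq_zero.1 h1 with h | h
      · exfalso
        have h2 : b = ev j := sub_eq_zero.1 (RCLike.ofReal_eq_zero.1 h)
        exact hb (h2 ▸ (Finset.mem_filter.1 j.2).2)
      · exact h
    | zero => simp
    | add x y _ _ hx hy => rw [inner_add_right, hx, hy, add_zero]
    | smul a x _ hx => rw [inner_smul_right, hx, mul_zero]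

/-- If the dimension exceeded the count, `U` would contain a nonzero vector orthogonal to all
eigenvectors of the window, and there `A - c` expands lengths by at least `r > ρ`. Together with
`exists_subspace_of_eigCount` this compares counts of different matrices through trial subspaces. -/
lemma finrank_le_eigCount (A : HermMat n 𝕜) (c : ℝ) {ρ r : ℝ} (hρ : ρ < r)
    (U : Submodule 𝕜 (EuclideanSpace 𝕜 n))
    (hU : ∀ u ∈ U, ‖hermLin A u - (c : 𝕜) • u‖ ≤ ρ * ‖u‖) :
    Module.finrank 𝕜 U ≤ eigCount A (Set.Ioo (c - r) (c + r)) := by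
  classical
  set v := (isHermitian_coe A).eigenvectorBasis with hv
  set ev := (isHermitian_coe A).eigenvalues with hev
  set S : Finset n := Finset.univ.filter fun i => ev i ∈ Set.Ioo (c - r) (c + r) with hS
  have hSm : ∀ i, i ∉ S → r ≤ |ev i - c| := fun i hi => by
    by_contra! h
    rw [abs_lt] at h
    refine hi ?_
    simp only [hS, Finset.mem_filter, Finset.mem_univ, true_and, Set.mem_Ioo]
    constructor <;> linarith
  let f : U →ₗ[𝕜] (S → 𝕜) :=
    LinearMap.pi fun i : S => (innerSL 𝕜 (v i)).toLinearMap ∘ₗ U.subtype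
  have hf : Function.Injective f := by
    rw [← LinearMap.ker_eq_bot, LinearMap.ker_eq_bot']
    intro u hu
    have h0 : ∀ i ∈ S, inner 𝕜 (v i) (u : EuclideanSpace 𝕜 n) = 0 := fun i hi =>
      congrFun hu ⟨i, hi⟩
    by_contra hne
    have hpos : 0 < ‖(u : EuclideanSpace 𝕜 n)‖ := norm_pos_iff.2 fun h => hne (Subtype.ext h)
    have h1 := hU u u.2
    have h2 : 0 ≤ ρ := by
      by_contra! h
      nlinarith [norm_nonneg (hermLin A (u : EuclideanSpace 𝕜 n) - (c : 𝕜) • u)]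
    have h3 : r ^ 2 * ‖(u : EuclideanSpace 𝕜 n)‖ ^ 2 ≤
        ‖hermLin A (u : EuclideanSpace 𝕜 n) - (c : 𝕜) • u‖ ^ 2 := by
      rw [norm_hermLin_sub_sq, ← v.sum_sq_norm_inner_right, Finset.mul_sum]
      refine Finset.sum_le_sum fun i _ => ?_
      by_cases hi : i ∈ S
      · rw [← hv, h0 i hi]; simp
      · refine mul_le_mul_of_nonneg_right ?_ (by positivity)
        rw [← sq_abs (_ - _)]
        exact pow_le_pow_left₀ (h2.trans hρ.le) (hSm i hi) 2
    have h4 := pow_le_pow_left₀ (norm_nonneg _) h1 2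
    rw [mul_pow] at h4
    have h5 : ρ ^ 2 < r ^ 2 := pow_lt_pow_left₀ hρ h2 (by norm_num)
    nlinarith [pow_pos hpos 2]
  have := LinearMap.finrank_le_finrank_of_injective hf
  rw [Module.finrank_fintype_fun_eq_card, Fintype.card_coe] at this
  rwa [eigCount_eq_card]

lemma norm_toEuclideanLin_le (B : Matrix n n 𝕜) (u : EuclideanSpace 𝕜 n) :
    ‖Matrix.toEuclideanLin B u‖ ≤ (∑ i, ∑ j, ‖B i j‖) * ‖u‖ := by
  have h1 : ‖Matrix.toEuclideanLin B u‖ ≤ ∑ i, ‖(Matrix.toEuclideanLin B u) i‖ := by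
    rw [EuclideanSpace.norm_eq]
    refine Real.sqrt_le_iff.2 ⟨by positivity, ?_⟩
    exact Finset.sum_sq_le_sq_sum_of_nonneg fun i _ => norm_nonneg _
  refine h1.trans ?_
  rw [Finset.sum_mul]
  refine Finset.sum_le_sum fun i _ => ?_
  rw [Finset.sum_mul, Matrix.toLpLin_apply]
  refine (norm_sum_le _ _).trans (Finset.sum_le_sum fun j _ => ?_)
  rw [norm_mul]
  exact mul_le_mul_of_nonneg_left (PiLp.norm_apply_le u j) (norm_nonneg _)

end EigCount

/-! ### Measurability of the eigenvalue count -/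

instance matrixBorelSpace (m n α : Type*) [Countable m] [Countable n] [TopologicalSpace α]
    [MeasurableSpace α] [SecondCountableTopology α] [BorelSpace α] : BorelSpace (Matrix m n α) :=
  inferInstanceAs (BorelSpace (m → n → α))

section Measurability

variable {n 𝕜 : Type*} [RCLike 𝕜] [Fintype n] [DecidableEq n]

/-- The spectral subspace of `A` is contracted with room `r - ρ` to spare, so it remains a trial
subspace for every nearby matrix. -/
lemma isOpen_le_eigCount_Ioo (c : ℝ) {r : ℝ} (hr : 0 < r) (k : ℕ) :
    IsOpen {A : HermMat n 𝕜 | k ≤ eigCount A (Set.Ioo (c - r) (c + r))} := by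
  rw [isOpen_iff_mem_nhds]
  intro A hA
  obtain ⟨ρ, hρ, -, U, hU, hUn, -⟩ := exists_subspace_of_eigCount A c hr
  have hcont : Continuous fun B : HermMat n 𝕜 =>
      ∑ i, ∑ j, ‖((B : Matrix n n 𝕜) - (A : Matrix n n 𝕜)) i j‖ := by
    refine continuous_finsetSum _ fun i _ => continuous_finsetSum _ fun j _ => ?_
    have h : Continuous fun B : HermMat n 𝕜 => (B : Matrix n n 𝕜) - (A : Matrix n n 𝕜) := by
      fun_prop
    exact (h.matrix_elem i j).norm
  have hev := hcont.tendsto A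
  simp only [sub_self, Matrix.zero_apply, norm_zero, Finset.sum_const_zero] at hev
  filter_upwards [hev.eventually (gt_mem_nhds (half_pos (sub_pos.2 hρ)))] with B hB
  refine le_trans (le_trans hA hU.ge) (finrank_le_eigCount B c (ρ := ρ + (r - ρ) / 2)
    (by linarith) U fun u hu => ?_)
  have h1 : hermLin B u - (c : 𝕜) • u = (hermLin A u - (c : 𝕜) • u)
      + Matrix.toEuclideanLin ((B : Matrix n n 𝕜) - (A : Matrix n n 𝕜)) u := by
    rw [map_sub, LinearMap.sub_apply]
    abel
  rw [h1, add_mul]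
  refine (norm_add_le _ _).trans (add_le_add (hUn u hu) ((norm_toEuclideanLin_le _ u).trans ?_))
  gcongr

/-- The eigenvalue counting measure. -/
noncomputable def eigMeasure (A : HermMat n 𝕜) : Measure ℝ :=
  ∑ i, Measure.dirac ((isHermitian_coe A).eigenvalues i)

instance (A : HermMat n 𝕜) : IsFiniteMeasure (eigMeasure A) := by
  rw [eigMeasure, ← Measure.sum_fintype]
  refine ⟨?_⟩
  simp

lemma eigMeasure_apply (A : HermMat n 𝕜) {I : Set ℝ} (hI : MeasurableSet I) :
    eigMeasure A I = eigCount A I := by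
  classical
  rw [eigMeasure, Measure.finsetSum_apply, eigCount_eq_card, Finset.card_filter]
  push_cast
  refine Finset.sum_congr rfl fun i _ => ?_
  rw [Measure.dirac_apply' _ hI, Set.indicator_apply]
  simp

variable [MeasurableSpace 𝕜] [BorelSpace 𝕜]

/-- Lower semicontinuity settles open intervals. Those with rational endpoints form a generating
π-system, and the counting measure has constant total mass, so every Borel set follows. -/
lemma measurable_eigCount {I : Set ℝ} (hI : MeasurableSet I) :
    Measurable fun A : HermMat n 𝕜 => eigCount A I := by
  have key : ∀ a b : ℝ, a < b → Measurable fun A : HermMat n 𝕜 => eigCount A (Set.Ioo a b) := by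
    intro a b hab
    refine measurable_of_Ici fun k => ?_
    have := (isOpen_le_eigCount_Ioo (n := n) (𝕜 := 𝕜) ((a + b) / 2) (half_pos (sub_pos.2 hab))
      k).measurableSet
    rw [show (a + b) / 2 - (b - a) / 2 = a by ring,
      show (a + b) / 2 + (b - a) / 2 = b by ring] at this
    exact this
  have hm : Measurable fun A : HermMat n 𝕜 => eigMeasure A := by
    refine Measurable.measure_of_isPiSystem
      ((BorelSpace.measurable_eq (α := ℝ)).trans Real.borel_eq_generateFrom_Ioo_rat)
      Real.isPiSystem_Ioo_rat ?_ ?_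
    · intro s hs
      simp only [Set.mem_iUnion, Set.mem_singleton_iff] at hs
      obtain ⟨a, b, hab, rfl⟩ := hs
      simp only [eigMeasure_apply _ measurableSet_Ioo]
      exact measurable_from_top.comp (key a b (by exact_mod_cast hab))
    · have : ∀ A : HermMat n 𝕜, eigMeasure A Set.univ = Fintype.card n := fun A => by
        rw [eigMeasure_apply _ MeasurableSet.univ, eigCount_eq_card]
        simp
      simp only [this, measurable_const]
  have h2 := (Measure.measurable_coe hI).comp hm
  have h3 : Measurable fun A : HermMat n 𝕜 => ((eigCount A I : ℕ) : ℝ≥0∞) := by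
    simpa only [Function.comp_def, eigMeasure_apply _ hI] using h2
  refine measurable_of_Ici fun k => ?_
  have h4 := measurableSet_le (measurable_const (a := (k : ℝ≥0∞))) h3
  simp only [Nat.cast_le] at h4
  exact h4

end Measurability

/-! ### Compression along a unit vector: interlacing and the limit of rank-one perturbations -/

section Compression

variable {n 𝕜 : Type*} [RCLike 𝕜] [Fintype n] [DecidableEq n]

/-- The orthogonal projection onto the span of a unit vector. -/
def rankOneProj (w : n → 𝕜) : HermMat n 𝕜 :=
  ⟨Matrix.vecMulVec w (star w), by
    rw [selfAdjoint.mem_iff, Matrix.star_eq_conjTranspose, Matrix.conjTranspose_vecMulVec,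
      star_star]⟩

/-- The compression of a matrix to the orthogonal complement of a unit vector `w`, extended by
`b` on `w`. -/
noncomputable def compress (w : n → 𝕜) (b : ℝ) (A : HermMat n 𝕜) : HermMat n 𝕜 :=
  ⟨(1 - (rankOneProj w : Matrix n n 𝕜)) * A * (1 - (rankOneProj w : Matrix n n 𝕜))
      + (b : 𝕜) • (rankOneProj w : Matrix n n 𝕜), by
    have h1 := (isHermitian_coe (rankOneProj w)).eq
    have h2 := (isHermitian_coe A).eq
    rw [selfAdjoint.mem_iff, Matrix.star_eq_conjTranspose]
    simp [Matrix.conjTranspose_mul, h1, h2, mul_assoc]⟩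

lemma hermLin_rankOneProj (w u : EuclideanSpace 𝕜 n) :
    hermLin (rankOneProj w.ofLp) u = inner 𝕜 w u • w := by
  rw [hermLin, Matrix.toLpLin_apply]
  ext i
  simp [rankOneProj, Matrix.vecMulVec_mulVec, PiLp.inner_apply, dotProduct, mul_comm,
    RCLike.inner_apply]

lemma hermLin_compress (w : EuclideanSpace 𝕜 n) (b : ℝ) (A : HermMat n 𝕜)
    (u : EuclideanSpace 𝕜 n) :
    hermLin (compress w.ofLp b A) u = hermLin A (u - inner 𝕜 w u • w)
      - inner 𝕜 w (hermLin A (u - inner 𝕜 w u • w)) • w + ((b : 𝕜) * inner 𝕜 w u) • w := by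
  have h1 : Matrix.toEuclideanLin (rankOneProj w.ofLp : Matrix n n 𝕜) u = inner 𝕜 w u • w :=
    hermLin_rankOneProj w u
  have h2 : ∀ x, Matrix.toEuclideanLin (1 - (rankOneProj w.ofLp : Matrix n n 𝕜)) x
      = x - inner 𝕜 w x • w := fun x => by
    rw [map_sub, LinearMap.sub_apply, ← hermLin_rankOneProj w x]
    simp
  rw [hermLin, compress, map_add, LinearMap.add_apply, map_smul, LinearMap.smul_apply, h1,
    Matrix.toLpLin_mul_same, Matrix.toLpLin_mul_same, LinearMap.comp_apply, LinearMap.comp_apply,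
    h2, h2, smul_smul]

lemma hermLin_add_smul_rankOneProj (w : EuclideanSpace 𝕜 n) (t : ℝ) (A : HermMat n 𝕜)
    (u : EuclideanSpace 𝕜 n) :
    hermLin (A + t • rankOneProj w.ofLp) u = hermLin A u + ((t : 𝕜) * inner 𝕜 w u) • w := by
  have : ((A + t • rankOneProj w.ofLp : HermMat n 𝕜) : Matrix n n 𝕜)
      = (A : Matrix n n 𝕜) + (t : 𝕜) • (rankOneProj w.ofLp : Matrix n n 𝕜) := by
    rw [AddSubgroup.coe_add]
    congr 1
    ext i j
    simp [RCLike.real_smul_eq_coe_mul]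
  rw [hermLin, this, map_add, LinearMap.add_apply, map_smul, LinearMap.smul_apply,
    ← smul_smul, ← hermLin_rankOneProj]

omit [DecidableEq n] in
lemma norm_sub_inner_smul_le {w : EuclideanSpace 𝕜 n} (hw : ‖w‖ = 1) (x : EuclideanSpace 𝕜 n) :
    ‖x - inner 𝕜 w x • w‖ ≤ ‖x‖ := by
  refine abs_le_of_sq_le_sq' ?_ (norm_nonneg _) |>.2
  have h1 : inner 𝕜 (x - inner 𝕜 w x • w) (inner 𝕜 w x • w) = 0 := by
    simp [inner_sub_left, inner_smul_left, inner_smul_right, inner_self_eq_norm_sq_to_K, hw]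
  have h2 := norm_add_sq_eq_norm_sq_add_norm_sq_of_inner_eq_zero _ _ h1
  rw [sub_add_cancel] at h2
  nlinarith [mul_self_nonneg ‖inner 𝕜 w x • w‖]

/-- Interlacing: a trial subspace loses at most one dimension when cut with the complement of `w`,
and there projecting off `w` does not increase `‖(A - c) u‖`. -/
lemma eigCount_sub_one_le_compress {w : EuclideanSpace 𝕜 n} (hw : ‖w‖ = 1) (b c : ℝ) {r : ℝ}
    (hr : 0 < r) (A : HermMat n 𝕜) :
    eigCount A (Set.Ioo (c - r) (c + r)) - 1
      ≤ eigCount (compress w.ofLp b A) (Set.Ioo (c - r) (c + r)) := by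
  obtain ⟨ρ, hρ, -, U, hU, hUn, -⟩ := exists_subspace_of_eigCount A c hr
  refine le_trans ?_ (finrank_le_eigCount _ c hρ (U ⊓ (𝕜 ∙ w)ᗮ) fun u hu => ?_)
  · have h1 := Submodule.finrank_sup_add_finrank_inf_eq U (𝕜 ∙ w)ᗮ
    have h2 := Submodule.finrank_add_finrank_orthogonal (𝕜 ∙ w)
    have h3 := Submodule.finrank_le (U ⊔ (𝕜 ∙ w)ᗮ)
    have h4 := finrank_span_singleton (K := 𝕜) (v := w) (by rintro rfl; simp at hw)
    omega
  · have h0 : inner 𝕜 w u = 0 := Submodule.mem_orthogonal_singleton_iff_inner_right.1 hu.2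
    refine le_trans (le_of_eq ?_) ((norm_sub_inner_smul_le hw _).trans (hUn u hu.1))
    rw [hermLin_compress, h0, inner_sub_right, inner_smul_right, h0]
    simp only [zero_smul, sub_zero, mul_zero, add_zero]
    congr 1
    abel

/-- A large multiple of the projection drives `w` out of the window and leaves the compression
behind. The value `c + r` is an endpoint of an open interval, so `w` is not counted and the spectral
subspace of the compression is orthogonal to `w`. -/
lemma exists_forall_eigCount_compress_le {w : EuclideanSpace 𝕜 n} (hw : ‖w‖ = 1) (c : ℝ) {r : ℝ}
    (hr : 0 < r) (A : HermMat n 𝕜) :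
    ∃ T : ℝ, ∀ t ≥ T, eigCount (compress w.ofLp (c + r) A) (Set.Ioo (c - r) (c + r))
      ≤ eigCount (A + t • rankOneProj w.ofLp) (Set.Ioo (c - r) (c + r)) := by
  obtain ⟨ρ, hρ, hρ0, U, hU, hUn, hUo⟩ :=
    exists_subspace_of_eigCount (compress w.ofLp (c + r) A) c hr
  have hww : inner 𝕜 w w = (1 : 𝕜) := by simp [inner_self_eq_norm_sq_to_K, hw]
  have hort : ∀ u ∈ U, inner 𝕜 w u = 0 := hUo (c + r) (by simp) w (by
    rw [hermLin_compress, hww]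
    simp)
  set κ := ‖hermLin A w‖ * ‖hermLin A w - (c : 𝕜) • w‖ with hκ
  have hκ0 : 0 ≤ κ := by positivity
  -- The trial vectors below have error at most `κ / t` times their norm; beyond this threshold that
  -- is at most half the gap `r - ρ`.
  refine ⟨2 * (κ + 1) / (r - ρ), fun t ht => ?_⟩
  have ht0 : 0 < t := lt_of_lt_of_le (div_pos (by positivity) (sub_pos.2 hρ)) ht
  have htκ : κ / t ≤ (r - ρ) / 2 := by
    rw [ge_iff_le, div_le_iff₀ (sub_pos.2 hρ)] at ht
    rw [div_le_iff₀ ht0]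
    nlinarith
  -- The correction along `w`, multiplied by `t`, cancels the component of `A u` along `w` exactly;
  -- what remains is of order `1 / t`.
  let f : EuclideanSpace 𝕜 n →ₗ[𝕜] EuclideanSpace 𝕜 n :=
    LinearMap.id - ((t : 𝕜)⁻¹) •
      ((innerSL 𝕜 (hermLin A w)).toLinearMap.smulRight w)
  have hf : ∀ u, f u = u - ((t : 𝕜)⁻¹ * inner 𝕜 (hermLin A w) u) • w := fun u => by
    simp [f, smul_smul]
  have hnorm : ∀ u ∈ U, ‖u‖ ≤ ‖f u‖ := by
    intro u hu
    have h := norm_sub_inner_smul_le hw (f u)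
    have h1 : inner 𝕜 w (f u) = -((t : 𝕜)⁻¹ * inner 𝕜 (hermLin A w) u) := by
      rw [hf, inner_sub_right, inner_smul_right, hort u hu, hww, zero_sub, mul_one]
    rwa [h1, neg_smul, sub_neg_eq_add, hf u, sub_add_cancel, ← hf u] at h
  have hinj : Function.Injective (f.domRestrict U) := by
    rw [← LinearMap.ker_eq_bot, LinearMap.ker_eq_bot']
    intro u hu
    have h := hnorm u u.2
    rw [show f u = 0 from hu, norm_zero] at h
    exact Subtype.ext (norm_le_zero_iff.1 h)
  have hrank : Module.finrank 𝕜 (U.map f) = Module.finrank 𝕜 U := by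
    rw [← LinearMap.range_domRestrict]
    exact LinearMap.finrank_range_of_inj hinj
  rw [← hU, ← hrank]
  refine finrank_le_eigCount _ c (ρ := ρ + (r - ρ) / 2) (by linarith) _ ?_
  rintro _ ⟨u, hu, rfl⟩
  have h1 : hermLin (A + t • rankOneProj w.ofLp) (f u) - (c : 𝕜) • f u
      = (hermLin (compress w.ofLp (c + r) A) u - (c : 𝕜) • u)
        - ((t : 𝕜)⁻¹ * inner 𝕜 (hermLin A w) u) • (hermLin A w - (c : 𝕜) • w) := by
    rw [hermLin_add_smul_rankOneProj, hermLin_compress, hort u hu, hf, inner_sub_right,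
      hort u hu, inner_smul_right, hww, ← hermLin_isSymmetric A w]
    simp only [map_sub, map_smul, zero_smul, sub_zero, mul_zero, add_zero, mul_one, zero_sub,
      smul_sub, mul_neg]
    rw [mul_inv_cancel_left₀ (by exact_mod_cast ht0.ne')]
    rw [smul_comm (c : 𝕜)]
    module
  rw [h1]
  have h2 : ‖((t : 𝕜)⁻¹ * inner 𝕜 (hermLin A w) u) • (hermLin A w - (c : 𝕜) • w)‖
      ≤ (r - ρ) / 2 * ‖u‖ := by
    rw [norm_smul, norm_mul, norm_inv, RCLike.norm_ofReal, abs_of_pos ht0]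
    calc t⁻¹ * ‖inner 𝕜 (hermLin A w) u‖ * ‖hermLin A w - (c : 𝕜) • w‖
        ≤ t⁻¹ * (‖hermLin A w‖ * ‖u‖) * ‖hermLin A w - (c : 𝕜) • w‖ := by
          gcongr
          exact norm_inner_le_norm _ _
      _ = κ / t * ‖u‖ := by rw [hκ]; field_simp
      _ ≤ _ := by gcongr
  calc _ ≤ ρ * ‖u‖ + (r - ρ) / 2 * ‖u‖ := (norm_sub_le _ _).trans (add_le_add (hUn u hu) h2)
    _ = (ρ + (r - ρ) / 2) * ‖u‖ := by ring
    _ ≤ _ := mul_le_mul_of_nonneg_left (hnorm u hu) (by linarith)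

end Compression

/-! ### Variation of the argument of a trigonometric polynomial -/

section TrigPolynomial

open Complex Polynomial in
lemma integral_circleMap_div_sub {z : ℂ} (hz : ‖z‖ ≠ 1) :
    ∫ θ in (0 : ℝ)..2 * Real.pi, circleMap 0 1 θ / (circleMap 0 1 θ - z)
      = if ‖z‖ < 1 then (2 * Real.pi : ℂ) else 0 := by
  have h1 : ∮ x in C(0, 1), (x - z)⁻¹
      = I * ∫ θ in (0 : ℝ)..2 * Real.pi, circleMap 0 1 θ / (circleMap 0 1 θ - z) := by
    rw [circleIntegral, ← intervalIntegral.integral_const_mul]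
    refine intervalIntegral.integral_congr fun θ _ => ?_
    simp only [deriv_circleMap, smul_eq_mul]
    ring
  have h2 : ∮ x in C(0, 1), (x - z)⁻¹ = I * if ‖z‖ < 1 then (2 * Real.pi : ℂ) else 0 := by
    split_ifs with h
    · rw [circleIntegral.integral_sub_inv_of_mem_ball (by simpa using h)]
      ring
    · rw [mul_zero]
      refine circleIntegral_eq_zero_of_differentiable_on_off_countable zero_le_one
        Set.countable_empty ?_ ?_
      · refine ContinuousOn.inv₀ (by fun_prop) fun x hx hxz => ?_
        rw [sub_eq_zero] at hxz
        subst hxz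
        have : ‖x‖ ≤ 1 := by simpa using hx
        exact hz (le_antisymm this (not_lt.1 h))
      · intro x hx
        refine DifferentiableAt.inv (by fun_prop) fun hxz => ?_
        rw [sub_eq_zero] at hxz
        subst hxz
        have : ‖x‖ < 1 := by simpa using hx.1
        exact h this
  rw [h1] at h2
  exact mul_left_cancel₀ I_ne_zero h2

lemma circleMap_sub_ne_zero {z : ℂ} (hz : ‖z‖ ≠ 1) (θ : ℝ) : circleMap 0 1 θ - z ≠ 0 := by
  intro h
  rw [sub_eq_zero] at h
  apply hz
  rw [← h]
  simp

/-- The right side is half the Poisson kernel. What matters is that its sign is constant on the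
circle and depends only on whether `z` is inside. -/
lemma re_circleMap_div_sub {z : ℂ} (hz : ‖z‖ ≠ 1) (θ : ℝ) :
    (circleMap 0 1 θ / (circleMap 0 1 θ - z)).re - 1 / 2
      = (1 - ‖z‖ ^ 2) / (2 * ‖circleMap 0 1 θ - z‖ ^ 2) := by
  have h0 := circleMap_sub_ne_zero hz θ
  have h1 : ‖circleMap 0 1 θ‖ = 1 := by simp
  set x := circleMap 0 1 θ
  have h2 : ‖x - z‖ ≠ 0 := norm_ne_zero_iff.2 h0
  have h3 : x.re ^ 2 + x.im ^ 2 = 1 := by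
    have := Complex.sq_norm x
    rw [h1, Complex.normSq_apply] at this
    linarith
  rw [Complex.div_re, Complex.normSq_eq_norm_sq]
  have h4 : ‖x - z‖ ^ 2 = (x.re - z.re) ^ 2 + (x.im - z.im) ^ 2 := by
    rw [Complex.sq_norm, Complex.normSq_apply]; simp; ring
  have h5 : ‖z‖ ^ 2 = z.re ^ 2 + z.im ^ 2 := by
    rw [Complex.sq_norm, Complex.normSq_apply]; ring
  have h6 : ‖x - z‖ ^ 2 ≠ 0 := pow_ne_zero 2 h2
  field_simp
  rw [h4, h5, Complex.sub_re, Complex.sub_im]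
  linear_combination h3

lemma continuous_circleMap_div_sub {z : ℂ} (hz : ‖z‖ ≠ 1) :
    Continuous fun θ => circleMap 0 1 θ / (circleMap 0 1 θ - z) :=
  (continuous_circleMap 0 1).div ((continuous_circleMap 0 1).sub continuous_const)
    (circleMap_sub_ne_zero hz)

/-- Since the sign is constant, the absolute value only affects the sign of the integral, which is
`2π - π` for `z` inside and `0 - π` for `z` outside. -/
lemma integral_abs_re_circleMap_div_sub {z : ℂ} (hz : ‖z‖ ≠ 1) :
    ∫ θ in (0 : ℝ)..2 * Real.pi, |(circleMap 0 1 θ / (circleMap 0 1 θ - z)).re - 1 / 2|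
      = Real.pi := by
  have hc := continuous_circleMap_div_sub hz
  have h1 : ∫ θ in (0 : ℝ)..2 * Real.pi, ((circleMap 0 1 θ / (circleMap 0 1 θ - z)).re - 1 / 2)
      = (if ‖z‖ < 1 then 2 * Real.pi else 0) - Real.pi := by
    have hcr : Continuous fun θ => (circleMap 0 1 θ / (circleMap 0 1 θ - z)).re :=
      Complex.continuous_re.comp hc
    rw [intervalIntegral.integral_sub (hcr.intervalIntegrable _ _)
      intervalIntegrable_const]
    have h2 := Complex.reCLM.intervalIntegral_comp_comm
      (hc.intervalIntegrable (μ := volume) 0 (2 * Real.pi))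
    simp only [Complex.reCLM_apply] at h2
    rw [h2, integral_circleMap_div_sub hz]
    congr 1
    · split_ifs <;> simp
    · simp
      ring
  rcases lt_or_gt_of_ne hz with h | h
  · rw [if_pos h] at h1
    refine Eq.trans ?_ (h1.trans (by ring))
    refine intervalIntegral.integral_congr fun θ _ => abs_of_nonneg ?_
    rw [re_circleMap_div_sub hz]
    have : ‖z‖ ^ 2 ≤ 1 := pow_le_one₀ (norm_nonneg _) h.le
    exact div_nonneg (by linarith) (by positivity)
  · rw [if_neg (not_lt.2 h.le), zero_sub] at h1
    refine Eq.trans ?_ ((congrArg Neg.neg h1).trans (neg_neg _))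
    rw [← intervalIntegral.integral_neg]
    refine intervalIntegral.integral_congr fun θ _ => abs_of_nonpos ?_
    rw [re_circleMap_div_sub hz]
    have : 1 ≤ ‖z‖ ^ 2 := one_le_pow₀ h.le
    exact div_nonpos_of_nonpos_of_nonneg (by linarith) (by positivity)

lemma integral_multiset_sum_abs (s : Multiset ℂ) (hs : ∀ z ∈ s, ‖z‖ ≠ 1) :
    (Continuous fun θ =>
      (s.map fun z => |(circleMap 0 1 θ / (circleMap 0 1 θ - z)).re - 1 / 2|).sum) ∧
    ∫ θ in (0 : ℝ)..2 * Real.pi,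
      (s.map fun z => |(circleMap 0 1 θ / (circleMap 0 1 θ - z)).re - 1 / 2|).sum
      = Multiset.card s * Real.pi := by
  induction s using Multiset.induction_on with
  | empty => exact ⟨by simpa using continuous_const, by simp⟩
  | cons a s ih =>
    obtain ⟨ih1, ih2⟩ := ih fun z hz => hs z (Multiset.mem_cons_of_mem hz)
    have ha := hs a (Multiset.mem_cons_self a s)
    have hc : Continuous fun θ => |(circleMap 0 1 θ / (circleMap 0 1 θ - a)).re - 1 / 2| :=
      ((Complex.continuous_re.comp (continuous_circleMap_div_sub ha)).sub continuous_const).abs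
    simp only [Multiset.map_cons, Multiset.sum_cons, Multiset.card_cons]
    refine ⟨hc.add ih1, ?_⟩
    rw [intervalIntegral.integral_add (hc.intervalIntegrable _ _) (ih1.intervalIntegrable _ _),
      integral_abs_re_circleMap_div_sub ha, ih2]
    push_cast
    ring

/-- The total variation of the argument of a trigonometric polynomial of degree two without
zeros is at most `4π`. -/
lemma integral_abs_re_logDeriv_le (p : Polynomial ℂ) (hp : p.natDegree ≤ 4)
    (h0 : ∀ θ, p.eval (circleMap 0 1 θ) ≠ 0) :
    ∫ θ in (0 : ℝ)..2 * Real.pi,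
      |(circleMap 0 1 θ * (p.derivative.eval (circleMap 0 1 θ) / p.eval (circleMap 0 1 θ)) - 2).re|
      ≤ 4 * Real.pi := by
  have hroot : ∀ z ∈ p.roots, ‖z‖ ≠ 1 := by
    intro z hz h1
    have h2 : z = circleMap 0 1 z.arg := by
      rw [circleMap_zero]
      conv_lhs => rw [← Complex.norm_mul_exp_arg_mul_I z, h1]
    exact h0 z.arg (h2 ▸ (Polynomial.isRoot_of_mem_roots hz))
  have hsp : p.Splits := IsAlgClosed.splits p
  obtain ⟨hc, hi⟩ := integral_multiset_sum_abs p.roots hroot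
  have hcard : (Multiset.card p.roots : ℝ) ≤ 4 := by
    exact_mod_cast p.card_roots'.trans hp
  -- Each root absorbs `1/2` of the shift `2`. If there are fewer than four roots, the leftover
  -- constant integrates to `π` for each missing root.
  have hpt : ∀ θ : ℝ,
      |(circleMap 0 1 θ * (p.derivative.eval (circleMap 0 1 θ) / p.eval (circleMap 0 1 θ)) - 2).re|
      ≤ (p.roots.map fun z => |(circleMap 0 1 θ / (circleMap 0 1 θ - z)).re - 1 / 2|).sum
        + (4 - (Multiset.card p.roots : ℝ)) / 2 := by
    intro θ
    rw [hsp.eval_derivative_div_eval_of_ne_zero (h0 θ), ← Multiset.sum_map_mul_left]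
    simp only [mul_one_div]
    generalize p.roots = s at hcard
    have h1 : ((s.map fun z => circleMap 0 1 θ / (circleMap 0 1 θ - z)).sum - 2 : ℂ).re
        = (s.map fun z => (circleMap 0 1 θ / (circleMap 0 1 θ - z)).re - 1 / 2).sum
          - (4 - (Multiset.card s : ℝ)) / 2 := by
      clear hcard
      induction s using Multiset.induction_on with
      | empty => norm_num
      | cons a s ih =>
        simp only [Multiset.map_cons, Multiset.sum_cons, Multiset.card_cons, Complex.sub_re,
          Complex.add_re] at ih ⊢
        push_cast
        linarith
    rw [h1]
    refine (abs_sub _ _).trans (add_le_add ?_ ?_)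
    · have := Multiset.abs_sum_le_sum_abs
        (s := s.map fun z => (circleMap 0 1 θ / (circleMap 0 1 θ - z)).re - 1 / 2)
      rwa [Multiset.map_map] at this
    · rw [abs_of_nonneg (by linarith)]
  have hcp : ∀ q : Polynomial ℂ, Continuous fun θ => q.eval (circleMap 0 1 θ) := fun q =>
    q.continuous.comp (continuous_circleMap 0 1)
  calc _ ≤ ∫ θ in (0 : ℝ)..2 * Real.pi,
        ((p.roots.map fun z => |(circleMap 0 1 θ / (circleMap 0 1 θ - z)).re - 1 / 2|).sum
          + (4 - (Multiset.card p.roots : ℝ)) / 2) := by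
        refine intervalIntegral.integral_mono_on (by positivity) ?_ ?_ fun θ _ => hpt θ
        · exact Continuous.intervalIntegrable (Complex.continuous_re.comp
            (((continuous_circleMap 0 1).mul ((hcp _).div (hcp _) h0)).sub
              continuous_const)).abs _ _
        · exact (hc.add continuous_const).intervalIntegrable _ _
    _ = 4 * Real.pi := by
        rw [intervalIntegral.integral_add (hc.intervalIntegrable _ _) (by simp), hi]
        simp
        ring

end TrigPolynomial

/-! ### Determinants of rank-two perturbations -/

section Jacobi

variable {n : Type*} [Fintype n] [DecidableEq n]

/-- Jacobi's formula: the determinant is multilinear in the rows, and replacing one row gives an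
entry of the adjugate product. -/
lemma hasDerivAt_det {M : ℝ → Matrix n n ℂ} {M' : Matrix n n ℂ} {θ : ℝ}
    (h : ∀ i j, HasDerivAt (fun t => M t i j) (M' i j) θ) :
    HasDerivAt (fun t => (M t).det) ((M θ).adjugate * M').trace θ := by
  let f : ContinuousMultilinearMap ℝ (fun _ : n => n → ℂ) ℂ :=
    { toMultilinearMap :=
        ((Matrix.detRowAlternating (R := ℂ) (n := n)).toMultilinearMap).restrictScalars ℝ
      cont := by
        change Continuous fun A : Matrix n n ℂ => A.det
        fun_prop }
  have hM : HasDerivAt (fun t => (fun i => M t i : n → n → ℂ)) (fun i => M' i) θ :=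
    hasDerivAt_pi.2 fun i => hasDerivAt_pi.2 fun j => h i j
  have h2 := (f.hasFDerivAt (fun i => M θ i)).comp_hasDerivAt θ hM
  refine h2.congr_deriv ?_
  rw [ContinuousMultilinearMap.linearDeriv_apply, Matrix.trace_mul_comm, Matrix.trace]
  refine Finset.sum_congr rfl fun i _ => ?_
  change ((M θ).updateRow i (M' i)).det = _
  rw [← Matrix.cramer_transpose_apply, Matrix.cramer_eq_adjugate_mulVec, ← Matrix.adjugate_transpose,
    Matrix.mulVec_transpose, Matrix.diag_apply]
  rfl

end Jacobi

section RankTwo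

/-- The self-adjoint matrix `w u* + u w*`. -/
def rankTwo {n 𝕜 : Type*} [RCLike 𝕜] (w u : n → 𝕜) : Matrix n n 𝕜 :=
  Matrix.vecMulVec w (star u) + Matrix.vecMulVec u (star w)

lemma rankTwo_isHermitian {n 𝕜 : Type*} [RCLike 𝕜] (w u : n → 𝕜) :
    (rankTwo w u).IsHermitian := by
  rw [Matrix.IsHermitian, rankTwo, Matrix.conjTranspose_add, Matrix.conjTranspose_vecMulVec,
    Matrix.conjTranspose_vecMulVec, star_star, star_star, add_comm]

variable {n : Type*} [Fintype n] [DecidableEq n]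

/-- The perturbation factors through a two-dimensional space, so the determinant lemma reduces the
question to a `2 × 2` determinant. -/
lemma det_add_rankTwo (K : Matrix n n ℂ) (hK : K.det ≠ 0) (w u : n → ℂ) :
    (K + rankTwo w u).det = K.det * ((1 + star u ⬝ᵥ (K⁻¹.mulVec w)) * (1 + star w ⬝ᵥ (K⁻¹.mulVec u))
      - (star u ⬝ᵥ (K⁻¹.mulVec u)) * (star w ⬝ᵥ (K⁻¹.mulVec w))) := by
  have h : rankTwo w u = (Matrix.of fun i (k : Fin 2) => ![w i, u i] k) *
      (Matrix.of fun (k : Fin 2) j => ![star u j, star w j] k) := by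
    ext i j
    simp [rankTwo, Matrix.mul_apply, Fin.sum_univ_two, Matrix.vecMulVec_apply]
  have hent : ∀ (a b : n → ℂ), (∑ x, (∑ x_1, a x_1 * K⁻¹ x_1 x) * b x)
      = a ⬝ᵥ (K⁻¹.mulVec b) := fun a b => by
    rw [Matrix.dotProduct_mulVec]
    rfl
  rw [h, Matrix.det_add_mul _ _ hK.isUnit, Matrix.det_fin_two]
  simp only [Matrix.add_apply, Matrix.mul_apply, Matrix.of_apply, Matrix.one_apply]
  simp [← hent]

/-- As `w` is fixed, the whole family is `rankTwo w` of a rotating vector, so the determinant is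
quadratic in cosine and sine. The factor `e^{2iθ}` clears the negative frequencies. -/
lemma exists_polynomial_det_rankTwo (K : Matrix n n ℂ) (hK : K.det ≠ 0) (w u v : n → ℂ) :
    ∃ p : Polynomial ℂ, p.natDegree ≤ 4 ∧ ∀ θ : ℝ,
      p.eval (circleMap 0 1 θ) = circleMap 0 1 θ ^ 2 *
        (K + ((Real.cos θ : ℂ) • rankTwo w u + (Real.sin θ : ℂ) • rankTwo w v)).det := by
  -- Below, `Cp` and `Sp` are `x cos θ` and `x sin θ` as polynomials in `x = e^{iθ}`.
  set q : (n → ℂ) → (n → ℂ) → ℂ := fun a b => star a ⬝ᵥ (K⁻¹.mulVec b) with hq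
  let Cp : Polynomial ℂ := Polynomial.C (1 / 2) * (Polynomial.X ^ 2 + 1)
  let Sp : Polynomial ℂ := Polynomial.C (-Complex.I / 2) * (Polynomial.X ^ 2 - 1)
  refine ⟨Polynomial.C K.det * ((Polynomial.X + (Polynomial.C (q u w) * Cp
      + Polynomial.C (q v w) * Sp)) * (Polynomial.X + (Polynomial.C (q w u) * Cp
      + Polynomial.C (q w v) * Sp)) - (Polynomial.C (q u u) * Cp ^ 2
      + Polynomial.C (q u v + q v u) * (Cp * Sp) + Polynomial.C (q v v) * Sp ^ 2)
      * Polynomial.C (q w w)), ?_, fun θ => ?_⟩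
  · simp only [Cp, Sp]
    compute_degree
  · have hc : (circleMap 0 1 θ) * (Real.cos θ : ℂ) = 1 / 2 * (circleMap 0 1 θ ^ 2 + 1) := by
      rw [circleMap_zero, Complex.exp_mul_I, ← Complex.ofReal_cos, ← Complex.ofReal_sin]
      have := congrArg (fun x : ℝ => (x : ℂ)) (Real.sin_sq_add_cos_sq θ)
      push_cast at this ⊢
      have hI := Complex.I_sq
      linear_combination ((1/2 : ℂ)) * this - (1/2 : ℂ) * Complex.sin θ ^ 2 * hI
    have hs : (circleMap 0 1 θ) * (Real.sin θ : ℂ)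
        = -Complex.I / 2 * (circleMap 0 1 θ ^ 2 - 1) := by
      rw [circleMap_zero, Complex.exp_mul_I, ← Complex.ofReal_cos, ← Complex.ofReal_sin]
      have := congrArg (fun x : ℝ => (x : ℂ)) (Real.sin_sq_add_cos_sq θ)
      push_cast at this ⊢
      have hI := Complex.I_sq
      linear_combination (Complex.I/2 : ℂ) * this + (Complex.cos θ * Complex.sin θ
        + Complex.I / 2 * Complex.sin θ ^ 2) * hI
    have hr : (Real.cos θ : ℂ) • rankTwo w u + (Real.sin θ : ℂ) • rankTwo w v
        = rankTwo w ((Real.cos θ : ℂ) • u + (Real.sin θ : ℂ) • v) := by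
      ext i j
      simp [rankTwo, Matrix.vecMulVec_apply, -Complex.ofReal_cos, -Complex.ofReal_sin]
      ring
    have hq1 : ∀ a, q ((Real.cos θ : ℂ) • u + (Real.sin θ : ℂ) • v) a
        = Real.cos θ * q u a + Real.sin θ * q v a := fun a => by
      simp [hq, add_dotProduct, -Complex.ofReal_cos, -Complex.ofReal_sin]
    have hq2 : ∀ a, q a ((Real.cos θ : ℂ) • u + (Real.sin θ : ℂ) • v)
        = Real.cos θ * q a u + Real.sin θ * q a v := fun a => by
      simp [hq, Matrix.mulVec_add, Matrix.mulVec_smul, -Complex.ofReal_cos, -Complex.ofReal_sin]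
    rw [hr, det_add_rankTwo K hK]
    change _ = _ * (K.det * ((1 + q _ w) * (1 + q w _) - q _ _ * q w w))
    rw [hq1, hq1, hq2, hq2, hq2]
    simp only [Cp, Sp, Polynomial.eval_mul, Polynomial.eval_C, Polynomial.eval_sub,
      Polynomial.eval_add, Polynomial.eval_pow, Polynomial.eval_X, Polynomial.eval_one, ← hc, ← hs]
    ring

/-- By Jacobi's formula the trace is the logarithmic derivative of the determinant in `θ`, and its
imaginary part is the derivative of the argument. The factor `e^{2iθ}` accounts for the `-2` in
`integral_abs_re_logDeriv_le`. -/
lemma integral_abs_im_trace_le (K : Matrix n n ℂ) (hK : K.det ≠ 0) (w u v : n → ℂ)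
    (h0 : ∀ θ : ℝ,
      (K + ((Real.cos θ : ℂ) • rankTwo w u + (Real.sin θ : ℂ) • rankTwo w v)).det ≠ 0) :
    ∫ θ in (0 : ℝ)..2 * Real.pi,
      |((K + ((Real.cos θ : ℂ) • rankTwo w u + (Real.sin θ : ℂ) • rankTwo w v))⁻¹
        * (-(Real.sin θ : ℂ) • rankTwo w u + (Real.cos θ : ℂ) • rankTwo w v)).trace.im|
      ≤ 4 * Real.pi := by
  obtain ⟨p, hp, hpd⟩ := exists_polynomial_det_rankTwo K hK w u v
  have hz : ∀ θ, circleMap 0 1 θ ≠ 0 := fun θ => circleMap_ne_center one_ne_zero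
  have hp0 : ∀ θ, p.eval (circleMap 0 1 θ) ≠ 0 := fun θ => by
    rw [hpd]
    exact mul_ne_zero (pow_ne_zero 2 (hz θ)) (h0 θ)
  refine le_trans (le_of_eq ?_) (integral_abs_re_logDeriv_le p hp hp0)
  refine intervalIntegral.integral_congr fun θ _ => ?_
  set M : ℝ → Matrix n n ℂ := fun θ =>
    K + ((Real.cos θ : ℂ) • rankTwo w u + (Real.sin θ : ℂ) • rankTwo w v) with hM
  set B : Matrix n n ℂ := -(Real.sin θ : ℂ) • rankTwo w u + (Real.cos θ : ℂ) • rankTwo w v with hB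
  have hd : HasDerivAt (fun t => (M t).det) ((M θ).adjugate * B).trace θ := by
    refine hasDerivAt_det fun i j => ?_
    have h1 := ((Real.hasDerivAt_cos θ).ofReal_comp.mul_const (rankTwo w u i j)).add
      ((Real.hasDerivAt_sin θ).ofReal_comp.mul_const (rankTwo w v i j))
    refine (h1.const_add (K i j)).congr_deriv ?_
    simp [hB]
  have hd2 : HasDerivAt (fun t => p.eval (circleMap 0 1 t))
      (p.derivative.eval (circleMap 0 1 θ) * (circleMap 0 1 θ * Complex.I)) θ :=
    (p.hasDerivAt (circleMap 0 1 θ)).comp θ (hasDerivAt_circleMap 0 1 θ)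
  have hd3 : HasDerivAt (fun t => circleMap 0 1 t ^ 2 * (M t).det)
      ((2 * circleMap 0 1 θ * (circleMap 0 1 θ * Complex.I)) * (M θ).det
        + circleMap 0 1 θ ^ 2 * ((M θ).adjugate * B).trace) θ := by
    have := ((hasDerivAt_circleMap 0 1 θ).pow 2).mul hd
    refine this.congr_deriv ?_
    simp
  have heq := hd2.unique ((funext hpd) ▸ hd3)
  have htr : ((M θ)⁻¹ * B).trace = (M θ).det⁻¹ * ((M θ).adjugate * B).trace := by
    rw [Matrix.inv_def, Ring.inverse_eq_inv', Matrix.smul_mul, Matrix.trace_smul, smul_eq_mul]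
  change |((M θ)⁻¹ * B).trace.im| = _
  have hfin : ((M θ)⁻¹ * B).trace = Complex.I * (circleMap 0 1 θ *
      (p.derivative.eval (circleMap 0 1 θ) / p.eval (circleMap 0 1 θ)) - 2) := by
    rw [htr]
    have h1 := hp0 θ
    have h2 : (M θ).det ≠ 0 := h0 θ
    have h3 := hz θ
    have h4 : p.eval (circleMap 0 1 θ) = circleMap 0 1 θ ^ 2 * (M θ).det := hpd θ
    rw [h4]
    field_simp
    have h5 : circleMap 0 1 θ * (circleMap 0 1 θ * ((M θ).adjugate * B).trace)
        = circleMap 0 1 θ * (Complex.I * (p.derivative.eval (circleMap 0 1 θ)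
          - 2 * circleMap 0 1 θ * (M θ).det)) := by
      linear_combination -heq
    have := mul_left_cancel₀ h3 h5
    linear_combination this
  rw [hfin, Complex.I_mul_im]

end RankTwo

/-! ### The imaginary part of the resolvent -/

section PoissonMatrix

variable {n 𝕜 : Type*} [RCLike 𝕜] [Fintype n] [DecidableEq n]

/-- The matrix `(H - e)² + η²`. -/
def shiftSq (e η : ℝ) (H : Matrix n n 𝕜) : Matrix n n 𝕜 :=
  (H - (e : 𝕜) • 1) * (H - (e : 𝕜) • 1) + ((η : 𝕜) ^ 2) • 1

/-- The imaginary part `η ((H - e)² + η²)⁻¹` of the resolvent `(H - e - iη)⁻¹`. -/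
noncomputable def imResolvent (e η : ℝ) (H : Matrix n n 𝕜) : Matrix n n 𝕜 :=
  (η : 𝕜) • (shiftSq e η H)⁻¹

omit [Fintype n] in
lemma sub_smul_one_isHermitian {H : Matrix n n 𝕜} (hH : H.IsHermitian) (e : ℝ) :
    (H - (e : 𝕜) • 1).IsHermitian := by
  rw [Matrix.IsHermitian, Matrix.conjTranspose_sub, hH.eq, Matrix.conjTranspose_smul]
  simp

lemma shiftSq_isHermitian {H : Matrix n n 𝕜} (hH : H.IsHermitian) (e η : ℝ) :
    (shiftSq e η H).IsHermitian := by
  rw [Matrix.IsHermitian, shiftSq, Matrix.conjTranspose_add, Matrix.conjTranspose_mul,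
    (sub_smul_one_isHermitian hH e).eq, Matrix.conjTranspose_smul]
  simp

open scoped ComplexOrder in
lemma shiftSq_det_ne_zero {H : Matrix n n 𝕜} (hH : H.IsHermitian) (e : ℝ) {η : ℝ} (hη : 0 < η) :
    (shiftSq e η H).det ≠ 0 := by
  have h1 : (shiftSq e η H).PosDef := by
    have h2 := Matrix.posSemidef_conjTranspose_mul_self (H - (e : 𝕜) • (1 : Matrix n n 𝕜))
    rw [(sub_smul_one_isHermitian hH e).eq] at h2
    refine Matrix.PosDef.posSemidef_add h2 ?_
    refine Matrix.PosDef.one.smul ?_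
    rw [← RCLike.ofReal_pow]
    exact_mod_cast pow_pos hη 2
  exact h1.det_pos.ne'

lemma imResolvent_isHermitian {H : Matrix n n 𝕜} (hH : H.IsHermitian) (e η : ℝ) :
    (imResolvent e η H).IsHermitian := by
  rw [Matrix.IsHermitian, imResolvent, Matrix.conjTranspose_smul,
    (shiftSq_isHermitian hH e η).inv.eq]
  simp

/-- The inverse is `(T + iη) (T² + η²)⁻¹` with `T = H - e`. The factors `T` and `(T² + η²)⁻¹`
commute, so the first summand has real trace against a Hermitian `B`. The embedding `σ` lets the
real and the complex case share one argument over `ℂ`. -/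
lemma im_trace_resolvent (σ : 𝕜 →+* ℂ) (hσ : ∀ x, σ (star x) = star (σ x))
    (hre : ∀ x, (σ x).re = RCLike.re x) {H B : Matrix n n 𝕜} (hH : H.IsHermitian)
    (hB : B.IsHermitian) (e : ℝ) {η : ℝ} (hη : 0 < η) :
    (H.map σ - (e + η * Complex.I) • (1 : Matrix n n ℂ)).det ≠ 0 ∧
    ((H.map σ - (e + η * Complex.I) • (1 : Matrix n n ℂ))⁻¹ * B.map σ).trace.im
      = RCLike.re (imResolvent e η H * B).trace := by
  have hσr : ∀ x : ℝ, σ (x : 𝕜) = x := fun x => by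
    have h1 : star (σ (x : 𝕜)) = σ (x : 𝕜) := by rw [← hσ]; simp
    apply Complex.ext
    · rw [hre]; simp
    · simpa using Complex.conj_eq_iff_im.1 h1
  have hu := (shiftSq_det_ne_zero hH e hη).isUnit
  set Y := (shiftSq e η H)⁻¹ with hY
  set T := H - (e : 𝕜) • (1 : Matrix n n 𝕜) with hT
  have hcomm : T * Y = Y * T := by
    have h1 : T * shiftSq e η H = shiftSq e η H * T := by
      rw [show shiftSq e η H = T * T + ((η : 𝕜) ^ 2) • 1 from rfl, mul_add, add_mul, mul_assoc,
        Matrix.mul_smul, Matrix.smul_mul, one_mul, mul_one]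
    calc T * Y = Y * (shiftSq e η H * T) * Y := by
          rw [← mul_assoc, Matrix.nonsing_inv_mul _ hu, one_mul]
      _ = Y * T := by rw [← h1, mul_assoc, mul_assoc, Matrix.mul_nonsing_inv _ hu, mul_one]
  have hTσ : H.map σ - (e : ℂ) • (1 : Matrix n n ℂ) = T.map σ := by
    ext i j
    simp only [hT, Matrix.map_apply, Matrix.sub_apply, Matrix.smul_apply, Matrix.one_apply,
      smul_eq_mul, map_sub, map_mul, hσr]
    split_ifs <;> simp
  have hmm : ∀ A C : Matrix n n 𝕜, (A * C).map σ = A.map σ * C.map σ := fun A C =>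
    Matrix.map_mul
  have hz : H.map σ - (e + η * Complex.I) • (1 : Matrix n n ℂ)
      = T.map σ - (η * Complex.I) • 1 := by
    rw [add_smul, ← hTσ, sub_sub]
  have hinv : (T.map σ - (η * Complex.I) • 1) * ((T.map σ + (η * Complex.I) • 1) * Y.map σ) = 1 := by
    have h1 : (shiftSq e η H).map σ = T.map σ * T.map σ + ((η : ℂ) ^ 2) • 1 := by
      rw [← hmm, show shiftSq e η H = T * T + ((η : 𝕜) ^ 2) • 1 from rfl]
      ext i j
      simp only [Matrix.map_apply, Matrix.add_apply, Matrix.smul_apply, Matrix.one_apply,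
        smul_eq_mul, map_add, map_mul, map_pow, hσr]
      split_ifs <;> simp
    have h2 : (T.map σ - (η * Complex.I) • 1) * (T.map σ + (η * Complex.I) • (1 : Matrix n n ℂ))
        = (shiftSq e η H).map σ := by
      rw [h1, sub_mul, mul_add, mul_add]
      simp only [Matrix.smul_mul, Matrix.mul_smul, one_mul, mul_one, smul_smul]
      have : (η * Complex.I * (η * Complex.I) : ℂ) = -(η : ℂ) ^ 2 := by
        linear_combination (η : ℂ) ^ 2 * Complex.I_sq
      rw [this, neg_smul]
      abel
    rw [← mul_assoc, h2, ← hmm, Matrix.mul_nonsing_inv _ hu]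
    simp
  rw [hz]
  refine ⟨fun h => ?_, ?_⟩
  · have := congrArg Matrix.det hinv
    rw [Matrix.det_mul, h, zero_mul, Matrix.det_one] at this
    exact zero_ne_one this
  rw [Matrix.inv_eq_right_inv hinv, add_mul, add_mul, Matrix.smul_mul, Matrix.smul_mul, one_mul,
    ← hmm, ← hmm, ← hmm, Matrix.trace_add, Matrix.trace_smul]
  have htr : ∀ A : Matrix n n 𝕜, (A.map σ).trace = σ A.trace := fun A => by
    simp [Matrix.trace]
  rw [htr, htr, Complex.add_im]
  have hreal : (σ (T * Y * B).trace).im = 0 := by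
    rw [← Complex.conj_eq_iff_im, ← Complex.star_def, ← hσ, ← Matrix.trace_conjTranspose,
      Matrix.conjTranspose_mul, Matrix.conjTranspose_mul, hB.eq,
      (shiftSq_isHermitian hH e η).inv.eq, (sub_smul_one_isHermitian hH e).eq, ← hY, ← hT,
      Matrix.trace_mul_comm, hcomm]
  rw [hreal, zero_add, imResolvent, Matrix.smul_mul, Matrix.trace_smul, smul_eq_mul, smul_eq_mul,
    RCLike.re_ofReal_mul, mul_assoc, ← hre, Complex.im_ofReal_mul,
    Complex.I_mul_im]

end PoissonMatrix

section ImResolvent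

variable {n 𝕜 : Type*} [RCLike 𝕜] [Fintype n] [DecidableEq n]

/-- Off the real axis the determinant of a shifted Hermitian matrix never vanishes, so the argument
bound applies. The bound does not depend on `K`, the vectors, `e` or `η`. -/
lemma integral_abs_re_trace_imResolvent_le (σ : 𝕜 →+* ℂ) (hσ : ∀ x, σ (star x) = star (σ x))
    (hre : ∀ x, (σ x).re = RCLike.re x) {K : Matrix n n 𝕜} (hK : K.IsHermitian)
    (w u v : n → 𝕜) (e : ℝ) {η : ℝ} (hη : 0 < η) :
    ∫ θ in (0 : ℝ)..2 * Real.pi,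
      |RCLike.re (imResolvent e η
          (K + ((Real.cos θ : 𝕜) • rankTwo w u + (Real.sin θ : 𝕜) • rankTwo w v))
        * (-(Real.sin θ : 𝕜) • rankTwo w u + (Real.cos θ : 𝕜) • rankTwo w v)).trace|
      ≤ 4 * Real.pi := by
  have hσr : ∀ x : ℝ, σ (x : 𝕜) = x := fun x => by
    have h1 : star (σ (x : 𝕜)) = σ (x : 𝕜) := by rw [← hσ]; simp
    apply Complex.ext
    · rw [hre]; simp
    · simpa using Complex.conj_eq_iff_im.1 h1
  have hsm : ∀ (r : ℝ) {A : Matrix n n 𝕜}, A.IsHermitian → ((r : 𝕜) • A).IsHermitian := by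
    intro r A hA
    rw [Matrix.IsHermitian, Matrix.conjTranspose_smul, hA.eq]
    simp
  have hr2 : ∀ x y : n → 𝕜, (rankTwo x y).map σ = rankTwo (fun i => σ (x i)) (fun i => σ (y i)) :=
    fun x y => by
      ext i j
      simp only [rankTwo, Matrix.map_apply, Matrix.add_apply, Matrix.vecMulVec_apply, Pi.star_apply,
        map_add, map_mul, hσ]
  set z : ℂ := e + η * Complex.I with hz
  have hmap : ∀ a b : ℝ, ((a : 𝕜) • rankTwo w u + (b : 𝕜) • rankTwo w v).map σ
      = (a : ℂ) • rankTwo (fun i => σ (w i)) (fun i => σ (u i))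
        + (b : ℂ) • rankTwo (fun i => σ (w i)) (fun i => σ (v i)) := fun a b => by
    rw [← hr2, ← hr2]
    ext i j
    simp only [Matrix.map_apply, Matrix.add_apply, Matrix.smul_apply, smul_eq_mul, map_add,
      map_mul, hσr]
  have hmap2 : ∀ a b : ℝ, (K + ((a : 𝕜) • rankTwo w u + (b : 𝕜) • rankTwo w v)).map σ
      - z • (1 : Matrix n n ℂ) = (K.map σ - z • (1 : Matrix n n ℂ))
      + ((a : ℂ) • rankTwo (fun i => σ (w i)) (fun i => σ (u i))
        + (b : ℂ) • rankTwo (fun i => σ (w i)) (fun i => σ (v i))) := fun a b => by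
    rw [Matrix.map_add σ (map_add σ), hmap]
    abel
  have hB : ∀ a b : ℝ, ((a : 𝕜) • rankTwo w u + (b : 𝕜) • rankTwo w v).IsHermitian := fun a b =>
    (hsm a (rankTwo_isHermitian w u)).add (hsm b (rankTwo_isHermitian w v))
  have key := fun θ : ℝ => im_trace_resolvent σ hσ hre (hK.add (hB (Real.cos θ) (Real.sin θ)))
    (hB (-Real.sin θ) (Real.cos θ)) e hη
  simp only [← hz, hmap, hmap2] at key
  have hK0 := (im_trace_resolvent σ hσ hre hK hK e hη).1
  refine le_trans (le_of_eq ?_) (integral_abs_im_trace_le (K.map σ - z • (1 : Matrix n n ℂ)) hK0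
    (fun i => σ (w i)) (fun i => σ (u i)) (fun i => σ (v i)) fun θ => (key θ).1)
  refine intervalIntegral.integral_congr fun θ _ => ?_
  have := (key θ).2
  push_cast at this ⊢
  simp only [this]

lemma imResolvent_eigenvectorBasis (A : HermMat n 𝕜) (e : ℝ) {η : ℝ} (hη : 0 < η) (i : n) :
    Matrix.toEuclideanLin (imResolvent e η (A : Matrix n n 𝕜))
      ((isHermitian_coe A).eigenvectorBasis i)
    = ((η / (((isHermitian_coe A).eigenvalues i - e) ^ 2 + η ^ 2) : ℝ) : 𝕜) •
      (isHermitian_coe A).eigenvectorBasis i := by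
  set x := (isHermitian_coe A).eigenvectorBasis i
  set l := (isHermitian_coe A).eigenvalues i
  have h1 : Matrix.toEuclideanLin ((A : Matrix n n 𝕜) - (e : 𝕜) • 1) x = ((l - e : ℝ) : 𝕜) • x := by
    rw [map_sub, LinearMap.sub_apply, hermLin_eigenvectorBasis, map_smul, LinearMap.smul_apply]
    simp [sub_smul]
    rfl
  have h2 : Matrix.toEuclideanLin (shiftSq e η (A : Matrix n n 𝕜)) x
      = (((l - e) ^ 2 + η ^ 2 : ℝ) : 𝕜) • x := by
    rw [shiftSq, map_add, LinearMap.add_apply, Matrix.toLpLin_mul_same, LinearMap.comp_apply, h1,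
      map_smul, h1, map_smul, LinearMap.smul_apply, smul_smul]
    simp [add_smul, sq]
  have hd : ((l - e) ^ 2 + η ^ 2 : ℝ) ≠ 0 := by positivity
  have h3 := congrArg (Matrix.toEuclideanLin (shiftSq e η (A : Matrix n n 𝕜))⁻¹) h2
  rw [← LinearMap.comp_apply, ← Matrix.toLpLin_mul_same, Matrix.nonsing_inv_mul _
    (shiftSq_det_ne_zero (isHermitian_coe A) e hη).isUnit, map_smul] at h3
  have h4 : Matrix.toEuclideanLin (shiftSq e η (A : Matrix n n 𝕜))⁻¹ x
      = (((l - e) ^ 2 + η ^ 2 : ℝ) : 𝕜)⁻¹ • x := by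
    rw [eq_inv_smul_iff₀ (by exact_mod_cast hd), ← h3]
    simp
  rw [imResolvent, map_smul, LinearMap.smul_apply, h4, smul_smul, div_eq_mul_inv,
    RCLike.ofReal_mul, RCLike.ofReal_inv]

/-- In the spectral expansion an eigenvalue within `η` of `e` has weight at least `1 / (2η)`, and
all other terms are nonnegative. -/
lemma sq_norm_inner_div_le_imResolvent (A : HermMat n 𝕜) (e : ℝ) {η : ℝ} (hη : 0 < η) {i : n}
    (hi : |(isHermitian_coe A).eigenvalues i - e| ≤ η) (x : EuclideanSpace 𝕜 n) :
    ‖inner 𝕜 ((isHermitian_coe A).eigenvectorBasis i) x‖ ^ 2 / (2 * η)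
      ≤ RCLike.re (inner 𝕜 x
        (Matrix.toEuclideanLin (imResolvent e η (A : Matrix n n 𝕜)) x)) := by
  set v := (isHermitian_coe A).eigenvectorBasis with hv
  have hs := Matrix.isSymmetric_toEuclideanLin_iff.2 (imResolvent_isHermitian (isHermitian_coe A) e η)
  rw [← v.sum_inner_mul_inner x, map_sum]
  have hterm : ∀ j, RCLike.re (inner 𝕜 x (v j) * inner 𝕜 (v j)
      (Matrix.toEuclideanLin (imResolvent e η (A : Matrix n n 𝕜)) x))
      = η / (((isHermitian_coe A).eigenvalues j - e) ^ 2 + η ^ 2) * ‖inner 𝕜 (v j) x‖ ^ 2 := by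
    intro j
    rw [← hs, hv, imResolvent_eigenvectorBasis A e hη, inner_smul_left, RCLike.conj_ofReal,
      mul_left_comm, RCLike.re_ofReal_mul, inner_mul_symm_re_eq_norm, norm_mul,
      norm_inner_symm, ← sq]
  simp only [hterm]
  refine le_trans ?_ (Finset.single_le_sum (f := fun j =>
    η / (((isHermitian_coe A).eigenvalues j - e) ^ 2 + η ^ 2) * ‖inner 𝕜 (v j) x‖ ^ 2)
    (fun j _ => by positivity) (Finset.mem_univ i))
  have h1 : ((isHermitian_coe A).eigenvalues i - e) ^ 2 ≤ η ^ 2 := sq_le_sq.2 (by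
    rwa [abs_of_pos hη])
  rw [div_eq_mul_inv, mul_comm]
  refine mul_le_mul_of_nonneg_right ?_ (by positivity)
  rw [inv_eq_one_div, div_le_div_iff₀ (by positivity) (by positivity)]
  nlinarith

end ImResolvent

/-- The real coordinates of a Hermitian matrix. -/
abbrev HermCoords (𝕜 : Type*) (N : ℕ) := (Fin N → ℝ) × (UpperPos N → 𝕜)

/-! ### Coordinates and the trace inner product -/

section Coordinates

variable {𝕜 : Type*} [RCLike 𝕜] {N : ℕ}

lemma hermOfCoords_apply (x : HermCoords 𝕜 N) (i j : Fin N) :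
    (hermOfCoords x : Matrix (Fin N) (Fin N) 𝕜) i j =
      if h : i < j then x.2 ⟨(i, j), h⟩
      else if h' : j < i then star (x.2 ⟨(j, i), h'⟩)
      else (x.1 i : 𝕜) := rfl

/-- The linear parametrization of Hermitian matrices by their diagonal and upper triangular
entries. -/
noncomputable def hermCoordsEquiv : HermCoords 𝕜 N ≃ₗ[ℝ] HermMat (Fin N) 𝕜 where
  toFun := hermOfCoords
  map_add' x y := by
    ext i j
    simp only [AddSubgroup.coe_add, Matrix.add_apply, hermOfCoords_apply]
    split_ifs <;> simp
  map_smul' c x := by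
    ext i j
    simp only [selfAdjoint.val_smul, Matrix.smul_apply, hermOfCoords_apply]
    split_ifs <;> simp [RCLike.real_smul_eq_coe_mul]
  invFun A := (fun i => RCLike.re ((A : Matrix (Fin N) (Fin N) 𝕜) i i),
    fun p => (A : Matrix (Fin N) (Fin N) 𝕜) p.1.1 p.1.2)
  left_inv x := by
    refine Prod.ext ?_ ?_
    · funext i
      simp [hermOfCoords_apply]
    · funext p
      simp [hermOfCoords_apply, p.2]
  right_inv A := by
    have hA := (isHermitian_coe A)
    ext i j
    rw [hermOfCoords_apply]
    split_ifs with h h'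
    · rfl
    · exact hA.apply i j
    · have : i = j := le_antisymm (not_lt.1 h') (not_lt.1 h)
      subst this
      exact hA.coe_re_apply_self i

lemma coe_hermCoordsEquiv :
    ⇑(hermCoordsEquiv : _ ≃ₗ[ℝ] HermMat (Fin N) 𝕜) = hermOfCoords := rfl

/-- The trace inner product of Hermitian matrices. -/
noncomputable def hermInner {n : Type*} [Fintype n] (A B : HermMat n 𝕜) : ℝ :=
  RCLike.re (Matrix.trace ((A : Matrix n n 𝕜) * (B : Matrix n n 𝕜)))

section HermInner

variable {n : Type*} [Fintype n]

lemma hermInner_comm (A B : HermMat n 𝕜) : hermInner A B = hermInner B A := by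
  rw [hermInner, Matrix.trace_mul_comm]; rfl

lemma hermInner_add_left (A B C : HermMat n 𝕜) :
    hermInner (A + B) C = hermInner A C + hermInner B C := by
  simp [hermInner, add_mul]

lemma hermInner_smul_left (t : ℝ) (A B : HermMat n 𝕜) :
    hermInner (t • A) B = t * hermInner A B := by
  simp [hermInner, RCLike.smul_re]

lemma hermInner_add_right (A B C : HermMat n 𝕜) :
    hermInner C (A + B) = hermInner C A + hermInner C B := by
  rw [hermInner_comm, hermInner_add_left, hermInner_comm A, hermInner_comm B]

lemma hermInner_smul_right (t : ℝ) (A B : HermMat n 𝕜) :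
    hermInner A (t • B) = t * hermInner A B := by
  rw [hermInner_comm, hermInner_smul_left, hermInner_comm B]

lemma hermInner_sub_left (A B C : HermMat n 𝕜) :
    hermInner (A - B) C = hermInner A C - hermInner B C := by
  simp [hermInner, sub_mul]

lemma hermInner_sub_right (A B C : HermMat n 𝕜) :
    hermInner C (A - B) = hermInner C A - hermInner C B := by
  rw [hermInner_comm, hermInner_sub_left, hermInner_comm A, hermInner_comm B]

lemma hermInner_self (A : HermMat n 𝕜) :
    hermInner A A = ∑ i, ∑ j, ‖(A : Matrix n n 𝕜) i j‖ ^ 2 := by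
  rw [hermInner, Matrix.trace, map_sum]
  refine Finset.sum_congr rfl fun i _ => ?_
  rw [Matrix.diag_apply, Matrix.mul_apply, map_sum]
  refine Finset.sum_congr rfl fun j _ => ?_
  rw [← (isHermitian_coe A).apply j i, RCLike.star_def, RCLike.mul_conj]
  norm_cast

lemma continuous_hermInner_left (A : HermMat n 𝕜) : Continuous (hermInner A) := by
  unfold hermInner
  refine RCLike.continuous_re.comp (Continuous.matrix_trace ?_)
  exact continuous_const.matrix_mul continuous_subtype_val

lemma continuous_hermInner_self : Continuous fun A : HermMat n 𝕜 => hermInner A A := by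
  unfold hermInner
  refine RCLike.continuous_re.comp (Continuous.matrix_trace ?_)
  exact continuous_subtype_val.matrix_mul continuous_subtype_val

end HermInner

lemma gaussWeight_eq (a : ℝ) (A : HermMat (Fin N) 𝕜) :
    gaussWeight a A = ENNReal.ofReal (Real.exp (-a * hermInner A A)) := by
  rw [gaussWeight, hermInner, sq]

end Coordinates

/-! ### Gaussian matrices: translation and first moments -/

section Gaussian

variable {𝕜 : Type*} [RCLike 𝕜] [MeasureSpace 𝕜] [BorelSpace 𝕜] {N : ℕ}

instance matrixSecondCountable (m n α : Type*) [Countable m] [Countable n] [TopologicalSpace α]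
    [SecondCountableTopology α] : SecondCountableTopology (Matrix m n α) :=
  inferInstanceAs (SecondCountableTopology (m → n → α))

lemma measurable_hermOfCoords :
    Measurable (hermOfCoords : HermCoords 𝕜 N → HermMat (Fin N) 𝕜) := by
  refine Measurable.subtype_mk (measurable_pi_lambda _ fun i => measurable_pi_lambda _ fun j => ?_)
  simp only [Matrix.of_apply]
  split_ifs
  · fun_prop
  · fun_prop
  · exact RCLike.continuous_ofReal.measurable.comp (by fun_prop)

lemma measurable_gaussWeight (a : ℝ) :
    Measurable (gaussWeight a : HermMat (Fin N) 𝕜 → ℝ≥0∞) := by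
  have : Continuous fun A : HermMat (Fin N) 𝕜 => Real.exp (-a * hermInner A A) :=
    Real.continuous_exp.comp (continuous_const.mul continuous_hermInner_self)
  rw [funext (gaussWeight_eq (𝕜 := 𝕜) (N := N) a)]
  exact this.measurable.ennreal_ofReal

lemma lintegral_gaussHerm (a : ℝ) {f : HermMat (Fin N) 𝕜 → ℝ≥0∞} (hf : Measurable f) :
    ∫⁻ A, f A ∂(gaussHerm 𝕜 N a) = (∫⁻ A, gaussWeight a A ∂(hermLebesgue 𝕜 N))⁻¹ *
      ∫⁻ A, gaussWeight a A * f A ∂(hermLebesgue 𝕜 N) := by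
  rw [gaussHerm, lintegral_smul_measure,
    lintegral_withDensity_eq_lintegral_mul _ (measurable_gaussWeight a) hf]
  rfl

variable [(volume : Measure 𝕜).IsAddHaarMeasure]

instance : (volume : Measure (HermCoords 𝕜 N)).IsAddHaarMeasure := by
  have h1 : (volume : Measure (Fin N → ℝ)).IsAddHaarMeasure := inferInstance
  have h2 : SigmaFinite (volume : Measure 𝕜) := inferInstance
  have h3 : (volume : Measure (UpperPos N → 𝕜)).IsAddHaarMeasure :=
    inferInstanceAs (Measure.pi fun _ : UpperPos N => (volume : Measure 𝕜)).IsAddHaarMeasure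
  exact inferInstanceAs ((volume : Measure (Fin N → ℝ)).prod
    (volume : Measure (UpperPos N → 𝕜))).IsAddHaarMeasure

lemma lintegral_add_hermLebesgue {f : HermMat (Fin N) 𝕜 → ℝ≥0∞} (hf : Measurable f)
    (S : HermMat (Fin N) 𝕜) :
    ∫⁻ A, f (A + S) ∂(hermLebesgue 𝕜 N) = ∫⁻ A, f A ∂(hermLebesgue 𝕜 N) := by
  have hS : Measurable fun A : HermMat (Fin N) 𝕜 => f (A + S) :=
    hf.comp (continuous_id.add continuous_const).measurable
  rw [hermLebesgue, lintegral_map hS measurable_hermOfCoords,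
    lintegral_map hf measurable_hermOfCoords,
    ← lintegral_add_right_eq_self (fun x => f (hermOfCoords x)) (hermCoordsEquiv.symm S)]
  refine lintegral_congr fun x => ?_
  rw [← coe_hermCoordsEquiv, map_add, LinearEquiv.apply_symm_apply]

/-- Translate by `t • S` and complete the square; no explicit normalising constant is needed. -/
lemma lintegral_exp_hermInner (a : ℝ) [IsProbabilityMeasure (gaussHerm 𝕜 N a)]
    (S : HermMat (Fin N) 𝕜) (t : ℝ) :
    ∫⁻ A, ENNReal.ofReal (Real.exp (2 * a * t * hermInner S A)) ∂(gaussHerm 𝕜 N a)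
      = ENNReal.ofReal (Real.exp (a * t ^ 2 * hermInner S S)) := by
  have hm : Measurable fun A : HermMat (Fin N) 𝕜 =>
      ENNReal.ofReal (Real.exp (2 * a * t * hermInner S A)) :=
    (Real.continuous_exp.comp (continuous_const.mul
      (continuous_hermInner_left S))).measurable.ennreal_ofReal
  have h1 : ∀ A : HermMat (Fin N) 𝕜, gaussWeight a (A + t • S) *
      ENNReal.ofReal (Real.exp (2 * a * t * hermInner S (A + t • S)))
      = ENNReal.ofReal (Real.exp (a * t ^ 2 * hermInner S S)) * gaussWeight a A := by
    intro A
    rw [gaussWeight_eq, gaussWeight_eq, ← ENNReal.ofReal_mul (Real.exp_pos _).le,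
      ← ENNReal.ofReal_mul (Real.exp_pos _).le, ← Real.exp_add, ← Real.exp_add]
    congr 2
    simp only [hermInner_add_left, hermInner_add_right, hermInner_smul_left, hermInner_smul_right,
      hermInner_comm A S]
    ring
  have h2 := lintegral_gaussHerm (𝕜 := 𝕜) (N := N) a (measurable_const (a := (1 : ℝ≥0∞)))
  simp only [mul_one, lintegral_const, measure_univ] at h2
  have h3 : Measurable fun A : HermMat (Fin N) 𝕜 => gaussWeight a A *
      ENNReal.ofReal (Real.exp (2 * a * t * hermInner S A)) := (measurable_gaussWeight a).mul hm
  rw [lintegral_gaussHerm a hm, ← lintegral_add_hermLebesgue h3 (t • S)]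
  simp only [h1]
  rw [lintegral_const_mul _ (measurable_gaussWeight a), mul_left_comm, ← h2, mul_one]

/-- With `x = cosh u` this reads `(x - 1) (2 - x) ≤ |u|`. It bounds `|u|` below by exponentials,
whose Gaussian means are known exactly. -/
lemma three_mul_cosh_le (u : ℝ) :
    3 / 2 * (Real.exp u + Real.exp (-u))
      ≤ |u| + 1 / 4 * (Real.exp (2 * u) + Real.exp (-(2 * u))) + 5 / 2 := by
  have h1 := Real.cosh_eq u
  have h2 : Real.exp (2 * u) = Real.exp u ^ 2 := by rw [sq, ← Real.exp_add]; ring_nf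
  have h3 : Real.exp (-(2 * u)) = Real.exp (-u) ^ 2 := by rw [sq, ← Real.exp_add]; ring_nf
  have h4 : Real.exp u * Real.exp (-u) = 1 := by rw [← Real.exp_add]; simp
  set x := Real.cosh u with hx
  have hx1 : 1 ≤ x := Real.one_le_cosh u
  have hxe : x ≤ Real.exp |u| := by
    rw [h1]
    have := Real.exp_le_exp.2 (le_abs_self u)
    have := Real.exp_le_exp.2 (neg_le_abs u)
    linarith
  have h5 : 1 - |u| ≤ Real.exp (-|u|) := by
    have := Real.add_one_le_exp (-|u|)
    linarith
  have h6 : Real.exp (-|u|) * x ≤ 1 := by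
    calc Real.exp (-|u|) * x ≤ Real.exp (-|u|) * Real.exp |u| := by gcongr
      _ = 1 := by rw [← Real.exp_add]; simp
  have h7 : (1 - |u|) * x ≤ 1 := le_trans (by gcongr) h6
  have h8 : x * (x - 1) * (2 - x) ≤ x * |u| := by nlinarith [sq_nonneg (x - 1)]
  have h9 : (x - 1) * (2 - x) ≤ |u| := by
    have : x * ((x - 1) * (2 - x)) ≤ x * |u| := by linarith
    exact le_of_mul_le_mul_left this (by linarith)
  nlinarith

/-- First absolute moments of the linear functionals of a Gaussian matrix are bounded from below
by their norms. -/
lemma sqrt_hermInner_le_lintegral {a : ℝ} (ha : 0 < a) [IsProbabilityMeasure (gaussHerm 𝕜 N a)]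
    (S : HermMat (Fin N) 𝕜) :
    ENNReal.ofReal (√(hermInner S S) / (24 * √a))
      ≤ ∫⁻ A, ENNReal.ofReal |hermInner S A| ∂(gaussHerm 𝕜 N a) := by
  rcases eq_or_lt_of_le (show 0 ≤ hermInner S S by rw [hermInner_self]; positivity) with h0 | h0
  · rw [← h0]; simp
  set s := √(hermInner S S) with hs
  have hs0 : 0 < s := Real.sqrt_pos.2 h0
  have hss : hermInner S S = s ^ 2 := (Real.sq_sqrt h0.le).symm
  set b := √a with hb
  have hb0 : 0 < b := Real.sqrt_pos.2 ha
  have hbb : a = b ^ 2 := (Real.sq_sqrt ha.le).symm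
  -- With this scale the exponential moment of order `k` is `e^{k²/16}`, whatever `S` is.
  set t := 1 / (4 * b * s) with ht
  have hE : ∀ k : ℝ, ∫⁻ A, ENNReal.ofReal (Real.exp (k * (2 * a * t * hermInner S A)))
      ∂(gaussHerm 𝕜 N a) = ENNReal.ofReal (Real.exp (k ^ 2 / 16)) := fun k => by
    have := lintegral_exp_hermInner (𝕜 := 𝕜) (N := N) a S (k * t)
    rw [show a * (k * t) ^ 2 * hermInner S S = k ^ 2 / 16 by
      rw [hss, hbb, ht]; field_simp; norm_num] at this
    rw [← this]
    refine lintegral_congr fun A => ?_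
    congr 2
    ring
  have hmE : ∀ k : ℝ, Measurable fun A : HermMat (Fin N) 𝕜 =>
      ENNReal.ofReal (Real.exp (k * (2 * a * t * hermInner S A))) := fun k =>
    (Real.continuous_exp.comp (continuous_const.mul (continuous_const.mul
      (continuous_hermInner_left S)))).measurable.ennreal_ofReal
  have hmA : Measurable fun A : HermMat (Fin N) 𝕜 => ENNReal.ofReal |hermInner S A| :=
    (continuous_hermInner_left S).abs.measurable.ennreal_ofReal
  have hpt : ∀ A : HermMat (Fin N) 𝕜,
      ENNReal.ofReal (3 / 2) * (ENNReal.ofReal (Real.exp (1 * (2 * a * t * hermInner S A)))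
        + ENNReal.ofReal (Real.exp ((-1) * (2 * a * t * hermInner S A))))
      ≤ ENNReal.ofReal (2 * a * t) * ENNReal.ofReal |hermInner S A|
        + ENNReal.ofReal (1 / 4) * (ENNReal.ofReal (Real.exp (2 * (2 * a * t * hermInner S A)))
          + ENNReal.ofReal (Real.exp ((-2) * (2 * a * t * hermInner S A))))
        + ENNReal.ofReal (5 / 2) := by
    intro A
    have h := three_mul_cosh_le (2 * a * t * hermInner S A)
    have hat : 0 ≤ 2 * a * t := by positivity
    rw [abs_mul, abs_of_nonneg hat] at h
    rw [← ENNReal.ofReal_add (by positivity) (by positivity),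
      ← ENNReal.ofReal_add (by positivity) (by positivity),
      ← ENNReal.ofReal_mul (by positivity), ← ENNReal.ofReal_mul (by positivity),
      ← ENNReal.ofReal_mul (by positivity), ← ENNReal.ofReal_add (by positivity) (by positivity),
      ← ENNReal.ofReal_add (by positivity) (by positivity)]
    refine ENNReal.ofReal_le_ofReal (le_trans (le_of_eq ?_) (h.trans (le_of_eq ?_))) <;> ring_nf
  have hmE2 : ∀ k l : ℝ, Measurable fun A : HermMat (Fin N) 𝕜 =>
      ENNReal.ofReal (Real.exp (k * (2 * a * t * hermInner S A)))
        + ENNReal.ofReal (Real.exp (l * (2 * a * t * hermInner S A))) := fun k l =>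
    (hmE k).add (hmE l)
  have hint := lintegral_mono (μ := gaussHerm 𝕜 N a) hpt
  rw [lintegral_const_mul _ (hmE2 1 (-1)), lintegral_add_left (hmE 1), hE, hE,
    lintegral_add_right _ measurable_const,
    lintegral_add_left (hmA.const_mul _), lintegral_const_mul _ hmA,
    lintegral_const_mul _ (hmE2 2 (-2)), lintegral_add_left (hmE 2), hE, hE,
    lintegral_const, measure_univ, mul_one] at hint
  rw [← ENNReal.ofReal_add (by positivity) (by positivity),
      ← ENNReal.ofReal_add (by positivity) (by positivity),
      ← ENNReal.ofReal_mul (by positivity), ← ENNReal.ofReal_mul (by positivity), add_assoc,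
      ← ENNReal.ofReal_add (by positivity) (by positivity)] at hint
  -- The estimates `e^{1/16} ≥ 17/16` and `e^{1/4} ≤ 4/3` leave exactly `1/48`, and dividing by `2 a
  -- t` gives `s / (24 √a)`.
  have hnum : (1 : ℝ) / 48 + (1 / 4 * (Real.exp (2 ^ 2 / 16) + Real.exp ((-2) ^ 2 / 16)) + 5 / 2)
      ≤ 3 / 2 * (Real.exp (1 ^ 2 / 16) + Real.exp ((-1) ^ 2 / 16)) := by
    have h1 := Real.add_one_le_exp (1 / 16 : ℝ)
    have h2 := Real.add_one_le_exp (-(1 / 4) : ℝ)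
    have h3 : Real.exp (1 / 4 : ℝ) * Real.exp (-(1 / 4) : ℝ) = 1 := by
      rw [← Real.exp_add]; simp
    have h4 : Real.exp (1 / 4 : ℝ) ≤ 4 / 3 := by nlinarith [Real.exp_pos (1 / 4 : ℝ)]
    norm_num at *
    linarith
  have h5 := (ENNReal.ofReal_le_ofReal hnum).trans hint
  rw [ENNReal.ofReal_add (by norm_num) (by positivity)] at h5
  have h6 := (ENNReal.add_le_add_iff_right ENNReal.ofReal_ne_top).1 h5
  have hat : 0 < 2 * a * t := by positivity
  calc ENNReal.ofReal (s / (24 * b)) = (ENNReal.ofReal (2 * a * t))⁻¹ * ENNReal.ofReal (1 / 48) := by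
        rw [← ENNReal.ofReal_inv_of_pos hat, ← ENNReal.ofReal_mul (by positivity)]
        congr 1
        rw [hbb, ht]
        field_simp
        norm_num
    _ ≤ (ENNReal.ofReal (2 * a * t))⁻¹ * (ENNReal.ofReal (2 * a * t) *
          ∫⁻ A, ENNReal.ofReal |hermInner S A| ∂(gaussHerm 𝕜 N a)) := by gcongr
    _ = _ := by
        rw [← mul_assoc, ENNReal.inv_mul_cancel (by simpa using hat) ENNReal.ofReal_ne_top, one_mul]

end Gaussian

/-! ### Invariance of a pair of Gaussian matrices under isometries -/

section Rotation

variable {𝕜 : Type*} [RCLike 𝕜] [MeasureSpace 𝕜] [BorelSpace 𝕜]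
  [(volume : Measure 𝕜).IsAddHaarMeasure] {N : ℕ}

instance : SFinite (hermLebesgue 𝕜 N) := by
  unfold hermLebesgue
  infer_instance

instance : BorelSpace (HermCoords 𝕜 N × HermCoords 𝕜 N) := Prod.borelSpace

/-- In coordinates a linear automorphism scales Haar measure. The factor may stay unspecified, since
total mass determines it in `lintegral_prod_gaussHerm_comp`. -/
lemma lintegral_prod_hermLebesgue_comp
    (L : (HermMat (Fin N) 𝕜 × HermMat (Fin N) 𝕜) ≃ₗ[ℝ] (HermMat (Fin N) 𝕜 × HermMat (Fin N) 𝕜))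
    (hLm : Measurable L) :
    ∃ c : ℝ≥0∞, ∀ F : HermMat (Fin N) 𝕜 × HermMat (Fin N) 𝕜 → ℝ≥0∞, Measurable F →
      ∫⁻ x, F (L x) ∂((hermLebesgue 𝕜 N).prod (hermLebesgue 𝕜 N))
        = c * ∫⁻ x, F x ∂((hermLebesgue 𝕜 N).prod (hermLebesgue 𝕜 N)) := by
  let h : (HermCoords 𝕜 N × HermCoords 𝕜 N) ≃ₗ[ℝ] (HermMat (Fin N) 𝕜 × HermMat (Fin N) 𝕜) :=
    hermCoordsEquiv.prodCongr hermCoordsEquiv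
  have hh : ⇑h = Prod.map hermOfCoords hermOfCoords := rfl
  have hhm : Measurable h := by
    rw [hh]
    exact measurable_hermOfCoords.prodMap measurable_hermOfCoords
  let L' : (HermCoords 𝕜 N × HermCoords 𝕜 N) ≃ₗ[ℝ] (HermCoords 𝕜 N × HermCoords 𝕜 N) := (h.trans L).trans h.symm
  have hν : (hermLebesgue 𝕜 N).prod (hermLebesgue 𝕜 N)
      = Measure.map h ((volume : Measure (HermCoords 𝕜 N)).prod (volume : Measure (HermCoords 𝕜 N))) := by
    rw [hermLebesgue, Measure.map_prod_map _ _ measurable_hermOfCoords measurable_hermOfCoords, hh]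
  have hdet : LinearMap.det (L' : (HermCoords 𝕜 N × HermCoords 𝕜 N) →ₗ[ℝ] (HermCoords 𝕜 N × HermCoords 𝕜 N)) ≠ 0 := L'.isUnit_det'.ne_zero
  have : ((volume : Measure (HermCoords 𝕜 N)).prod
      (volume : Measure (HermCoords 𝕜 N))).IsAddHaarMeasure :=
    Measure.prod.instIsAddHaarMeasure _ _
  have hmap := Measure.map_linearMap_addHaar_eq_smul_addHaar
    ((volume : Measure (HermCoords 𝕜 N)).prod (volume : Measure (HermCoords 𝕜 N))) hdet
  have hL'm : Measurable (L' : (HermCoords 𝕜 N × HermCoords 𝕜 N) →ₗ[ℝ] (HermCoords 𝕜 N × HermCoords 𝕜 N)) :=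
    (LinearMap.continuous_of_finiteDimensional _).measurable
  refine ⟨ENNReal.ofReal |(LinearMap.det (L' : (HermCoords 𝕜 N × HermCoords 𝕜 N) →ₗ[ℝ] (HermCoords 𝕜 N × HermCoords 𝕜 N)))⁻¹|, fun F hF => ?_⟩
  have hFh : Measurable fun y => F (h y) := hF.comp hhm
  have hFL : Measurable fun x => F (L x) := hF.comp hLm
  rw [hν, lintegral_map hFL hhm, lintegral_map hF hhm, ← smul_eq_mul,
    ← lintegral_smul_measure, ← hmap, lintegral_map hFh hL'm]
  refine lintegral_congr fun y => ?_
  simp [L']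

/-- The product of two copies of the Gaussian ensemble is invariant under the linear maps which
preserve the sum of the squared norms. -/
lemma lintegral_prod_gaussHerm_comp (a : ℝ) [IsProbabilityMeasure (gaussHerm 𝕜 N a)]
    (L : (HermMat (Fin N) 𝕜 × HermMat (Fin N) 𝕜) ≃ₗ[ℝ] (HermMat (Fin N) 𝕜 × HermMat (Fin N) 𝕜))
    (hLm : Measurable L)
    (hL : ∀ x, hermInner (L x).1 (L x).1 + hermInner (L x).2 (L x).2
      = hermInner x.1 x.1 + hermInner x.2 x.2)
    {F : HermMat (Fin N) 𝕜 × HermMat (Fin N) 𝕜 → ℝ≥0∞} (hF : Measurable F) :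
    ∫⁻ x, F (L x) ∂((gaussHerm 𝕜 N a).prod (gaussHerm 𝕜 N a))
      = ∫⁻ x, F x ∂((gaussHerm 𝕜 N a).prod (gaussHerm 𝕜 N a)) := by
  set c := (∫⁻ A, gaussWeight a A ∂(hermLebesgue 𝕜 N))⁻¹ with hc
  set G : HermMat (Fin N) 𝕜 × HermMat (Fin N) 𝕜 → ℝ≥0∞ :=
    fun x => gaussWeight a x.1 * gaussWeight a x.2 with hG
  have hGm : Measurable G := ((measurable_gaussWeight a).comp measurable_fst).mul
    ((measurable_gaussWeight a).comp measurable_snd)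
  have hGL : ∀ x, G (L x) = G x := fun x => by
    simp only [hG, gaussWeight_eq]
    rw [← ENNReal.ofReal_mul (Real.exp_pos _).le, ← ENNReal.ofReal_mul (Real.exp_pos _).le,
      ← Real.exp_add, ← Real.exp_add, ← mul_add, ← mul_add, hL]
  have hc0 : c ≠ ⊤ := by
    intro h
    have h2 := lintegral_gaussHerm (𝕜 := 𝕜) (N := N) a (measurable_const (a := (1 : ℝ≥0∞)))
    simp only [mul_one, lintegral_const, measure_univ] at h2
    rw [hc, ENNReal.inv_eq_top] at h
    rw [h, mul_zero] at h2
    exact one_ne_zero h2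
  have hint : ∀ f : HermMat (Fin N) 𝕜 × HermMat (Fin N) 𝕜 → ℝ≥0∞, Measurable f →
      ∫⁻ x, f x ∂((gaussHerm 𝕜 N a).prod (gaussHerm 𝕜 N a))
        = c * c * ∫⁻ x, G x * f x ∂((hermLebesgue 𝕜 N).prod (hermLebesgue 𝕜 N)) := by
    intro f hf
    have hprod : (gaussHerm 𝕜 N a).prod (gaussHerm 𝕜 N a)
        = (c * c) • ((hermLebesgue 𝕜 N).prod (hermLebesgue 𝕜 N)).withDensity G := by
      rw [hG, ← prod_withDensity (measurable_gaussWeight a) (measurable_gaussWeight a), gaussHerm,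
        ← hc, Measure.prod_smul_left, Measure.prod_smul_right, smul_smul]
    rw [hprod, lintegral_smul_measure, lintegral_withDensity_eq_lintegral_mul _ hGm hf]
    rfl
  obtain ⟨k, hk⟩ := lintegral_prod_hermLebesgue_comp L hLm
  have hkey : ∀ f : HermMat (Fin N) 𝕜 × HermMat (Fin N) 𝕜 → ℝ≥0∞, Measurable f →
      ∫⁻ x, f (L x) ∂((gaussHerm 𝕜 N a).prod (gaussHerm 𝕜 N a))
        = k * ∫⁻ x, f x ∂((gaussHerm 𝕜 N a).prod (gaussHerm 𝕜 N a)) := by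
    intro f hf
    have h1 : Measurable fun x => f (L x) := hf.comp hLm
    rw [hint _ h1, hint _ hf, mul_left_comm k, ← hk (fun x => G x * f x) (hGm.mul hf)]
    simp only [hGL]
  -- Both sides are probabilities, so testing on `1` forces the Jacobian factor to be `1`.
  have hk1 := hkey (fun _ => 1) measurable_const
  simp only [lintegral_const, measure_univ, mul_one] at hk1
  rw [hkey F hF, ← hk1, one_mul]

end Rotation

/-! ### The cross part along a unit vector and its rotations -/

section CrossPart

variable {n 𝕜 : Type*} [RCLike 𝕜] [Fintype n] [DecidableEq n]

/-- The part of a Hermitian matrix which is orthogonal to its compression to the orthogonal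
complement of `w`. -/
noncomputable def crossPart (w : n → 𝕜) : HermMat n 𝕜 →ₗ[ℝ] HermMat n 𝕜 where
  toFun A := A - compress w 0 A
  map_add' A B := by
    ext i j
    simp [compress, mul_add, add_mul]
    ring
  map_smul' t A := by
    ext i j
    simp [compress, RCLike.real_smul_eq_coe_mul]
    ring

lemma crossPart_apply (w : n → 𝕜) (A : HermMat n 𝕜) : crossPart w A = A - compress w 0 A := rfl

omit [DecidableEq n] in
lemma rankOneProj_mul_self {w : n → 𝕜} (hw : star w ⬝ᵥ w = 1) :
    (rankOneProj w : Matrix n n 𝕜) * (rankOneProj w : Matrix n n 𝕜) = rankOneProj w := by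
  simp [rankOneProj, Matrix.vecMulVec_mul_vecMulVec, hw]

lemma coe_compress_zero (w : n → 𝕜) (A : HermMat n 𝕜) :
    (compress w 0 A : Matrix n n 𝕜) = (1 - (rankOneProj w : Matrix n n 𝕜)) * A *
      (1 - (rankOneProj w : Matrix n n 𝕜)) := by
  simp [compress]

lemma compress_zero_idem {w : n → 𝕜} (hw : star w ⬝ᵥ w = 1) (A : HermMat n 𝕜) :
    compress w 0 (compress w 0 A) = compress w 0 A := by
  have hQ := rankOneProj_mul_self hw
  have hP : (1 - (rankOneProj w : Matrix n n 𝕜)) * (1 - (rankOneProj w : Matrix n n 𝕜))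
      = 1 - (rankOneProj w : Matrix n n 𝕜) := by
    simp [mul_sub, sub_mul, hQ]
  apply Subtype.ext
  rw [coe_compress_zero, coe_compress_zero]
  simp only [mul_assoc, hP]
  simp only [← mul_assoc, hP]

lemma hermInner_compress_zero {w : n → 𝕜} (hw : star w ⬝ᵥ w = 1) (A B : HermMat n 𝕜) :
    hermInner A (compress w 0 B) = hermInner (compress w 0 A) (compress w 0 B) := by
  have hQ := rankOneProj_mul_self hw
  have hP : (1 - (rankOneProj w : Matrix n n 𝕜)) * (1 - (rankOneProj w : Matrix n n 𝕜))
      = 1 - (rankOneProj w : Matrix n n 𝕜) := by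
    simp [mul_sub, sub_mul, hQ]
  rw [hermInner, hermInner, coe_compress_zero, coe_compress_zero]
  set P := 1 - (rankOneProj w : Matrix n n 𝕜)
  congr 1
  calc ((A : Matrix n n 𝕜) * (P * B * P)).trace
      = ((A : Matrix n n 𝕜) * (P * B * (P * P))).trace := by rw [hP]
    _ = (P * (A * (P * (B * P)))).trace := by
        rw [Matrix.trace_mul_comm P]
        simp only [mul_assoc]
    _ = _ := by
        conv_lhs => rw [← hP]
        simp only [mul_assoc, hP]
        simp only [← mul_assoc, hP]

/-- Compression to the complement of `w` is an orthogonal projection for the trace inner product,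
hence so is its complement `crossPart`. -/
lemma hermInner_crossPart {w : n → 𝕜} (hw : star w ⬝ᵥ w = 1) (A B : HermMat n 𝕜) :
    hermInner A (crossPart w B) = hermInner (crossPart w A) (crossPart w B) := by
  simp only [crossPart_apply, hermInner_sub_left, hermInner_sub_right]
  rw [hermInner_compress_zero hw A B, hermInner_comm (compress w 0 A) B,
    hermInner_compress_zero hw B A, hermInner_comm (compress w 0 B)]
  ring

lemma crossPart_idem {w : n → 𝕜} (hw : star w ⬝ᵥ w = 1) (A : HermMat n 𝕜) :
    crossPart w (crossPart w A) = crossPart w A := by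
  have h : compress w 0 (crossPart w A) = 0 := by
    have h1 : crossPart w (compress w 0 A) = 0 := by
      rw [crossPart_apply, compress_zero_idem hw, sub_self]
    have h2 : crossPart w (A - compress w 0 A) = crossPart w A := by
      rw [map_sub, h1, sub_zero]
    have h3 := crossPart_apply w (A - compress w 0 A)
    rw [h2, crossPart_apply, eq_comm, sub_eq_self] at h3
    rwa [crossPart_apply]
  rw [crossPart_apply w (crossPart w A), h, sub_zero]

lemma crossPart_eq_rankTwo (w : n → 𝕜) (A : HermMat n 𝕜) :
    ∃ u, (crossPart w A : Matrix n n 𝕜) = rankTwo w u := by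
  set y := (A : Matrix n n 𝕜).mulVec w with hy
  have hA := (isHermitian_coe A).eq
  have hQA : (rankOneProj w : Matrix n n 𝕜) * A = Matrix.vecMulVec w (star y) := by
    rw [rankOneProj, Matrix.vecMulVec_mul, hy, Matrix.star_mulVec, hA]
  have hAQ : (A : Matrix n n 𝕜) * (rankOneProj w : Matrix n n 𝕜) = Matrix.vecMulVec y (star w) := by
    rw [rankOneProj, Matrix.mul_vecMulVec]
  have hreal : star (star y ⬝ᵥ w) = star y ⬝ᵥ w := by
    have h1 : star y ⬝ᵥ w = star w ⬝ᵥ y := by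
      rw [hy, Matrix.star_mulVec, hA, ← Matrix.dotProduct_mulVec]
    rw [h1, ← Matrix.star_dotProduct, h1]
  have hQAQ : (rankOneProj w : Matrix n n 𝕜) * A * (rankOneProj w : Matrix n n 𝕜)
      = (star y ⬝ᵥ w) • Matrix.vecMulVec w (star w) := by
    rw [hQA, rankOneProj, Matrix.vecMulVec_mul_vecMulVec]
    ext i j
    simp [Matrix.vecMulVec_apply]
    ring
  -- With `Q = w w*` and `y = A w`, the cross part is `Q A + A Q - Q A Q`. The halved multiple of
  -- `w` enters twice and produces the last term; the symmetrisation works because the scalar is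
  -- real.
  refine ⟨y - ((star y ⬝ᵥ w) / 2) • w, ?_⟩
  rw [crossPart_apply, AddSubgroup.coe_sub, coe_compress_zero]
  have : (A : Matrix n n 𝕜) - (1 - (rankOneProj w : Matrix n n 𝕜)) * A *
      (1 - (rankOneProj w : Matrix n n 𝕜)) = (rankOneProj w : Matrix n n 𝕜) * A
      + A * (rankOneProj w : Matrix n n 𝕜) - (rankOneProj w : Matrix n n 𝕜) * A *
        (rankOneProj w : Matrix n n 𝕜) := by
    noncomm_ring
  rw [this, hQAQ, hQA, hAQ]
  have h2 : star ((star y ⬝ᵥ w) / 2) = (star y ⬝ᵥ w) / 2 := by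
    rw [star_div₀, hreal]; simp
  ext i j
  simp only [rankTwo, Matrix.add_apply, Matrix.sub_apply, Matrix.smul_apply,
    Matrix.vecMulVec_apply, Pi.star_apply, Pi.sub_apply, Pi.smul_apply, smul_eq_mul, star_sub,
    star_mul', h2]
  ring

lemma continuous_compress (w : n → 𝕜) (b : ℝ) : Continuous (compress w b) := by
  refine Continuous.subtype_mk ?_ _
  exact ((continuous_const.matrix_mul continuous_subtype_val).matrix_mul continuous_const).add
    continuous_const

lemma continuous_crossPart (w : n → 𝕜) : Continuous (crossPart w) :=
  continuous_id.sub (continuous_compress w 0)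

/-- Rotation by the angle `θ` of the cross parts of a pair of Hermitian matrices. -/
noncomputable def crossRotation (w : n → 𝕜) (c s : ℝ) :
    (HermMat n 𝕜 × HermMat n 𝕜) →ₗ[ℝ] (HermMat n 𝕜 × HermMat n 𝕜) :=
  let p := crossPart w ∘ₗ LinearMap.fst ℝ (HermMat n 𝕜) (HermMat n 𝕜)
  let q := crossPart w ∘ₗ LinearMap.snd ℝ (HermMat n 𝕜) (HermMat n 𝕜)
  (LinearMap.fst ℝ _ _ + ((c - 1) • p + s • q)).prod (LinearMap.snd ℝ _ _ + ((c - 1) • q - s • p))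

lemma crossRotation_apply (w : n → 𝕜) (c s : ℝ) (x : HermMat n 𝕜 × HermMat n 𝕜) :
    crossRotation w c s x
      = (x.1 + ((c - 1) • crossPart w x.1 + s • crossPart w x.2),
        x.2 + ((c - 1) • crossPart w x.2 - s • crossPart w x.1)) := rfl

lemma hermInner_crossRotation {w : n → 𝕜} (hw : star w ⬝ᵥ w = 1) {c s : ℝ} (hcs : c ^ 2 + s ^ 2 = 1)
    (x : HermMat n 𝕜 × HermMat n 𝕜) :
    hermInner (crossRotation w c s x).1 (crossRotation w c s x).1
      + hermInner (crossRotation w c s x).2 (crossRotation w c s x).2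
      = hermInner x.1 x.1 + hermInner x.2 x.2 := by
  rw [crossRotation_apply]
  simp only [hermInner_add_left, hermInner_add_right, hermInner_sub_left, hermInner_sub_right,
    hermInner_smul_left, hermInner_smul_right]
  rw [hermInner_comm (crossPart w x.1) x.1, hermInner_comm (crossPart w x.2) x.1,
    hermInner_comm (crossPart w x.1) x.2, hermInner_comm (crossPart w x.2) x.2,
    hermInner_crossPart hw x.1 x.1, hermInner_crossPart hw x.1 x.2, hermInner_crossPart hw x.2 x.1,
    hermInner_crossPart hw x.2 x.2, hermInner_comm (crossPart w x.2) (crossPart w x.1)]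
  linear_combination (hermInner (crossPart w x.1) (crossPart w x.1)
    + hermInner (crossPart w x.2) (crossPart w x.2)) * hcs

lemma crossRotation_comp {w : n → 𝕜} (hw : star w ⬝ᵥ w = 1) {c s : ℝ} (hcs : c ^ 2 + s ^ 2 = 1) :
    crossRotation w c s ∘ₗ crossRotation w c (-s) = LinearMap.id := by
  refine LinearMap.ext fun x => ?_
  rw [LinearMap.comp_apply, crossRotation_apply, crossRotation_apply]
  simp only [map_add, map_sub, map_smul, crossPart_idem hw, LinearMap.id_coe, id]
  have hs : s * s = 1 - c * c := by linarith
  refine Prod.ext ?_ ?_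
  · simp only
    match_scalars <;> linarith
  · simp only
    match_scalars <;> linarith

/-- `crossRotation` as a linear automorphism. -/
noncomputable def crossRotationEquiv {w : n → 𝕜} (hw : star w ⬝ᵥ w = 1) {c s : ℝ}
    (hcs : c ^ 2 + s ^ 2 = 1) :
    (HermMat n 𝕜 × HermMat n 𝕜) ≃ₗ[ℝ] (HermMat n 𝕜 × HermMat n 𝕜) :=
  LinearEquiv.ofLinearMap (crossRotation w c s) (crossRotation w c (-s)) (crossRotation_comp hw hcs)
    (by simpa using crossRotation_comp (c := c) (s := -s) hw (by simpa using hcs))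

end CrossPart

/-! ### Blocks inside the full matrix, and the rotation argument -/

section Sandwich

variable {n m 𝕜 : Type*} [RCLike 𝕜] [Fintype n] [Fintype m]

/-- The Hermitian matrix `U V U*`. -/
def sandwich (U : Matrix n m 𝕜) (V : HermMat m 𝕜) : HermMat n 𝕜 :=
  ⟨U * (V : Matrix m m 𝕜) * U.conjTranspose, by
    rw [selfAdjoint.mem_iff, Matrix.star_eq_conjTranspose, Matrix.conjTranspose_mul,
      Matrix.conjTranspose_mul, Matrix.conjTranspose_conjTranspose, (isHermitian_coe V).eq,
      Matrix.mul_assoc]⟩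

omit [Fintype n] in
lemma coe_sandwich (U : Matrix n m 𝕜) (V : HermMat m 𝕜) :
    (sandwich U V : Matrix n n 𝕜) = U * (V : Matrix m m 𝕜) * U.conjTranspose := rfl

omit [Fintype n] in
lemma continuous_sandwich (U : Matrix n m 𝕜) : Continuous (sandwich U) := by
  refine Continuous.subtype_mk ?_ _
  exact (continuous_const.matrix_mul continuous_subtype_val).matrix_mul continuous_const

lemma hermInner_sandwich (U : Matrix n m 𝕜) (A : HermMat n 𝕜) (B : HermMat m 𝕜) :
    hermInner (sandwich U.conjTranspose A) B = hermInner A (sandwich U B) := by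
  rw [hermInner, hermInner, coe_sandwich, coe_sandwich, Matrix.conjTranspose_conjTranspose]
  congr 1
  calc (U.conjTranspose * (A : Matrix n n 𝕜) * U * (B : Matrix m m 𝕜)).trace
      = (U.conjTranspose * ((A : Matrix n n 𝕜) * U * (B : Matrix m m 𝕜))).trace := by
        simp only [Matrix.mul_assoc]
    _ = _ := by
        rw [Matrix.trace_mul_comm]
        simp only [Matrix.mul_assoc]

omit [Fintype n] in
lemma mul_rankTwo_mul (U : Matrix n m 𝕜) (w u : m → 𝕜) :
    U * rankTwo w u * U.conjTranspose = rankTwo (U.mulVec w) (U.mulVec u) := by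
  rw [rankTwo, rankTwo, Matrix.mul_add, Matrix.add_mul, Matrix.mul_vecMulVec,
    Matrix.vecMulVec_mul, Matrix.mul_vecMulVec, Matrix.vecMulVec_mul, Matrix.star_mulVec,
    Matrix.star_mulVec]

end Sandwich

section Continuity

variable {n 𝕜 : Type*} [RCLike 𝕜] [Fintype n] [DecidableEq n]

/-- The imaginary part of the resolvent as a Hermitian matrix. -/
noncomputable def hermImResolvent (e η : ℝ) (A : HermMat n 𝕜) : HermMat n 𝕜 :=
  ⟨imResolvent e η (A : Matrix n n 𝕜), imResolvent_isHermitian (isHermitian_coe A) e η⟩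

lemma continuous_hermImResolvent (e : ℝ) {η : ℝ} (hη : 0 < η) :
    Continuous (hermImResolvent e η : HermMat n 𝕜 → HermMat n 𝕜) := by
  have h1 : Continuous fun A : HermMat n 𝕜 => shiftSq e η (A : Matrix n n 𝕜) := by
    have h2 : Continuous fun A : HermMat n 𝕜 => (A : Matrix n n 𝕜) - (e : 𝕜) • (1 : Matrix n n 𝕜) :=
      continuous_subtype_val.sub continuous_const
    exact (h2.matrix_mul h2).add continuous_const
  refine Continuous.subtype_mk ?_ _
  simp only [imResolvent, Matrix.inv_def, Ring.inverse_eq_inv']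
  have h3 : Continuous fun A : HermMat n 𝕜 => (shiftSq e η (A : Matrix n n 𝕜)).det⁻¹ :=
    h1.matrix_det.inv₀ fun A => shiftSq_det_ne_zero (isHermitian_coe A) e hη
  have h4 : Continuous fun A : HermMat n 𝕜 => (shiftSq e η (A : Matrix n n 𝕜)).det⁻¹ •
      (shiftSq e η (A : Matrix n n 𝕜)).adjugate := h3.smul h1.matrix_adjugate
  exact h4.const_smul (η : 𝕜)

omit [DecidableEq n] in
lemma continuous_hermInner :
    Continuous fun x : HermMat n 𝕜 × HermMat n 𝕜 => hermInner x.1 x.2 := by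
  unfold hermInner
  refine RCLike.continuous_re.comp (Continuous.matrix_trace ?_)
  exact (continuous_subtype_val.comp continuous_fst).matrix_mul
    (continuous_subtype_val.comp continuous_snd)

instance : ContinuousSMul ℝ (HermMat n 𝕜) where
  continuous_smul := by
    refine Continuous.subtype_mk ?_ _
    exact continuous_fst.smul (continuous_subtype_val.comp continuous_snd)

lemma continuous_crossRotation (w : n → 𝕜) :
    Continuous fun x : ℝ × (HermMat n 𝕜 × HermMat n 𝕜) =>
      crossRotation w (Real.cos x.1) (Real.sin x.1) x.2 := by
  have h1 : Continuous fun x : ℝ × (HermMat n 𝕜 × HermMat n 𝕜) => crossPart w x.2.1 :=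
    (continuous_crossPart w).comp (continuous_fst.comp continuous_snd)
  have h2 : Continuous fun x : ℝ × (HermMat n 𝕜 × HermMat n 𝕜) => crossPart w x.2.2 :=
    (continuous_crossPart w).comp (continuous_snd.comp continuous_snd)
  have h3 : Continuous fun x : ℝ × (HermMat n 𝕜 × HermMat n 𝕜) => Real.cos x.1 :=
    Real.continuous_cos.comp continuous_fst
  have h4 : Continuous fun x : ℝ × (HermMat n 𝕜 × HermMat n 𝕜) => Real.sin x.1 :=
    Real.continuous_sin.comp continuous_fst
  simp only [crossRotation_apply]
  exact ((continuous_fst.comp continuous_snd).add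
    (((h3.sub continuous_const).smul h1).add (h4.smul h2))).prodMk
    ((continuous_snd.comp continuous_snd).add
    (((h3.sub continuous_const).smul h2).sub (h4.smul h1)))

end Continuity

section Block

variable {n 𝕜 : Type*} [RCLike 𝕜] [Fintype n] [DecidableEq n] {N : ℕ}

/-- The rotation changes the first matrix only in its cross part, so weights that factor through the
compression are constant along the orbit. -/
lemma compress_crossRotation_fst {w : Fin N → 𝕜} (hw : star w ⬝ᵥ w = 1) (c s : ℝ)
    (x : HermMat (Fin N) 𝕜 × HermMat (Fin N) 𝕜) :
    compress w 0 (crossRotation w c s x).1 = compress w 0 x.1 := by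
  have h1 : ∀ A, compress w 0 A = A - crossPart w A := fun A => by
    rw [crossPart_apply, sub_sub_cancel]
  rw [h1, h1, crossRotation_apply]
  simp only [map_add, map_smul, crossPart_idem hw]
  abel

/-- The cross part of the second rotated matrix is the `θ`-derivative of the first rotated matrix,
so the integrand is the speed of the argument of the determinant. -/
lemma integral_abs_hermInner_crossRotation_le (σ : 𝕜 →+* ℂ)
    (hσ : ∀ x, σ (star x) = star (σ x)) (hre : ∀ x, (σ x).re = RCLike.re x)
    (A : HermMat n 𝕜) (U : Matrix n (Fin N) 𝕜) {w : Fin N → 𝕜} (hw : star w ⬝ᵥ w = 1)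
    (e : ℝ) {η : ℝ} (hη : 0 < η) (x : HermMat (Fin N) 𝕜 × HermMat (Fin N) 𝕜) :
    ∫ θ in (0 : ℝ)..2 * Real.pi,
      |hermInner (hermImResolvent e η
          (A + sandwich U (crossRotation w (Real.cos θ) (Real.sin θ) x).1))
        (sandwich U (crossPart w (crossRotation w (Real.cos θ) (Real.sin θ) x).2))|
      ≤ 4 * Real.pi := by
  obtain ⟨u, hu⟩ := crossPart_eq_rankTwo w x.1
  obtain ⟨v, hv⟩ := crossPart_eq_rankTwo w x.2
  refine le_trans (le_of_eq ?_) (integral_abs_re_trace_imResolvent_le σ hσ hre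
    (isHermitian_coe (A + sandwich U (compress w 0 x.1))) (U.mulVec w) (U.mulVec u) (U.mulVec v)
    e hη)
  refine intervalIntegral.integral_congr fun θ _ => ?_
  have hsm : ∀ (r : ℝ) (B : Matrix (Fin N) (Fin N) 𝕜), U * (r • B) * U.conjTranspose
      = (r : 𝕜) • (U * B * U.conjTranspose) := fun r B => by
    have : r • B = (r : 𝕜) • B := by
      ext i j
      simp [RCLike.real_smul_eq_coe_mul]
    rw [this, Matrix.mul_smul, Matrix.smul_mul]
  have h1 : ((A + sandwich U (crossRotation w (Real.cos θ) (Real.sin θ) x).1 : HermMat n 𝕜) :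
      Matrix n n 𝕜) = ((A + sandwich U (compress w 0 x.1) : HermMat n 𝕜) : Matrix n n 𝕜)
      + ((Real.cos θ : 𝕜) • rankTwo (U.mulVec w) (U.mulVec u)
        + (Real.sin θ : 𝕜) • rankTwo (U.mulVec w) (U.mulVec v)) := by
    rw [AddSubgroup.coe_add, AddSubgroup.coe_add, coe_sandwich, coe_sandwich, ← mul_rankTwo_mul,
      ← mul_rankTwo_mul, ← hu, ← hv, ← hsm, ← hsm, ← Matrix.add_mul, ← Matrix.mul_add,
      add_assoc, ← Matrix.add_mul, ← Matrix.mul_add, crossRotation_apply]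
    have : compress w 0 x.1 = x.1 - crossPart w x.1 := by rw [crossPart_apply, sub_sub_cancel]
    congr 3
    rw [this]
    simp only [AddSubgroup.coe_add, AddSubgroup.coe_sub, selfAdjoint.val_smul, sub_smul, one_smul]
    abel
  have h2 : (sandwich U (crossPart w (crossRotation w (Real.cos θ) (Real.sin θ) x).2) :
      Matrix n n 𝕜) = -(Real.sin θ : 𝕜) • rankTwo (U.mulVec w) (U.mulVec u)
        + (Real.cos θ : 𝕜) • rankTwo (U.mulVec w) (U.mulVec v) := by
    rw [coe_sandwich, ← mul_rankTwo_mul, ← mul_rankTwo_mul, ← hu, ← hv, ← RCLike.ofReal_neg,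
      ← hsm, ← hsm, ← Matrix.add_mul, ← Matrix.mul_add, crossRotation_apply]
    congr 2
    simp only [map_add, map_sub, map_smul, crossPart_idem hw, AddSubgroup.coe_add,
      AddSubgroup.coe_sub, selfAdjoint.val_smul, sub_smul, one_smul, neg_smul]
    abel
  simp only [hermInner, hermImResolvent, h1, h2]

/-- The compression kills `w`, so `S` and its cross part agree there; then the operator norm is at
most the Hilbert–Schmidt norm. -/
lemma norm_toEuclideanLin_le_sqrt_crossPart {w : EuclideanSpace 𝕜 n} (hw : ‖w‖ = 1)
    (S : HermMat n 𝕜) :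
    ‖hermLin S w‖ ≤ √(hermInner (crossPart w.ofLp S) (crossPart w.ofLp S)) := by
  have hww : star w.ofLp ⬝ᵥ w.ofLp = 1 := by
    have : inner 𝕜 w w = (1 : 𝕜) := by simp [inner_self_eq_norm_sq_to_K, hw]
    rw [← this, EuclideanSpace.inner_eq_star_dotProduct, dotProduct_comm]
  have h1 : hermLin (crossPart w.ofLp S) w = hermLin S w := by
    have h2 : hermLin (compress w.ofLp 0 S) w = 0 := by
      rw [hermLin_compress, inner_self_eq_norm_sq_to_K, hw]
      simp
    have h3 : hermLin (crossPart w.ofLp S) w = hermLin S w - hermLin (compress w.ofLp 0 S) w := by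
      rw [crossPart_apply, hermLin, AddSubgroup.coe_sub, map_sub, LinearMap.sub_apply]
    rw [h3, h2, sub_zero]
  rw [← h1]
  generalize crossPart w.ofLp S = B
  rw [EuclideanSpace.norm_eq, hermInner_self]
  refine Real.sqrt_le_sqrt (Finset.sum_le_sum fun i _ => ?_)
  have h4 : hermLin B w i = ∑ j, (B : Matrix n n 𝕜) i j * w j := rfl
  have h5 : ∑ j, ‖w j‖ ^ 2 = 1 := by
    rw [← EuclideanSpace.norm_sq_eq, hw, one_pow]
  rw [h4]
  calc ‖∑ j, (B : Matrix n n 𝕜) i j * w j‖ ^ 2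
      ≤ (∑ j, ‖(B : Matrix n n 𝕜) i j‖ * ‖w j‖) ^ 2 := by
        refine pow_le_pow_left₀ (norm_nonneg _) ((norm_sum_le _ _).trans ?_) 2
        simp only [norm_mul, le_refl]
    _ ≤ (∑ j, ‖(B : Matrix n n 𝕜) i j‖ ^ 2) * ∑ j, ‖w j‖ ^ 2 :=
        Finset.sum_mul_sq_le_sq_mul_sq _ _ _
    _ = _ := by rw [h5, mul_one]

end Block

/-! ### Averaging the resolvent over the cross part of a block -/

section BlockIntegral

variable {n 𝕜 : Type*} [RCLike 𝕜] [Fintype n] [DecidableEq n] [MeasureSpace 𝕜] [BorelSpace 𝕜]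
  [(volume : Measure 𝕜).IsAddHaarMeasure] {N : ℕ}

omit [DecidableEq n] [MeasureSpace 𝕜] [BorelSpace 𝕜] [(volume : Measure 𝕜).IsAddHaarMeasure] in
lemma secondCountableTopology_hermMat : SecondCountableTopology (HermMat n 𝕜) :=
  TopologicalSpace.Subtype.secondCountableTopology _

instance : SecondCountableTopology (HermMat (Fin N) 𝕜) := secondCountableTopology_hermMat

instance : BorelSpace (HermMat (Fin N) 𝕜 × HermMat (Fin N) 𝕜) := Prod.borelSpace

instance : BorelSpace (ℝ × (HermMat (Fin N) 𝕜 × HermMat (Fin N) 𝕜)) := Prod.borelSpace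

/-- The average over the rotations of the cross part of a Gaussian matrix bounds the part of the
resolvent which it sees. -/
lemma lintegral_abs_hermInner_mul_le (σ : 𝕜 →+* ℂ)
    (hσ : ∀ x, σ (star x) = star (σ x)) (hre : ∀ x, (σ x).re = RCLike.re x) (a : ℝ)
    [IsProbabilityMeasure (gaussHerm 𝕜 N a)]
    (A : HermMat n 𝕜) (U : Matrix n (Fin N) 𝕜) {w : Fin N → 𝕜} (hw : star w ⬝ᵥ w = 1)
    (e : ℝ) {η : ℝ} (hη : 0 < η) {Ψ : HermMat (Fin N) 𝕜 → ℝ≥0∞} (hΨ : Measurable Ψ)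
    (hΨw : ∀ V, Ψ (compress w 0 V) = Ψ V) :
    ∫⁻ x, ENNReal.ofReal |hermInner (hermImResolvent e η (A + sandwich U x.1))
        (sandwich U (crossPart w x.2))| * Ψ x.1 ∂((gaussHerm 𝕜 N a).prod (gaussHerm 𝕜 N a))
      ≤ 2 * ∫⁻ V, Ψ V ∂(gaussHerm 𝕜 N a) := by
  set f : HermMat (Fin N) 𝕜 × HermMat (Fin N) 𝕜 → ℝ := fun x =>
    |hermInner (hermImResolvent e η (A + sandwich U x.1)) (sandwich U (crossPart w x.2))| with hf
  have hfc : Continuous f := by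
    have h1 : Continuous fun x : HermMat (Fin N) 𝕜 × HermMat (Fin N) 𝕜 =>
        (hermImResolvent e η (A + sandwich U x.1), sandwich U (crossPart w x.2)) :=
      ((continuous_hermImResolvent e hη).comp (continuous_const.add
        ((continuous_sandwich U).comp continuous_fst))).prodMk
        ((continuous_sandwich U).comp ((continuous_crossPart w).comp continuous_snd))
    exact (continuous_hermInner.comp h1).abs
  set F : HermMat (Fin N) 𝕜 × HermMat (Fin N) 𝕜 → ℝ≥0∞ := fun x => ENNReal.ofReal (f x) * Ψ x.1
    with hF
  have hFm : Measurable F := hfc.measurable.ennreal_ofReal.mul (hΨ.comp measurable_fst)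
  set γ := (gaussHerm 𝕜 N a).prod (gaussHerm 𝕜 N a) with hγ
  set R : ℝ → HermMat (Fin N) 𝕜 × HermMat (Fin N) 𝕜 → HermMat (Fin N) 𝕜 × HermMat (Fin N) 𝕜 :=
    fun θ x => crossRotation w (Real.cos θ) (Real.sin θ) x with hR
  have hRc : Continuous fun y : ℝ × (HermMat (Fin N) 𝕜 × HermMat (Fin N) 𝕜) => R y.1 y.2 :=
    continuous_crossRotation w
  have hrot : ∀ θ, ∫⁻ x, F (R θ x) ∂γ = ∫⁻ x, F x ∂γ := fun θ =>
    lintegral_prod_gaussHerm_comp a (crossRotationEquiv hw (Real.cos_sq_add_sin_sq θ))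
      (hRc.comp (Continuous.prodMk_right θ)).measurable
      (hermInner_crossRotation hw (Real.cos_sq_add_sin_sq θ)) hFm
  have hΨR : ∀ θ x, Ψ (R θ x).1 = Ψ x.1 := fun θ x => by
    rw [← hΨw (R θ x).1, ← hΨw x.1]
    exact congrArg Ψ (compress_crossRotation_fst hw _ _ x)
  have hfR : ∀ x, ∫ θ in (0 : ℝ)..2 * Real.pi, f (R θ x) ≤ 4 * Real.pi :=
    integral_abs_hermInner_crossRotation_le σ hσ hre A U hw e hη
  have hf0 : ∀ x, 0 ≤ f x := fun x => abs_nonneg _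
  clear_value R f
  -- Integrate the rotated expectation over `θ` in two ways: invariance gives `2π` times the left
  -- side, while for each fixed pair the orbit integral is at most `4π` times the weight. The ratio
  -- is the constant `2`.
  have hswap : ∫⁻ θ in Set.Ioc (0 : ℝ) (2 * Real.pi), ∫⁻ x, F (R θ x) ∂γ
      = ∫⁻ x, (∫⁻ θ in Set.Ioc (0 : ℝ) (2 * Real.pi), F (R θ x)) ∂γ :=
    lintegral_lintegral_swap (f := fun θ x => F (R θ x)) (hFm.comp hRc.measurable).aemeasurable
  have hleft : ∫⁻ θ in Set.Ioc (0 : ℝ) (2 * Real.pi), ∫⁻ x, F (R θ x) ∂γ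
      = ENNReal.ofReal (2 * Real.pi) * ∫⁻ x, F x ∂γ := by
    simp only [hrot]
    rw [setLIntegral_const, Real.volume_Ioc, sub_zero, mul_comm]
  have hpt : ∀ x, ∫⁻ θ in Set.Ioc (0 : ℝ) (2 * Real.pi), F (R θ x)
      ≤ ENNReal.ofReal (4 * Real.pi) * Ψ x.1 := by
    intro x
    have hcθ : Continuous fun θ : ℝ => f (R θ x) :=
      hfc.comp (hRc.comp (continuous_id.prodMk continuous_const))
    simp only [hF, hΨR]
    rw [lintegral_mul_const _ hcθ.measurable.ennreal_ofReal]
    gcongr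
    rw [← ofReal_integral_eq_lintegral_ofReal
      (hcθ.integrableOn_Ioc) (Filter.Eventually.of_forall fun θ => hf0 _),
      ← intervalIntegral.integral_of_le (by positivity)]
    exact ENNReal.ofReal_le_ofReal (hfR x)
  have hfin : ENNReal.ofReal (2 * Real.pi) * ∫⁻ x, F x ∂γ
      ≤ ENNReal.ofReal (2 * Real.pi) * (2 * ∫⁻ V, Ψ V ∂(gaussHerm 𝕜 N a)) := by
    rw [← hleft, hswap]
    refine (lintegral_mono hpt).trans (le_of_eq ?_)
    have hΨ1 : Measurable fun x : HermMat (Fin N) 𝕜 × HermMat (Fin N) 𝕜 => Ψ x.1 :=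
      hΨ.comp measurable_fst
    have h2 : ∫⁻ x, Ψ x.1 ∂γ = ∫⁻ V, Ψ V ∂(gaussHerm 𝕜 N a) := by
      rw [hγ, lintegral_prod _ hΨ1.aemeasurable]
      simp
    rw [lintegral_const_mul _ hΨ1, h2, ← mul_assoc,
      show (4 : ℝ) * Real.pi = 2 * Real.pi * 2 by ring, ENNReal.ofReal_mul (by positivity),
      ENNReal.ofReal_ofNat]
  exact (ENNReal.mul_le_mul_iff_right (by simpa using Real.pi_pos) ENNReal.ofReal_ne_top).1 hfin

/-- A vector in a block, seen by the imaginary part of the resolvent compressed to that block, is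
bounded on average, with a weight which does not depend on the cross part of the block. -/
lemma lintegral_norm_imResolvent_mul_le (σ : 𝕜 →+* ℂ)
    (hσ : ∀ x, σ (star x) = star (σ x)) (hre : ∀ x, (σ x).re = RCLike.re x) {a : ℝ} (ha : 0 < a)
    [IsProbabilityMeasure (gaussHerm 𝕜 N a)]
    (A : HermMat n 𝕜) (U : Matrix n (Fin N) 𝕜) {w : EuclideanSpace 𝕜 (Fin N)} (hw : ‖w‖ = 1)
    (e : ℝ) {η : ℝ} (hη : 0 < η) {Ψ : HermMat (Fin N) 𝕜 → ℝ≥0∞} (hΨ : Measurable Ψ)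
    (hΨw : ∀ V, Ψ (compress w.ofLp 0 V) = Ψ V) :
    ∫⁻ V, ENNReal.ofReal ‖hermLin (sandwich U.conjTranspose
        (hermImResolvent e η (A + sandwich U V))) w‖ * Ψ V ∂(gaussHerm 𝕜 N a)
      ≤ ENNReal.ofReal (48 * √a) * ∫⁻ V, Ψ V ∂(gaussHerm 𝕜 N a) := by
  have hww : star w.ofLp ⬝ᵥ w.ofLp = 1 := by
    have : inner 𝕜 w w = (1 : 𝕜) := by simp [inner_self_eq_norm_sq_to_K, hw]
    rw [← this, EuclideanSpace.inner_eq_star_dotProduct, dotProduct_comm]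
  have h1 := lintegral_abs_hermInner_mul_le σ hσ hre a A U hww e hη hΨ hΨw
  have hS : ∀ x : HermMat (Fin N) 𝕜 × HermMat (Fin N) 𝕜,
      hermInner (hermImResolvent e η (A + sandwich U x.1)) (sandwich U (crossPart w.ofLp x.2))
      = hermInner (crossPart w.ofLp (sandwich U.conjTranspose
        (hermImResolvent e η (A + sandwich U x.1)))) x.2 := fun x => by
    rw [← hermInner_sandwich, hermInner_crossPart hww, hermInner_comm _ x.2,
      hermInner_crossPart hww x.2, hermInner_comm]
  simp only [hS] at h1
  set S : HermMat (Fin N) 𝕜 → HermMat (Fin N) 𝕜 := fun V => crossPart w.ofLp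
    (sandwich U.conjTranspose (hermImResolvent e η (A + sandwich U V))) with hSd
  have hSc : Continuous S := (continuous_crossPart _).comp ((continuous_sandwich _).comp
    ((continuous_hermImResolvent e hη).comp (continuous_const.add (continuous_sandwich U))))
  have hm1 : Measurable fun x : HermMat (Fin N) 𝕜 × HermMat (Fin N) 𝕜 =>
      ENNReal.ofReal |hermInner (S x.1) x.2| * Ψ x.1 := by
    refine Measurable.mul (Continuous.measurable ?_).ennreal_ofReal (hΨ.comp measurable_fst)
    exact (continuous_hermInner.comp ((hSc.comp continuous_fst).prodMk continuous_snd)).abs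
  rw [lintegral_prod _ hm1.aemeasurable] at h1
  have hsa : 0 < √a := Real.sqrt_pos.2 ha
  -- With `V` frozen, `S V` is deterministic and the first-moment bound applies to the independent
  -- copy `V'`. The constant `48` is `24` from here times `2` from the rotation.
  have h2 : ∀ V, ENNReal.ofReal (1 / (24 * √a)) * (ENNReal.ofReal ‖hermLin (sandwich U.conjTranspose
        (hermImResolvent e η (A + sandwich U V))) w‖ * Ψ V)
      ≤ ∫⁻ V', ENNReal.ofReal |hermInner (S V) V'| * Ψ V ∂(gaussHerm 𝕜 N a) := by
    intro V
    rw [lintegral_mul_const _ (continuous_hermInner_left _).abs.measurable.ennreal_ofReal,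
      ← mul_assoc]
    gcongr
    refine le_trans ?_ (sqrt_hermInner_le_lintegral ha (S V))
    rw [← ENNReal.ofReal_mul (by positivity)]
    refine ENNReal.ofReal_le_ofReal ?_
    rw [one_div_mul_eq_div]
    gcongr
    exact norm_toEuclideanLin_le_sqrt_crossPart hw _
  have h3 := (lintegral_mono h2).trans h1
  rw [lintegral_const_mul' _ _ ENNReal.ofReal_ne_top] at h3
  have h4 : ENNReal.ofReal (24 * √a) * ENNReal.ofReal (1 / (24 * √a)) = 1 := by
    rw [← ENNReal.ofReal_mul (by positivity), mul_one_div_cancel (by positivity),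
      ENNReal.ofReal_one]
  have h5 : ENNReal.ofReal (48 * √a) = ENNReal.ofReal (24 * √a) * 2 := by
    rw [show (48 : ℝ) * √a = 24 * √a * 2 by ring, ENNReal.ofReal_mul (by positivity),
      ENNReal.ofReal_ofNat]
  have h6 := mul_le_mul_right h3 (ENNReal.ofReal (24 * √a))
  rwa [← mul_assoc, h4, one_mul, ← mul_assoc, ← h5] at h6

end BlockIntegral

/-! ### Khintchine's inequality and sign vectors -/

section Khintchine

/-- The sign `±1` determined by a Boolean. -/
def boolSign (b : Bool) : ℝ := if b then 1 else -1

variable {E : Type*} [NormedAddCommGroup E] [InnerProductSpace ℝ E]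

lemma sum_bool_fin_succ {M : Type*} [AddCommMonoid M] {N : ℕ} (f : (Fin (N + 1) → Bool) → M) :
    ∑ ε, f ε = ∑ ε : Fin N → Bool, (f (Fin.cons true ε) + f (Fin.cons false ε)) := by
  rw [← (Fin.consEquiv fun _ : Fin (N + 1) => Bool).sum_comp, Fintype.sum_prod_type, Fintype.sum_bool,
    Finset.sum_add_distrib]
  rfl

lemma sum_norm_sq_boolSign {N : ℕ} (y : Fin N → E) :
    ∑ ε : Fin N → Bool, ‖∑ k, boolSign (ε k) • y k‖ ^ 2 = 2 ^ N * ∑ k, ‖y k‖ ^ 2 := by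
  induction N with
  | zero => simp
  | succ N ih =>
    rw [sum_bool_fin_succ, Fin.sum_univ_succ (f := fun k => ‖y k‖ ^ 2)]
    simp only [Fin.sum_univ_succ, Fin.cons_zero, Fin.cons_succ, boolSign, if_true,
      Bool.false_eq_true, if_false, one_smul, neg_smul]
    have h : ∀ S : E, ‖y 0 + S‖ ^ 2 + ‖-y 0 + S‖ ^ 2 = 2 * ‖S‖ ^ 2 + 2 * ‖y 0‖ ^ 2 := fun S => by
      rw [norm_add_sq_real, norm_add_sq_real, inner_neg_left, norm_neg]
      ring
    simp only [boolSign] at ih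
    simp only [h, Finset.sum_add_distrib, ← Finset.mul_sum, ih fun k => y k.succ]
    simp
    ring

/-- Adding one sign at a time, the odd powers of the inner product cancel and Cauchy–Schwarz bounds
its square. -/
lemma sum_norm_pow_four_boolSign {N : ℕ} (y : Fin N → E) :
    ∑ ε : Fin N → Bool, ‖∑ k, boolSign (ε k) • y k‖ ^ 4 ≤ 3 * (2 ^ N * (∑ k, ‖y k‖ ^ 2) ^ 2) := by
  induction N with
  | zero => simp
  | succ N ih =>
    have ih' := ih fun k => y k.succ
    have h2 := sum_norm_sq_boolSign fun k => y k.succ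
    rw [sum_bool_fin_succ, Fin.sum_univ_succ (f := fun k => ‖y k‖ ^ 2)]
    simp only [Fin.sum_univ_succ, Fin.cons_zero, Fin.cons_succ]
    have h : ∀ S : E, ‖boolSign true • y 0 + S‖ ^ 4 + ‖boolSign false • y 0 + S‖ ^ 4
        ≤ 2 * ‖S‖ ^ 4 + 12 * ‖y 0‖ ^ 2 * ‖S‖ ^ 2 + 2 * ‖y 0‖ ^ 4 := fun S => by
      have e1 : ‖boolSign true • y 0 + S‖ ^ 4 = (‖y 0‖ ^ 2 + 2 * inner ℝ (y 0) S + ‖S‖ ^ 2) ^ 2 := by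
        rw [← norm_add_sq_real, boolSign]; simp; ring
      have e2 : ‖boolSign false • y 0 + S‖ ^ 4
          = (‖y 0‖ ^ 2 - 2 * inner ℝ (y 0) S + ‖S‖ ^ 2) ^ 2 := by
        have := norm_add_sq_real (-y 0) S
        rw [inner_neg_left, norm_neg] at this
        rw [boolSign, if_neg (by simp), neg_one_smul, show 4 = 2 * 2 from rfl, pow_mul, this]
        ring
      have e3 : inner ℝ (y 0) S ^ 2 ≤ ‖y 0‖ ^ 2 * ‖S‖ ^ 2 := by
        rw [← mul_pow, ← sq_abs]
        exact pow_le_pow_left₀ (abs_nonneg _) (abs_real_inner_le_norm _ _) 2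
      rw [e1, e2]
      nlinarith
    refine (Finset.sum_le_sum fun ε _ => h _).trans ?_
    simp only [Finset.sum_add_distrib, ← Finset.mul_sum, h2]
    simp only [Finset.sum_const, Finset.card_univ, Fintype.card_fun, Fintype.card_bool,
      Fintype.card_fin, nsmul_eq_mul]
    push_cast
    set Q := ∑ k : Fin N, ‖y k.succ‖ ^ 2
    have h2N : (0 : ℝ) < 2 ^ N := by positivity
    rw [pow_succ (2 : ℝ) N]
    nlinarith [mul_nonneg h2N.le (pow_nonneg (norm_nonneg (y 0)) 4)]

/-- Khintchine's inequality for the first moment of a sum with random signs. -/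
lemma sqrt_le_sum_norm_boolSign {N : ℕ} (y : Fin N → E) :
    2 ^ N * √(∑ k, ‖y k‖ ^ 2) ≤ 4 * ∑ ε : Fin N → Bool, ‖∑ k, boolSign (ε k) • y k‖ := by
  set Q := ∑ k, ‖y k‖ ^ 2 with hQ
  rcases (show 0 ≤ Q by positivity).eq_or_lt with h0 | h0
  · rw [← h0]; simp; positivity
  set s := √Q with hs
  have hs0 : 0 < s := Real.sqrt_pos.2 h0
  have hss : s ^ 2 = Q := Real.sq_sqrt h0.le
  -- This interpolates the first moment between the second and the fourth: averaging over signs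
  -- gives `4 s⁴ - 3 s⁴ ≤ 4 s³` times the first moment.
  have hpt : ∀ t : ℝ, 0 ≤ t → 4 * s ^ 2 * t ^ 2 - t ^ 4 ≤ 4 * s ^ 3 * t := by
    intro t ht
    have h1 : 0 ≤ 4 * s ^ 3 - 4 * s ^ 2 * t + t ^ 3 := by
      nlinarith [mul_nonneg hs0.le (sq_nonneg (t - s)), mul_nonneg ht (sq_nonneg (t - s)),
        mul_nonneg hs0.le (sq_nonneg (2 * t - 2 * s)), mul_nonneg ht (sq_nonneg (t - 2 * s)),
        pow_pos hs0 3, mul_nonneg ht (sq_nonneg (2 * t - 3 * s)),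
        mul_nonneg hs0.le (sq_nonneg (2 * t - 3 * s)), pow_nonneg ht 3]
    nlinarith [mul_nonneg ht h1]
  have h2 := sum_norm_sq_boolSign y
  have h4 := sum_norm_pow_four_boolSign y
  have hsum := Finset.sum_le_sum fun (ε : Fin N → Bool) (_ : ε ∈ Finset.univ) =>
    hpt _ (norm_nonneg (∑ k, boolSign (ε k) • y k))
  rw [Finset.sum_sub_distrib, ← Finset.mul_sum, ← Finset.mul_sum, h2] at hsum
  rw [← hQ, ← hss] at hsum h4
  have h5 : s ^ 3 * (2 ^ N * s) ≤ s ^ 3 * (4 * ∑ ε : Fin N → Bool, ‖∑ k, boolSign (ε k) • y k‖) := by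
    nlinarith
  exact le_of_mul_le_mul_left h5 (by positivity)

end Khintchine

section SignVectors

variable {𝕜 : Type*} [RCLike 𝕜] {N : ℕ}

/-- The unit vector with entries `± N ^ (-1/2)`. -/
noncomputable def signVec (𝕜 : Type*) [RCLike 𝕜] {N : ℕ} (ε : Fin N → Bool) :
    EuclideanSpace 𝕜 (Fin N) :=
  WithLp.toLp 2 fun k => (((√N)⁻¹ * boolSign (ε k) : ℝ) : 𝕜)

lemma abs_boolSign (b : Bool) : |boolSign b| = 1 := by
  cases b <;> simp [boolSign]

lemma norm_signVec (hN : 0 < N) (ε : Fin N → Bool) : ‖signVec 𝕜 ε‖ = 1 := by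
  have hN' : (0 : ℝ) < N := by exact_mod_cast hN
  rw [EuclideanSpace.norm_eq, Real.sqrt_eq_one]
  have h1 : ∀ k, ‖(signVec 𝕜 ε).ofLp k‖ ^ 2 = (N : ℝ)⁻¹ := fun k => by
    rw [signVec, RCLike.norm_ofReal, abs_mul, abs_boolSign, mul_one, sq_abs, inv_pow,
      Real.sq_sqrt hN'.le]
  simp only [h1, Finset.sum_const, Finset.card_univ, Fintype.card_fin, nsmul_eq_mul]
  exact mul_inv_cancel₀ hN'.ne'

/-- Finitely many unit vectors detect every direction on average, at the cost of a factor `√N` from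
their normalisation. -/
lemma norm_le_sum_norm_inner_signVec (hN : 0 < N) (z : EuclideanSpace 𝕜 (Fin N)) :
    2 ^ N * ‖z‖ ≤ 4 * √N * ∑ ε, ‖inner 𝕜 (signVec 𝕜 ε) z‖ := by
  let _ : InnerProductSpace ℝ 𝕜 := InnerProductSpace.rclikeToReal 𝕜 𝕜
  have hN' : (0 : ℝ) < √N := Real.sqrt_pos.2 (by exact_mod_cast hN)
  have h1 : 2 ^ N * √(∑ k, ‖z.ofLp k‖ ^ 2)
      ≤ 4 * ∑ ε : Fin N → Bool, ‖∑ k, ((boolSign (ε k) : ℝ) : 𝕜) * z.ofLp k‖ :=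
    sqrt_le_sum_norm_boolSign fun k => z.ofLp k
  have h2 : ∀ ε : Fin N → Bool, ‖∑ k, ((boolSign (ε k) : ℝ) : 𝕜) * z.ofLp k‖
      = √N * ‖inner 𝕜 (signVec 𝕜 ε) z‖ := fun ε => by
    have : inner 𝕜 (signVec 𝕜 ε) z = (((√N)⁻¹ : ℝ) : 𝕜) * ∑ k, ((boolSign (ε k) : ℝ) : 𝕜) * z.ofLp k := by
      rw [PiLp.inner_apply, Finset.mul_sum]
      refine Finset.sum_congr rfl fun k _ => ?_
      rw [RCLike.inner_apply, signVec, RCLike.conj_ofReal, RCLike.ofReal_mul]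
      ring
    rw [this, norm_mul, RCLike.norm_ofReal, abs_of_pos (inv_pos.2 hN'),
      mul_inv_cancel_left₀ hN'.ne']
  rw [← EuclideanSpace.norm_eq] at h1
  simp only [h2, ← Finset.mul_sum] at h1
  linarith

end SignVectors

/-! ### Detecting an eigenvector through sign vectors -/

section Detection

variable {n m 𝕜 : Type*} [RCLike 𝕜] [Fintype n] [DecidableEq n] [Fintype m] [DecidableEq m] {N : ℕ}

lemma inner_toEuclideanLin_conjTranspose (U : Matrix n m 𝕜) (x : EuclideanSpace 𝕜 m)
    (y : EuclideanSpace 𝕜 n) :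
    inner 𝕜 x (Matrix.toEuclideanLin U.conjTranspose y) = inner 𝕜 (Matrix.toEuclideanLin U x) y := by
  rw [Matrix.toEuclideanLin_conjTranspose_eq_adjoint, LinearMap.adjoint_inner_right]

lemma hermLin_sandwich_conjTranspose (U : Matrix n m 𝕜) (M : HermMat n 𝕜)
    (x : EuclideanSpace 𝕜 m) :
    hermLin (sandwich U.conjTranspose M) x
      = Matrix.toEuclideanLin U.conjTranspose (hermLin M (Matrix.toEuclideanLin U x)) := by
  rw [hermLin, coe_sandwich, Matrix.conjTranspose_conjTranspose, Matrix.toLpLin_mul_same,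
    Matrix.toLpLin_mul_same]
  rfl

/-- If `A` has an eigenvalue near `e`, then the resolvent detects the part of the eigenvector in a
block through the random sign vectors of the block. -/
lemma sq_norm_conjTranspose_eigenvector_le (hN : 0 < N) (A : HermMat n 𝕜) (U : Matrix n (Fin N) 𝕜)
    (e : ℝ) {η : ℝ} (hη : 0 < η) {i : n} (hi : |(isHermitian_coe A).eigenvalues i - e| ≤ η) :
    ‖Matrix.toEuclideanLin U.conjTranspose ((isHermitian_coe A).eigenvectorBasis i)‖ ^ 2
      ≤ 8 * η * √N / 2 ^ N * ∑ ε, ‖hermLin (sandwich U.conjTranspose (hermImResolvent e η A))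
        (signVec 𝕜 ε)‖ := by
  set v := (isHermitian_coe A).eigenvectorBasis i with hv
  set S := sandwich U.conjTranspose (hermImResolvent e η A) with hS
  set x := Matrix.toEuclideanLin U.conjTranspose v with hx
  set T := ∑ ε, ‖hermLin S (signVec 𝕜 ε)‖ with hT
  have hT0 : 0 ≤ T := by positivity
  -- Test the resolvent on the block component `U x` of the eigenvector `v`: its overlap with `v` is
  -- `‖x‖²`, and the spectral weight of `v` is at least `1 / (2η)`.
  have h1 : ‖x‖ ^ 4 / (2 * η) ≤ ‖x‖ * ‖hermLin S x‖ := by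
    have h2 := sq_norm_inner_div_le_imResolvent A e hη hi (Matrix.toEuclideanLin U x)
    have h3 : ‖inner 𝕜 v (Matrix.toEuclideanLin U x)‖ = ‖x‖ ^ 2 := by
      rw [norm_inner_symm, ← inner_toEuclideanLin_conjTranspose U x v, ← hx,
        inner_self_eq_norm_sq_to_K (𝕜 := 𝕜), norm_pow, RCLike.norm_ofReal, abs_norm]
    rw [← hv, h3, ← pow_mul] at h2
    refine h2.trans (le_trans (le_of_eq ?_)
      ((RCLike.re_le_norm (inner 𝕜 x (hermLin S x))).trans (norm_inner_le_norm x _)))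
    rw [hS, hermLin_sandwich_conjTranspose, inner_toEuclideanLin_conjTranspose]
    rfl
  have h4 := norm_le_sum_norm_inner_signVec hN (hermLin S x)
  have h5 : ∑ ε, ‖inner 𝕜 (signVec 𝕜 ε) (hermLin S x)‖ ≤ ‖x‖ * T := by
    rw [hT, Finset.mul_sum]
    refine Finset.sum_le_sum fun ε _ => ?_
    rw [← hermLin_isSymmetric S, mul_comm]
    exact norm_inner_le_norm _ _
  have h6 : 0 ≤ √(N : ℝ) := Real.sqrt_nonneg _
  have h2N : (0 : ℝ) < 2 ^ N := by positivity
  rcases (norm_nonneg x).eq_or_lt with h0 | h0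
  · rw [← h0, zero_pow two_ne_zero]
    clear_value T
    positivity
  rw [div_le_iff₀ (by positivity)] at h1
  rw [div_mul_eq_mul_div, le_div_iff₀ h2N]
  have h7 : ‖x‖ ^ 2 * (‖x‖ ^ 2 * 2 ^ N) ≤ ‖x‖ ^ 2 * (8 * η * √N * T) := by
    calc ‖x‖ ^ 2 * (‖x‖ ^ 2 * 2 ^ N) = ‖x‖ ^ 4 * 2 ^ N := by ring
      _ ≤ ‖x‖ * ‖hermLin S x‖ * (2 * η) * 2 ^ N := by gcongr
      _ = ‖x‖ * (2 * η) * (2 ^ N * ‖hermLin S x‖) := by ring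
      _ ≤ ‖x‖ * (2 * η) * (4 * √N * (‖x‖ * T)) :=
          mul_le_mul_of_nonneg_left (h4.trans (by gcongr)) (by positivity)
      _ = _ := by ring
  exact le_of_mul_le_mul_left h7 (by positivity)

end Detection

/-! ### Block inclusions, and conditioning on all blocks but one -/

section BlockEmbedding

variable {𝕜 : Type*} [RCLike 𝕜] {k : ℕ} {N : Fin k → ℕ}

/-- The inclusion of the `j`-th block. -/
def blockEmbed (𝕜 : Type*) [RCLike 𝕜] {k : ℕ} (N : Fin k → ℕ) (j : Fin k) :
    Matrix (Σ j, Fin (N j)) (Fin (N j)) 𝕜 :=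
  Matrix.of fun i l => if i = ⟨j, l⟩ then 1 else 0

lemma blockEmbed_apply (j : Fin k) (i : Σ j, Fin (N j)) (l : Fin (N j)) :
    blockEmbed 𝕜 N j i l = if i = ⟨j, l⟩ then 1 else 0 := rfl

lemma conjTranspose_blockEmbed_apply (j : Fin k) (i : Σ j, Fin (N j)) (l : Fin (N j)) :
    (blockEmbed 𝕜 N j).conjTranspose l i = if i = ⟨j, l⟩ then 1 else 0 := by
  rw [Matrix.conjTranspose_apply, blockEmbed_apply]
  split_ifs <;> simp

lemma conjTranspose_blockEmbed_mul_self (j : Fin k) :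
    (blockEmbed 𝕜 N j).conjTranspose * blockEmbed 𝕜 N j = 1 := by
  ext l l'
  simp only [Matrix.mul_apply, conjTranspose_blockEmbed_apply, blockEmbed_apply, Matrix.one_apply]
  simp [eq_comm]

lemma sum_sq_norm_conjTranspose_blockEmbed (v : EuclideanSpace 𝕜 (Σ j, Fin (N j))) :
    ∑ j, ‖Matrix.toEuclideanLin (blockEmbed 𝕜 N j).conjTranspose v‖ ^ 2 = ‖v‖ ^ 2 := by
  rw [EuclideanSpace.norm_sq_eq, Fintype.sum_sigma]
  refine Finset.sum_congr rfl fun j _ => ?_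
  rw [EuclideanSpace.norm_sq_eq]
  refine Finset.sum_congr rfl fun l _ => ?_
  congr 2
  simp only [Matrix.toLpLin_apply, Matrix.mulVec, dotProduct, conjTranspose_blockEmbed_apply]
  simp

lemma norm_toEuclideanLin_of_conjTranspose_mul_self {n m : Type*} [Fintype n] [DecidableEq n]
    [Fintype m] [DecidableEq m] {U : Matrix n m 𝕜}
    (hU : U.conjTranspose * U = 1) (x : EuclideanSpace 𝕜 m) :
    ‖Matrix.toEuclideanLin U x‖ = ‖x‖ := by
  have h : inner 𝕜 (Matrix.toEuclideanLin U x) (Matrix.toEuclideanLin U x) = inner 𝕜 x x := by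
    rw [← inner_toEuclideanLin_conjTranspose, ← LinearMap.comp_apply, ← Matrix.toLpLin_mul_same, hU]
    simp
  rw [@norm_eq_sqrt_re_inner 𝕜, @norm_eq_sqrt_re_inner 𝕜 _ _ _ _ x, h]

lemma hermBlockDiag_update (V : ∀ j, HermMat (Fin (N j)) 𝕜) (j : Fin k)
    (W : HermMat (Fin (N j)) 𝕜) :
    hermBlockDiag (Function.update V j W)
      = hermBlockDiag (Function.update V j 0) + sandwich (blockEmbed 𝕜 N j) W := by
  refine Subtype.ext ?_
  rw [AddSubgroup.coe_add, coe_sandwich]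
  ext ⟨i, l⟩ ⟨i', l'⟩
  simp only [hermBlockDiag, Matrix.add_apply, Matrix.blockDiagonal'_apply, Matrix.mul_apply,
    blockEmbed_apply, conjTranspose_blockEmbed_apply]
  by_cases h : i = j
  · subst h
    by_cases h' : i = i'
    · subst h'
      simp
    · have : i' ≠ i := fun h => h' h.symm
      simp [h', this]
  · by_cases h' : i = i'
    · subst h'
      simp [h]
    · simp [h, h']

/-- Since `U` is isometric, the projection off `U w` passes through `U` to the projection off `w`.
Hence a compression of the full matrix sees the block only through the block's own compression. -/
lemma compress_add_sandwich {n m : Type*} [Fintype n] [DecidableEq n] [Fintype m] [DecidableEq m]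
    {U : Matrix n m 𝕜} (hU : U.conjTranspose * U = 1) (w : m → 𝕜) (b : ℝ) (A : HermMat n 𝕜)
    (V : HermMat m 𝕜) :
    compress (U.mulVec w) b (A + sandwich U V)
      = compress (U.mulVec w) b A + sandwich U (compress w 0 V) := by
  refine Subtype.ext ?_
  have h1 : (rankOneProj (U.mulVec w) : Matrix n n 𝕜)
      = U * (rankOneProj w : Matrix m m 𝕜) * U.conjTranspose := by
    simp only [rankOneProj]
    rw [Matrix.mul_vecMulVec, Matrix.vecMulVec_mul, Matrix.star_mulVec]
  have h2 : (1 - (rankOneProj (U.mulVec w) : Matrix n n 𝕜)) * U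
      = U * (1 - (rankOneProj w : Matrix m m 𝕜)) := by
    rw [h1, Matrix.sub_mul, Matrix.mul_sub, Matrix.mul_assoc (U * _), hU, Matrix.mul_one,
      Matrix.one_mul, Matrix.mul_one]
  have h3 : U.conjTranspose * (1 - (rankOneProj (U.mulVec w) : Matrix n n 𝕜))
      = (1 - (rankOneProj w : Matrix m m 𝕜)) * U.conjTranspose := by
    rw [h1, Matrix.sub_mul, Matrix.mul_sub, Matrix.mul_assoc U, ← Matrix.mul_assoc _ U, hU,
      Matrix.one_mul, Matrix.mul_one, Matrix.one_mul]
  rw [AddSubgroup.coe_add, coe_sandwich]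
  simp only [compress, AddSubgroup.coe_add, coe_sandwich, Matrix.mul_add, Matrix.add_mul]
  have h4 : (1 - (rankOneProj (U.mulVec w) : Matrix n n 𝕜))
        * (U * (V : Matrix m m 𝕜) * U.conjTranspose)
        * (1 - (rankOneProj (U.mulVec w) : Matrix n n 𝕜))
      = ((1 - (rankOneProj (U.mulVec w) : Matrix n n 𝕜)) * U) * (V : Matrix m m 𝕜)
        * (U.conjTranspose * (1 - (rankOneProj (U.mulVec w) : Matrix n n 𝕜))) := by
    simp only [Matrix.mul_assoc]
  rw [h4, h2, h3]
  simp only [RCLike.ofReal_zero, zero_smul, Matrix.mul_zero, Matrix.zero_mul, add_zero,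
    Matrix.mul_assoc]
  exact add_right_comm _ _ _

lemma compress_compress {n : Type*} [Fintype n] [DecidableEq n] {w : n → 𝕜}
    (hw : star w ⬝ᵥ w = 1) (V : HermMat n 𝕜) :
    compress w 0 (compress w 0 V) = compress w 0 V := by
  have h1 : ∀ A, compress w 0 A = A - crossPart w A := fun A => by
    rw [crossPart_apply, sub_sub_cancel]
  rw [h1, h1, map_sub, crossPart_idem hw, sub_self, sub_zero]

end BlockEmbedding

section BlockMeasurability

variable {𝕜 : Type*} [RCLike 𝕜] {k : ℕ} {N : Fin k → ℕ}

lemma continuous_hermBlockDiag :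
    Continuous (hermBlockDiag : (∀ j, HermMat (Fin (N j)) 𝕜) → _) := by
  refine Continuous.subtype_mk ?_ _
  exact Continuous.matrix_blockDiagonal' (continuous_pi fun j =>
    continuous_subtype_val.comp (continuous_apply j))

lemma continuous_hermLin_apply {n : Type*} [Fintype n] [DecidableEq n] (w : EuclideanSpace 𝕜 n) :
    Continuous fun A : HermMat n 𝕜 => hermLin A w := by
  have h : Continuous fun A : HermMat n 𝕜 => (A : Matrix n n 𝕜).mulVec w.ofLp :=
    continuous_subtype_val.matrix_mulVec continuous_const
  exact (PiLp.continuous_toLp 2 _).comp h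

variable [MeasurableSpace 𝕜] [BorelSpace 𝕜]

lemma measurable_eigCount_comp {n : Type*} [Fintype n] [DecidableEq n] {I : Set ℝ}
    (hI : MeasurableSet I) {f : (∀ j, HermMat (Fin (N j)) 𝕜) → HermMat n 𝕜} (hf : Continuous f)
    (Φ : ℕ → ℝ≥0∞) : Measurable fun V => Φ (eigCount (f V) I) :=
  measurable_from_top.comp ((measurable_eigCount hI).comp hf.measurable)

end BlockMeasurability

/-- By independence it suffices to integrate over one block with all others frozen. -/
lemma lintegral_pi_le_of_update {ι : Type*} [Fintype ι] [DecidableEq ι] {X : ι → Type*}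
    [∀ i, MeasurableSpace (X i)] (μ : ∀ i, Measure (X i)) [∀ i, SigmaFinite (μ i)]
    {f g : (∀ i, X i) → ℝ≥0∞} (hf : Measurable f) (hg : Measurable g) (j : ι)
    (h : ∀ x, ∫⁻ y, f (Function.update x j y) ∂μ j ≤ ∫⁻ y, g (Function.update x j y) ∂μ j) :
    ∫⁻ x, f x ∂Measure.pi μ ≤ ∫⁻ x, g x ∂Measure.pi μ := by
  refine lintegral_le_of_lmarginal_le {j} hf hg ?_
  rw [lmarginal_singleton, lmarginal_singleton]
  exact h

/-! ### The cost of one eigenvalue -/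

section BlockGaussian

variable {𝕜 : Type*} [RCLike 𝕜] [MeasureSpace 𝕜] [BorelSpace 𝕜]
  [(volume : Measure 𝕜).IsAddHaarMeasure] {k : ℕ} {N : Fin k → ℕ} {a : Fin k → ℝ}

omit [(volume : Measure 𝕜).IsAddHaarMeasure] in
/-- A bound uniform in the deterministic part carries over to compressions. -/
lemma lintegral_compress_le {μ : Measure (∀ j, HermMat (Fin (N j)) 𝕜)} {Φ : ℕ → ℝ≥0∞}
    (hΦ : Monotone Φ) (c : ℝ) {r : ℝ} (hr : 0 < r) {K : ℝ≥0∞}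
    (hK : ∀ A, ∫⁻ V, Φ (eigCount (A + hermBlockDiag V) (Set.Ioo (c - r) (c + r))) ∂μ ≤ K)
    (A : HermMat (Σ j, Fin (N j)) 𝕜) {w : EuclideanSpace 𝕜 (Σ j, Fin (N j))} (hw : ‖w‖ = 1) :
    ∫⁻ V, Φ (eigCount (compress w.ofLp (c + r) (A + hermBlockDiag V))
      (Set.Ioo (c - r) (c + r))) ∂μ ≤ K := by
  let f : ℕ → (∀ j, HermMat (Fin (N j)) 𝕜) → ℝ≥0∞ := fun t V =>
    Φ (eigCount ((A + (t : ℝ) • rankOneProj w.ofLp) + hermBlockDiag V) (Set.Ioo (c - r) (c + r)))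
  have hfm : ∀ t, Measurable (f t) := fun t => measurable_eigCount_comp measurableSet_Ioo
    (continuous_const.add continuous_hermBlockDiag) Φ
  -- The threshold for `t` depends on `V`, so the comparison holds only eventually at each point;
  -- Fatou's lemma needs no uniformity.
  have hpt : ∀ V, Φ (eigCount (compress w.ofLp (c + r) (A + hermBlockDiag V))
      (Set.Ioo (c - r) (c + r))) ≤ Filter.liminf (fun t => f t V) Filter.atTop := fun V => by
    obtain ⟨T, hT⟩ := exists_forall_eigCount_compress_le hw c hr (A + hermBlockDiag V)
    refine Filter.le_liminf_of_le (by isBoundedDefault) ?_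
    filter_upwards [Filter.eventually_ge_atTop ⌈T⌉₊] with t ht
    refine hΦ ((hT t ((Nat.le_ceil T).trans (by exact_mod_cast ht))).trans (le_of_eq ?_))
    rw [add_right_comm]
  calc _ ≤ ∫⁻ V, Filter.liminf (fun t => f t V) Filter.atTop ∂μ := lintegral_mono hpt
    _ ≤ Filter.liminf (fun t => ∫⁻ V, f t V ∂μ) Filter.atTop := lintegral_liminf_le hfm
    _ ≤ Filter.liminf (fun _ : ℕ => K) Filter.atTop :=
        Filter.liminf_le_liminf (Filter.Eventually.of_forall fun t => hK _)
    _ = K := Filter.liminf_const K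

/-- The block `j`, seen by the resolvent of the whole matrix, with a weight depending on a
compression of the whole matrix. -/
lemma lintegral_norm_imResolvent_block_mul_le (σ : 𝕜 →+* ℂ)
    (hσ : ∀ x, σ (star x) = star (σ x)) (hre : ∀ x, (σ x).re = RCLike.re x)
    [∀ j, IsProbabilityMeasure (gaussHerm 𝕜 (N j) (a j))] (j : Fin k) (haj : 0 < a j)
    (A : HermMat (Σ j, Fin (N j)) 𝕜) {w : EuclideanSpace 𝕜 (Fin (N j))} (hw : ‖w‖ = 1)
    (e : ℝ) {η : ℝ} (hη : 0 < η) (Φ : ℕ → ℝ≥0∞) (b : ℝ) {I : Set ℝ} (hI : MeasurableSet I) :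
    ∫⁻ V, ENNReal.ofReal ‖hermLin (sandwich (blockEmbed 𝕜 N j).conjTranspose
        (hermImResolvent e η (A + hermBlockDiag V))) w‖
        * Φ (eigCount (compress (Matrix.toEuclideanLin (blockEmbed 𝕜 N j) w).ofLp b
          (A + hermBlockDiag V)) I) ∂(Measure.pi fun j => gaussHerm 𝕜 (N j) (a j))
      ≤ ENNReal.ofReal (48 * √(a j)) *
        ∫⁻ V, Φ (eigCount (compress (Matrix.toEuclideanLin (blockEmbed 𝕜 N j) w).ofLp b
          (A + hermBlockDiag V)) I) ∂(Measure.pi fun j => gaussHerm 𝕜 (N j) (a j)) := by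
  have hww : star w.ofLp ⬝ᵥ w.ofLp = 1 := by
    have : inner 𝕜 w w = (1 : 𝕜) := by simp [inner_self_eq_norm_sq_to_K, hw]
    rw [← this, EuclideanSpace.inner_eq_star_dotProduct, dotProduct_comm]
  have hAc : Continuous fun V : ∀ j, HermMat (Fin (N j)) 𝕜 => A + hermBlockDiag V :=
    continuous_const.add continuous_hermBlockDiag
  have h1 : Measurable fun V : ∀ j, HermMat (Fin (N j)) 𝕜 =>
      ENNReal.ofReal ‖hermLin (sandwich (blockEmbed 𝕜 N j).conjTranspose
        (hermImResolvent e η (A + hermBlockDiag V))) w‖ :=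
    (Continuous.measurable ((continuous_hermLin_apply w).comp ((continuous_sandwich _).comp
      ((continuous_hermImResolvent e hη).comp hAc))).norm).ennreal_ofReal
  have h2 : Measurable fun V : ∀ j, HermMat (Fin (N j)) 𝕜 =>
      Φ (eigCount (compress (Matrix.toEuclideanLin (blockEmbed 𝕜 N j) w).ofLp b
        (A + hermBlockDiag V)) I) :=
    measurable_eigCount_comp hI ((continuous_compress _ _).comp hAc) Φ
  rw [← lintegral_const_mul _ h2]
  refine lintegral_pi_le_of_update _ (h1.mul h2) (h2.const_mul _) j fun V => ?_
  -- The frozen blocks join the deterministic part, leaving a single Gaussian block.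
  obtain ⟨B, hsplit⟩ : ∃ B, ∀ W, A + hermBlockDiag (Function.update V j W)
      = B + sandwich (blockEmbed 𝕜 N j) W :=
    ⟨A + hermBlockDiag (Function.update V j 0), fun W => by
      rw [hermBlockDiag_update V j W, add_assoc]⟩
  have hofLp : (Matrix.toEuclideanLin (blockEmbed 𝕜 N j) w).ofLp
    = (blockEmbed 𝕜 N j).mulVec w.ofLp := rfl
  simp only [hsplit, hofLp]
  have h3 : Continuous fun W => compress ((blockEmbed 𝕜 N j).mulVec w.ofLp) b
      (B + sandwich (blockEmbed 𝕜 N j) W) :=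
    (continuous_compress _ _).comp (continuous_const.add (continuous_sandwich _))
  have h4 : Measurable fun W => Φ (eigCount (compress ((blockEmbed 𝕜 N j).mulVec w.ofLp) b
      (B + sandwich (blockEmbed 𝕜 N j) W)) I) :=
    measurable_from_top.comp ((measurable_eigCount hI).comp h3.measurable)
  rw [lintegral_const_mul _ h4]
  refine lintegral_norm_imResolvent_mul_le σ hσ hre haj B (blockEmbed 𝕜 N j) hw e hη h4 fun W => ?_
  rw [compress_add_sandwich (conjTranspose_blockEmbed_mul_self j),
    compress_add_sandwich (conjTranspose_blockEmbed_mul_self j), compress_compress hww]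

/-- The eigenvalues near an energy cost a factor proportional to the total dimension and the
length of the window, and one eigenvalue in the larger interval. -/
lemma lintegral_one_le_eigCount_mul_le (σ : 𝕜 →+* ℂ)
    (hσ : ∀ x, σ (star x) = star (σ x)) (hre : ∀ x, (σ x).re = RCLike.re x)
    [∀ j, IsProbabilityMeasure (gaussHerm 𝕜 (N j) (a j))] (hN : ∀ j, 0 < N j)
    (ha : ∀ j, 0 < a j) (haN : ∀ j, a j ≤ N j) {Φ : ℕ → ℝ≥0∞}
    (hΦ : Monotone Φ) (c : ℝ) {r : ℝ} (hr : 0 < r) {K : ℝ≥0∞}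
    (hK : ∀ A, ∫⁻ V, Φ (eigCount (A + hermBlockDiag V) (Set.Ioo (c - r) (c + r)))
      ∂(Measure.pi fun j => gaussHerm 𝕜 (N j) (a j)) ≤ K)
    (A : HermMat (Σ j, Fin (N j)) 𝕜) (e : ℝ) {η : ℝ} (hη : 0 < η) :
    ∫⁻ V, (if 1 ≤ eigCount (A + hermBlockDiag V) (Set.Icc (e - η) (e + η)) then 1 else 0)
        * Φ (eigCount (A + hermBlockDiag V) (Set.Ioo (c - r) (c + r)) - 1)
        ∂(Measure.pi fun j => gaussHerm 𝕜 (N j) (a j))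
      ≤ ENNReal.ofReal (384 * η * ∑ j, (N j : ℝ)) * K := by
  set γ := Measure.pi fun j => gaussHerm 𝕜 (N j) (a j) with hγ
  let w : ∀ j, (Fin (N j) → Bool) → EuclideanSpace 𝕜 (Σ j, Fin (N j)) := fun j ε =>
    Matrix.toEuclideanLin (blockEmbed 𝕜 N j) (signVec 𝕜 ε)
  have hw : ∀ j ε, ‖w j ε‖ = 1 := fun j ε => by
    rw [norm_toEuclideanLin_of_conjTranspose_mul_self (conjTranspose_blockEmbed_mul_self j),
      norm_signVec (hN j)]
  let f : ∀ j, (Fin (N j) → Bool) → (∀ j, HermMat (Fin (N j)) 𝕜) → ℝ≥0∞ := fun j ε V =>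
    ENNReal.ofReal ‖hermLin (sandwich (blockEmbed 𝕜 N j).conjTranspose
        (hermImResolvent e η (A + hermBlockDiag V))) (signVec 𝕜 ε)‖
  let g : ∀ j, (Fin (N j) → Bool) → (∀ j, HermMat (Fin (N j)) 𝕜) → ℝ≥0∞ := fun j ε V =>
    Φ (eigCount (compress (w j ε).ofLp (c + r) (A + hermBlockDiag V)) (Set.Ioo (c - r) (c + r)))
  have hAc : Continuous fun V : ∀ j, HermMat (Fin (N j)) 𝕜 => A + hermBlockDiag V :=
    continuous_const.add continuous_hermBlockDiag
  have hf : ∀ j ε, Measurable (f j ε) := fun j ε =>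
    (Continuous.measurable ((continuous_hermLin_apply _).comp ((continuous_sandwich _).comp
      ((continuous_hermImResolvent e hη).comp hAc))).norm).ennreal_ofReal
  have hg : ∀ j ε, Measurable (g j ε) := fun j ε =>
    measurable_eigCount_comp measurableSet_Ioo ((continuous_compress _ _).comp hAc) Φ
  have hfg : ∀ j ε, ∫⁻ V, f j ε V * g j ε V ∂γ ≤ ENNReal.ofReal (48 * √(a j)) * K := fun j ε =>
    (lintegral_norm_imResolvent_block_mul_le σ hσ hre j (ha j) A (norm_signVec (hN j) ε) e hη Φ
      (c + r) measurableSet_Ioo).trans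
      (mul_le_mul_right (lintegral_compress_le hΦ c hr hK A (hw j ε)) _)
  have hpt : ∀ V, (if 1 ≤ eigCount (A + hermBlockDiag V) (Set.Icc (e - η) (e + η)) then 1 else 0)
        * Φ (eigCount (A + hermBlockDiag V) (Set.Ioo (c - r) (c + r)) - 1)
      ≤ ∑ j, ∑ ε, ENNReal.ofReal (8 * η * √(N j) / 2 ^ N j) * (f j ε V * g j ε V) := by
    intro V
    split_ifs with h1
    swap
    · simp
    rw [one_mul]
    have h2 : ∃ i, (isHermitian_coe (A + hermBlockDiag V)).eigenvalues i
        ∈ Set.Icc (e - η) (e + η) := by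
      by_contra! h
      have : eigCount (A + hermBlockDiag V) (Set.Icc (e - η) (e + η)) = 0 := by
        classical
        rw [eigCount_eq_card, Finset.card_eq_zero, Finset.filter_eq_empty_iff]
        exact fun i _ => h i
      omega
    obtain ⟨i, hi⟩ := h2
    have hi' : |(isHermitian_coe (A + hermBlockDiag V)).eigenvalues i - e| ≤ η := by
      rw [abs_le]
      constructor <;> linarith [hi.1, hi.2]
    have h3 := sum_sq_norm_conjTranspose_blockEmbed
      ((isHermitian_coe (A + hermBlockDiag V)).eigenvectorBasis i)
    rw [OrthonormalBasis.norm_eq_one, one_pow] at h3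
    -- The squared block norms of the unit eigenvector sum to `1`, and each is bounded by its
    -- average over sign vectors.
    have h4 : (1 : ℝ≥0∞) ≤ ∑ j, ∑ ε, ENNReal.ofReal (8 * η * √(N j) / 2 ^ N j) * f j ε V := by
      rw [← ENNReal.ofReal_one, ← h3, ENNReal.ofReal_sum_of_nonneg fun j _ => by positivity]
      refine Finset.sum_le_sum fun j _ => ?_
      refine (ENNReal.ofReal_le_ofReal (sq_norm_conjTranspose_eigenvector_le (hN j) _
        (blockEmbed 𝕜 N j) e hη hi')).trans (le_of_eq ?_)
      rw [ENNReal.ofReal_mul (by positivity), ENNReal.ofReal_sum_of_nonneg fun ε _ => by positivity,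
        Finset.mul_sum]
    calc Φ (eigCount (A + hermBlockDiag V) (Set.Ioo (c - r) (c + r)) - 1)
        ≤ (∑ j, ∑ ε, ENNReal.ofReal (8 * η * √(N j) / 2 ^ N j) * f j ε V)
          * Φ (eigCount (A + hermBlockDiag V) (Set.Ioo (c - r) (c + r)) - 1) :=
          le_mul_of_one_le_left zero_le h4
      _ ≤ _ := by
          simp only [Finset.sum_mul, mul_assoc]
          gcongr with j _ ε _
          exact hΦ (eigCount_sub_one_le_compress (hw j ε) _ c hr _)
  calc _ ≤ ∫⁻ V, ∑ j, ∑ ε, ENNReal.ofReal (8 * η * √(N j) / 2 ^ N j) * (f j ε V * g j ε V) ∂γ :=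
        lintegral_mono hpt
    _ = ∑ j, ∑ ε, ENNReal.ofReal (8 * η * √(N j) / 2 ^ N j) * ∫⁻ V, f j ε V * g j ε V ∂γ := by
        have hfgm : ∀ j ε, Measurable fun V => f j ε V * g j ε V := fun j ε => (hf j ε).mul (hg j ε)
        rw [lintegral_finsetSum _ fun j _ => Finset.measurable_sum _ fun ε _ =>
          (hfgm j ε).const_mul _]
        refine Finset.sum_congr rfl fun j _ => ?_
        rw [lintegral_finsetSum _ fun ε _ => (hfgm j ε).const_mul _]
        exact Finset.sum_congr rfl fun ε _ => lintegral_const_mul _ (hfgm j ε)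
    _ ≤ ∑ j, ∑ _ε : Fin (N j) → Bool, ENNReal.ofReal (8 * η * √(N j) / 2 ^ N j)
          * (ENNReal.ofReal (48 * √(a j)) * K) := by
        gcongr with j _ ε _
        exact hfg j ε
    _ ≤ ∑ j, ENNReal.ofReal (384 * η * N j) * K := by
        refine Finset.sum_le_sum fun j _ => ?_
        rw [Finset.sum_const, Finset.card_univ, Fintype.card_fun, Fintype.card_bool,
          Fintype.card_fin, nsmul_eq_mul, ← mul_assoc, ← mul_assoc, ← ENNReal.ofReal_natCast,
          ← ENNReal.ofReal_mul (by positivity), ← ENNReal.ofReal_mul (by positivity)]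
        refine mul_le_mul' (ENNReal.ofReal_le_ofReal ?_) le_rfl
        -- Here `√N` from the sign vectors meets `√a` from the Gaussian scale, which makes the cost
        -- linear in the block size; `384 = 8 * 48`.
        have h5 : √(a j) ≤ √(N j) := Real.sqrt_le_sqrt (haN j)
        push_cast
        calc (2 : ℝ) ^ N j * (8 * η * √(N j) / 2 ^ N j) * (48 * √(a j))
            = 384 * η * (√(N j) * √(a j)) := by field_simp; ring
          _ ≤ 384 * η * (√(N j) * √(N j)) := by gcongr
          _ = _ := by rw [Real.mul_self_sqrt (by positivity)]
    _ = _ := by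
        rw [← Finset.sum_mul, Finset.mul_sum, ENNReal.ofReal_sum_of_nonneg fun j _ => by positivity]

end BlockGaussian

/-! ### Factorial moments by cutting the interval into small windows -/

lemma Ioo_subset_iUnion_Icc (c : ℝ) {r : ℝ} (hr : 0 < r) {Q : ℕ} (hQ : 0 < Q) :
    Set.Ioo (c - r) (c + r) ⊆ ⋃ q ∈ Finset.range Q,
      Set.Icc (c - r + (2 * q + 1) * (r / Q) - r / Q) (c - r + (2 * q + 1) * (r / Q) + r / Q) := by
  intro x hx
  have hQ' : (0 : ℝ) < Q := by exact_mod_cast hQ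
  have hη : 0 < r / Q := by positivity
  have hrη : r = Q * (r / Q) := by field_simp
  set η := r / Q
  have h0 : 0 ≤ (x - (c - r)) / (2 * η) := div_nonneg (by linarith [hx.1]) (by positivity)
  have h1 := Nat.floor_le h0
  have h2 := Nat.lt_floor_add_one ((x - (c - r)) / (2 * η))
  rw [le_div_iff₀ (by positivity)] at h1
  rw [div_lt_iff₀ (by positivity)] at h2
  simp only [Set.mem_iUnion, Finset.mem_range, exists_prop]
  refine ⟨⌊(x - (c - r)) / (2 * η)⌋₊, ?_, ?_, ?_⟩
  · have h3 : (⌊(x - (c - r)) / (2 * η)⌋₊ : ℝ) * (2 * η) < Q * (2 * η) := by linarith [hx.2]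
    exact_mod_cast lt_of_mul_lt_mul_right h3 (by positivity)
  · linarith
  · linarith

section FactorialMoments

variable {𝕜 : Type*} [RCLike 𝕜] [MeasureSpace 𝕜] [BorelSpace 𝕜]
  [(volume : Measure 𝕜).IsAddHaarMeasure] {k : ℕ} {N : Fin k → ℕ} {a : Fin k → ℝ}

/-- With a constant weight the larger interval plays no role, and `K = 1`. -/
lemma lintegral_one_le_eigCount_le (σ : 𝕜 →+* ℂ)
    (hσ : ∀ x, σ (star x) = star (σ x)) (hre : ∀ x, (σ x).re = RCLike.re x)
    [∀ j, IsProbabilityMeasure (gaussHerm 𝕜 (N j) (a j))] (hN : ∀ j, 0 < N j)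
    (ha : ∀ j, 0 < a j) (haN : ∀ j, a j ≤ N j)
    (A : HermMat (Σ j, Fin (N j)) 𝕜) (e : ℝ) {η : ℝ} (hη : 0 < η) :
    ∫⁻ V, (if 1 ≤ eigCount (A + hermBlockDiag V) (Set.Icc (e - η) (e + η)) then 1 else 0)
        ∂(Measure.pi fun j => gaussHerm 𝕜 (N j) (a j))
      ≤ ENNReal.ofReal (384 * η * ∑ j, (N j : ℝ)) := by
  simpa using lintegral_one_le_eigCount_mul_le σ hσ hre hN ha haN (Φ := fun _ => 1)
    monotone_const e hη (K := 1) (by simp) A e hη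

/-- Detect one eigenvalue; another remains in the open window of doubled radius, and the
one-eigenvalue bound there serves as `K`. The product is `O(η²)`. -/
lemma lintegral_two_le_eigCount_le (σ : 𝕜 →+* ℂ)
    (hσ : ∀ x, σ (star x) = star (σ x)) (hre : ∀ x, (σ x).re = RCLike.re x)
    [∀ j, IsProbabilityMeasure (gaussHerm 𝕜 (N j) (a j))] (hN : ∀ j, 0 < N j)
    (ha : ∀ j, 0 < a j) (haN : ∀ j, a j ≤ N j)
    (A : HermMat (Σ j, Fin (N j)) 𝕜) (e : ℝ) {η : ℝ} (hη : 0 < η) :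
    ∫⁻ V, (if 2 ≤ eigCount (A + hermBlockDiag V) (Set.Icc (e - η) (e + η)) then 1 else 0)
        ∂(Measure.pi fun j => gaussHerm 𝕜 (N j) (a j))
      ≤ ENNReal.ofReal (384 * η * ∑ j, (N j : ℝ))
        * ENNReal.ofReal (384 * (2 * η) * ∑ j, (N j : ℝ)) := by
  have hmono : Monotone fun n : ℕ => if 1 ≤ n then (1 : ℝ≥0∞) else 0 := fun n m h => by
    dsimp only
    split_ifs
    · exact le_rfl
    · omega
    · exact zero_le
    · exact le_rfl
  refine le_trans (lintegral_mono fun V => ?_) (lintegral_one_le_eigCount_mul_le σ hσ hre hN ha haN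
    hmono e (r := 2 * η) (by positivity)
    (K := ENNReal.ofReal (384 * (2 * η) * ∑ j, (N j : ℝ))) (fun B => ?_) A e hη)
  · have h1 : eigCount (A + hermBlockDiag V) (Set.Icc (e - η) (e + η))
        ≤ eigCount (A + hermBlockDiag V) (Set.Ioo (e - 2 * η) (e + 2 * η)) :=
      eigCount_mono _ fun x hx => ⟨by linarith [hx.1], by linarith [hx.2]⟩
    dsimp only
    split_ifs <;> first | omega | simp
  · refine le_trans (lintegral_mono fun V => ?_)
      (lintegral_one_le_eigCount_le σ hσ hre hN ha haN B e (η := 2 * η) (by positivity))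
    exact hmono (eigCount_mono _ Set.Ioo_subset_Icc_self)

/-- The factorial moments of the number of eigenvalues in an open interval. -/
lemma lintegral_descFactorial_eigCount_Ioo_le (σ : 𝕜 →+* ℂ)
    (hσ : ∀ x, σ (star x) = star (σ x)) (hre : ∀ x, (σ x).re = RCLike.re x)
    [∀ j, IsProbabilityMeasure (gaussHerm 𝕜 (N j) (a j))] (hN : ∀ j, 0 < N j)
    (ha : ∀ j, 0 < a j) (haN : ∀ j, a j ≤ N j) (m : ℕ)
    (A : HermMat (Σ j, Fin (N j)) 𝕜) (c : ℝ) {r : ℝ} (hr : 0 < r) :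
    ∫⁻ V, ((eigCount (A + hermBlockDiag V) (Set.Ioo (c - r) (c + r))).descFactorial m : ℝ≥0∞)
        ∂(Measure.pi fun j => gaussHerm 𝕜 (N j) (a j))
      ≤ ENNReal.ofReal (384 * r * ∑ j, (N j : ℝ)) ^ m := by
  -- The previous moment is needed for all deterministic parts at once, because the compression is
  -- reached through rank-one perturbations of `A`.
  induction m generalizing A with
  | zero => simp
  | succ m ih =>
  set γ := Measure.pi fun j => gaussHerm 𝕜 (N j) (a j) with hγ
  set D := ∑ j, (N j : ℝ) with hD
  have hD0 : 0 ≤ D := by positivity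
  set d := Fintype.card (Σ j, Fin (N j)) with hd
  set K := ENNReal.ofReal (384 * r * D) ^ m with hK
  have hmono : Monotone fun n : ℕ => ((n.descFactorial m : ℕ) : ℝ≥0∞) := fun n n' h =>
    Nat.cast_le.2 (Nat.descFactorial_le m h)
  have hAc : Continuous fun V : ∀ j, HermMat (Fin (N j)) 𝕜 => A + hermBlockDiag V :=
    continuous_const.add continuous_hermBlockDiag
  have hQ : ∀ Q : ℕ, 0 < Q →
      ∫⁻ V, ((eigCount (A + hermBlockDiag V) (Set.Ioo (c - r) (c + r))).descFactorial (m + 1) : ℝ≥0∞)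
        ∂γ ≤ ENNReal.ofReal (384 * r * D) * K
          + ENNReal.ofReal ((d ^ (m + 1) * 2 * (384 * r * D) ^ 2) / Q) := by
    intro Q hQ
    have hQ' : (0 : ℝ) < Q := by exact_mod_cast hQ
    set η := r / Q with hη
    have hη0 : 0 < η := by positivity
    set e : ℕ → ℝ := fun q => c - r + (2 * q + 1) * η with he
    set n : ℕ → (∀ j, HermMat (Fin (N j)) 𝕜) → ℕ := fun q V =>
      eigCount (A + hermBlockDiag V) (Set.Icc (e q - η) (e q + η)) with hn
    set M : (∀ j, HermMat (Fin (N j)) 𝕜) → ℕ := fun V =>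
      eigCount (A + hermBlockDiag V) (Set.Ioo (c - r) (c + r)) with hM
    have hpt : ∀ V, ((M V).descFactorial (m + 1) : ℝ≥0∞)
        ≤ ∑ q ∈ Finset.range Q, ((if 1 ≤ n q V then 1 else 0) * ((M V - 1).descFactorial m : ℝ≥0∞)
          + (d : ℝ≥0∞) ^ (m + 1) * (if 2 ≤ n q V then 1 else 0)) := by
      intro V
      have h1 : M V ≤ ∑ q ∈ Finset.range Q, n q V :=
        eigCount_le_sum _ _ (Ioo_subset_iUnion_Icc c hr hQ)
      have h2 : (M V).descFactorial (m + 1) = M V * (M V - 1).descFactorial m := by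
        rcases M V with _ | M
        · simp
        · rw [Nat.succ_descFactorial_succ, Nat.add_sub_cancel]
      have h3 : (M V - 1).descFactorial m ≤ d ^ m :=
        (Nat.descFactorial_le_pow _ _).trans
          (Nat.pow_le_pow_left ((Nat.sub_le _ _).trans (eigCount_le_card _ _)) m)
      have h4 : ∀ q, n q V ≤ d := fun q => eigCount_le_card _ _
      -- A window with at most one eigenvalue equals its own indicator; otherwise every count is
      -- bounded crudely by the dimension `d`.
      have h5 : ∀ q, n q V * (M V - 1).descFactorial m
          ≤ (if 1 ≤ n q V then 1 else 0) * (M V - 1).descFactorial m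
            + d ^ (m + 1) * (if 2 ≤ n q V then 1 else 0) := by
        intro q
        have h6 := h4 q
        rcases lt_or_ge (n q V) 2 with h | h
        · refine le_trans (Nat.mul_le_mul_right _ ?_) (Nat.le_add_right _ _)
          split_ifs <;> omega
        · rw [if_pos h, mul_one, pow_succ', mul_comm d]
          refine le_trans ?_ (Nat.le_add_left _ _)
          rw [mul_comm]
          exact Nat.mul_le_mul h3 h6
      have h7 : (M V).descFactorial (m + 1)
          ≤ ∑ q ∈ Finset.range Q, ((if 1 ≤ n q V then 1 else 0) * (M V - 1).descFactorial m
            + d ^ (m + 1) * (if 2 ≤ n q V then 1 else 0)) := by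
        rw [h2]
        refine (Nat.mul_le_mul_right _ h1).trans ?_
        rw [Finset.sum_mul]
        exact Finset.sum_le_sum fun q _ => h5 q
      have h8 : ((M V).descFactorial (m + 1) : ℝ≥0∞) ≤
          ((∑ q ∈ Finset.range Q, ((if 1 ≤ n q V then 1 else 0) * (M V - 1).descFactorial m
            + d ^ (m + 1) * (if 2 ≤ n q V then 1 else 0)) : ℕ) : ℝ≥0∞) := by exact_mod_cast h7
      refine h8.trans (le_of_eq ?_)
      push_cast
      rfl
    have hm1 : ∀ q, Measurable fun V => (if 1 ≤ n q V then (1 : ℝ≥0∞) else 0) := fun q =>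
      measurable_eigCount_comp measurableSet_Icc hAc fun n => if 1 ≤ n then 1 else 0
    have hm2 : ∀ q, Measurable fun V => (if 2 ≤ n q V then (1 : ℝ≥0∞) else 0) := fun q =>
      measurable_eigCount_comp measurableSet_Icc hAc fun n => if 2 ≤ n then 1 else 0
    have hm3 : Measurable fun V => ((M V - 1).descFactorial m : ℝ≥0∞) :=
      measurable_eigCount_comp measurableSet_Ioo hAc fun n => ((n - 1).descFactorial m : ℝ≥0∞)
    have hm4 : ∀ q, Measurable fun V =>
        (if 1 ≤ n q V then (1 : ℝ≥0∞) else 0) * ((M V - 1).descFactorial m : ℝ≥0∞) := fun q =>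
      (hm1 q).mul hm3
    have hm5 : ∀ q, Measurable fun V =>
        (if 1 ≤ n q V then (1 : ℝ≥0∞) else 0) * ((M V - 1).descFactorial m : ℝ≥0∞)
          + (d : ℝ≥0∞) ^ (m + 1) * (if 2 ≤ n q V then 1 else 0) := fun q =>
      (hm4 q).add ((hm2 q).const_mul _)
    have hterm : ∀ q, ∫⁻ V, ((if 1 ≤ n q V then 1 else 0) * ((M V - 1).descFactorial m : ℝ≥0∞)
          + (d : ℝ≥0∞) ^ (m + 1) * (if 2 ≤ n q V then 1 else 0)) ∂γ
        ≤ ENNReal.ofReal (384 * η * D) * K + ENNReal.ofReal (d ^ (m + 1))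
          * (ENNReal.ofReal (384 * η * D) * ENNReal.ofReal (384 * (2 * η) * D)) := by
      intro q
      rw [lintegral_add_left (hm4 q), lintegral_const_mul _ (hm2 q),
        ENNReal.ofReal_pow (Nat.cast_nonneg d), ENNReal.ofReal_natCast]
      exact add_le_add
        (lintegral_one_le_eigCount_mul_le σ hσ hre hN ha haN hmono c hr (fun B => ih B) A (e q) hη0)
        (mul_le_mul' le_rfl
          (lintegral_two_le_eigCount_le σ hσ hre hN ha haN A (e q) hη0))
    calc _ ≤ ∫⁻ V, ∑ q ∈ Finset.range Q,
          ((if 1 ≤ n q V then 1 else 0) * ((M V - 1).descFactorial m : ℝ≥0∞)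
          + (d : ℝ≥0∞) ^ (m + 1) * (if 2 ≤ n q V then 1 else 0)) ∂γ := lintegral_mono hpt
      _ ≤ ∑ _q ∈ Finset.range Q, (ENNReal.ofReal (384 * η * D) * K + ENNReal.ofReal (d ^ (m + 1))
          * (ENNReal.ofReal (384 * η * D) * ENNReal.ofReal (384 * (2 * η) * D))) := by
          rw [lintegral_finsetSum _ fun q _ => hm5 q]
          exact Finset.sum_le_sum fun q _ => hterm q
      _ = _ := by
          rw [Finset.sum_const, Finset.card_range, nsmul_eq_mul, mul_add,
            ← ENNReal.ofReal_natCast Q, ← mul_assoc, ← ENNReal.ofReal_mul (by positivity),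
            ← ENNReal.ofReal_mul (by positivity), ← ENNReal.ofReal_mul (by positivity),
            ← ENNReal.ofReal_mul (by positivity)]
          congr 2
          · rw [hη]
            congr 1
            field_simp
          · rw [hη]; field_simp
  -- The error is a sum of `Q` terms of order `Q⁻²`; the crude factor `d ^ (m + 1)` does not depend
  -- on `Q`.
  have hlim : Filter.Tendsto (fun Q : ℕ => ENNReal.ofReal (384 * r * D) * K
      + ENNReal.ofReal ((d ^ (m + 1) * 2 * (384 * r * D) ^ 2) / Q)) Filter.atTop
      (nhds (ENNReal.ofReal (384 * r * D) * K + ENNReal.ofReal 0)) :=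
    tendsto_const_nhds.add (ENNReal.tendsto_ofReal (tendsto_const_div_atTop_nhds_zero_nat _))
  rw [ENNReal.ofReal_zero, add_zero] at hlim
  rw [pow_succ', ← hK]
  exact ge_of_tendsto hlim ((Filter.eventually_gt_atTop 0).mono hQ)

end FactorialMoments

/-! ### Arbitrary intervals and the conclusion -/

lemma dist_le_toReal_volume {I : Set ℝ} (hI : I.OrdConnected) (hfin : volume I ≠ ⊤) {x y : ℝ}
    (hx : x ∈ I) (hy : y ∈ I) : y - x ≤ (volume I).toReal := by
  have h1 := measure_mono (μ := volume) (hI.out hx hy)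
  rw [Real.volume_Icc] at h1
  exact (ENNReal.ofReal_le_iff_le_toReal hfin).1 h1

/-- The slack `ε` lets an open interval cover the endpoints, and also a single point. -/
lemma exists_subset_Ioo_of_ordConnected {I : Set ℝ} (hI : I.OrdConnected) (hfin : volume I ≠ ⊤)
    (hne : I.Nonempty) {ε : ℝ} (hε : 0 < ε) :
    ∃ c, I ⊆ Set.Ioo (c - ((volume I).toReal / 2 + ε)) (c + ((volume I).toReal / 2 + ε)) := by
  set L := (volume I).toReal
  obtain ⟨x₀, hx₀⟩ := hne
  have hbelow : BddBelow I := ⟨x₀ - L, fun y hy => by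
    linarith [dist_le_toReal_volume hI hfin hy hx₀]⟩
  have hle : ∀ y ∈ I, y ≤ sInf I + L := fun y hy => by
    have : y - L ≤ sInf I := le_csInf ⟨x₀, hx₀⟩ fun x hx => by
      linarith [dist_le_toReal_volume hI hfin hx hy]
    linarith
  refine ⟨sInf I + L / 2, fun y hy => ⟨?_, ?_⟩⟩
  · linarith [csInf_le hbelow hy]
  · linarith [hle y hy]

section Wegner

variable {𝕜 : Type*} [RCLike 𝕜] [MeasureSpace 𝕜] [BorelSpace 𝕜]
  [(volume : Measure 𝕜).IsAddHaarMeasure] {k : ℕ} {N : Fin k → ℕ} {a : Fin k → ℝ}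

/-- The factorial moments of the number of eigenvalues in an arbitrary interval. -/
lemma lintegral_descFactorial_eigCount_le (σ : 𝕜 →+* ℂ)
    (hσ : ∀ x, σ (star x) = star (σ x)) (hre : ∀ x, (σ x).re = RCLike.re x)
    [∀ j, IsProbabilityMeasure (gaussHerm 𝕜 (N j) (a j))] (hk : 0 < k) (hN : ∀ j, 0 < N j)
    (ha : ∀ j, 0 < a j) (haN : ∀ j, a j ≤ N j) {m : ℕ} (hm : 1 ≤ m)
    (A : HermMat (Σ j, Fin (N j)) 𝕜) {I : Set ℝ} (hI : I.OrdConnected) :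
    ∫⁻ V, ((eigCount (A + hermBlockDiag V) I).descFactorial m : ℝ≥0∞)
        ∂(Measure.pi fun j => gaussHerm 𝕜 (N j) (a j))
      ≤ (192 * (∑ j, (N j : ℝ≥0∞)) * volume I) ^ m := by
  rcases I.eq_empty_or_nonempty with rfl | hne
  · have : ∀ V : ∀ j, HermMat (Fin (N j)) 𝕜, eigCount (A + hermBlockDiag V) ∅ = 0 := fun V => by
      simp [eigCount]
    simp [this, Nat.descFactorial_eq_zero_iff_lt.2 (show 0 < m by omega)]
  by_cases hfin : volume I = ⊤
  · have hD : 192 * ∑ j, (N j : ℝ≥0∞) ≠ 0 := by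
      refine mul_ne_zero (by norm_num) fun h => ?_
      have := (Finset.sum_eq_zero_iff.1 h) ⟨0, hk⟩ (Finset.mem_univ _)
      exact (hN ⟨0, hk⟩).ne' (by exact_mod_cast this)
    rw [hfin, ENNReal.mul_top hD, ENNReal.top_pow (by omega)]
    exact le_top
  have hε : ∀ ε : ℝ, 0 < ε → ∫⁻ V, ((eigCount (A + hermBlockDiag V) I).descFactorial m : ℝ≥0∞)
        ∂(Measure.pi fun j => gaussHerm 𝕜 (N j) (a j))
      ≤ ENNReal.ofReal (384 * ((volume I).toReal / 2 + ε) * ∑ j, (N j : ℝ)) ^ m := by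
    intro ε hε
    obtain ⟨c, hc⟩ := exists_subset_Ioo_of_ordConnected hI hfin hne hε
    refine le_trans (lintegral_mono fun V => ?_)
      (lintegral_descFactorial_eigCount_Ioo_le σ hσ hre hN ha haN m A c
        (r := (volume I).toReal / 2 + ε) (by positivity))
    exact Nat.cast_le.2 (Nat.descFactorial_le m (eigCount_mono _ hc))
  have hcont : Continuous fun ε : ℝ =>
      ENNReal.ofReal (384 * ((volume I).toReal / 2 + ε) * ∑ j, (N j : ℝ)) ^ m := by
    refine (ENNReal.continuous_pow m).comp (ENNReal.continuous_ofReal.comp ?_)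
    fun_prop
  -- Let the slack tend to zero; half of `384` remains because `r` tends to half the length.
  have hlim := (hcont.tendsto 0).mono_left (nhdsWithin_le_nhds (s := Set.Ioi 0))
  refine (ge_of_tendsto hlim (Filter.eventually_of_mem self_mem_nhdsWithin hε)).trans (le_of_eq ?_)
  congr 1
  rw [add_zero, show 384 * ((volume I).toReal / 2) * ∑ j, (N j : ℝ)
    = 192 * (∑ j, (N j : ℝ)) * (volume I).toReal by ring, ENNReal.ofReal_mul (by positivity),
    ENNReal.ofReal_mul (by positivity), ENNReal.ofReal_toReal hfin,
    ENNReal.ofReal_sum_of_nonneg fun j _ => by positivity]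
  simp

/-- The product is thus a natural number, so `ENNReal.ofReal` truncates nothing in the moment bound.
-/
lemma prod_range_sub_eq_descFactorial (n m : ℕ) :
    ∏ l ∈ Finset.range m, ((n : ℝ) - (l : ℝ)) = (n.descFactorial m : ℝ) := by
  rw [← descPochhammer_eval_eq_prod_range, descPochhammer_eval_eq_descFactorial]

/-- The Wegner and Minami type estimates for a deformed block-Gaussian matrix. -/
theorem wegner_of_hasLaw_gaussHerm (σ : 𝕜 →+* ℂ)
    (hσ : ∀ x, σ (star x) = star (σ x)) (hre : ∀ x, (σ x).re = RCLike.re x)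
    (hk : 0 < k) (hN : ∀ j, 0 < N j) (ha : ∀ j, 0 < a j) (haN : ∀ j, a j ≤ N j)
    (H₀ : HermMat (Σ j, Fin (N j)) 𝕜) {Ω : Type*} [MeasurableSpace Ω] (P : Measure Ω)
    [IsProbabilityMeasure P] (V : ∀ j, Ω → HermMat (Fin (N j)) 𝕜)
    (hV : iIndepFun V P) (hlaw : ∀ j, HasLaw (V j) (gaussHerm 𝕜 (N j) (a j)) P)
    {m : ℕ} (hm : 1 ≤ m) {I : Set ℝ} (hI : I.OrdConnected) :
    AEMeasurable (fun ω => eigCount (H₀ + hermBlockDiag fun j => V j ω) I) P ∧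
    ∫⁻ ω, ENNReal.ofReal (∏ l ∈ Finset.range m,
        ((eigCount (H₀ + hermBlockDiag fun j => V j ω) I : ℝ) - (l : ℝ))) ∂P
      ≤ (192 * (∑ j, (N j : ℝ≥0∞)) * volume I) ^ m ∧
    P {ω | m ≤ eigCount (H₀ + hermBlockDiag fun j => V j ω) I}
      ≤ (m ! : ℝ≥0∞)⁻¹ * (192 * (∑ j, (N j : ℝ≥0∞)) * volume I) ^ m := by
  have hVm : ∀ j, AEMeasurable (V j) P := fun j => (hlaw j).aemeasurable
  have hprob : ∀ j, IsProbabilityMeasure (gaussHerm 𝕜 (N j) (a j)) := fun j => by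
    rw [← (hlaw j).map_eq]
    exact Measure.isProbabilityMeasure_map (hVm j)
  have hmap : P.map (fun ω j => V j ω) = Measure.pi fun j => gaussHerm 𝕜 (N j) (a j) := by
    rw [(iIndepFun_iff_map_fun_eq_pi_map hVm).1 hV]
    congr 1
    funext j
    exact (hlaw j).map_eq
  have hVm' : AEMeasurable (fun ω j => V j ω) P := aemeasurable_pi_lambda _ hVm
  have hAc : Continuous fun W : ∀ j, HermMat (Fin (N j)) 𝕜 => H₀ + hermBlockDiag W :=
    continuous_const.add continuous_hermBlockDiag
  have hcount : Measurable fun W : ∀ j, HermMat (Fin (N j)) 𝕜 => eigCount (H₀ + hermBlockDiag W) I :=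
    (measurable_eigCount hI.measurableSet).comp hAc.measurable
  have hae : AEMeasurable (fun ω => eigCount (H₀ + hermBlockDiag fun j => V j ω) I) P :=
    hcount.comp_aemeasurable hVm'
  have hmoment : ∫⁻ ω, ((eigCount (H₀ + hermBlockDiag fun j => V j ω) I).descFactorial m : ℝ≥0∞) ∂P
      ≤ (192 * (∑ j, (N j : ℝ≥0∞)) * volume I) ^ m := by
    have h1 : Measurable fun W : ∀ j, HermMat (Fin (N j)) 𝕜 =>
        ((eigCount (H₀ + hermBlockDiag W) I).descFactorial m : ℝ≥0∞) :=
      measurable_eigCount_comp hI.measurableSet hAc fun n => (n.descFactorial m : ℝ≥0∞)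
    have h2 := lintegral_descFactorial_eigCount_le σ hσ hre hk hN ha haN hm H₀ hI
    rwa [← hmap, lintegral_map' h1.aemeasurable hVm'] at h2
  refine ⟨hae, ?_, ?_⟩
  · simpa only [prod_range_sub_eq_descFactorial, ENNReal.ofReal_natCast] using hmoment
  · have h3 : AEMeasurable (fun ω =>
        ((eigCount (H₀ + hermBlockDiag fun j => V j ω) I).descFactorial m : ℝ≥0∞)) P :=
      (measurable_from_top (f := fun n : ℕ => (n.descFactorial m : ℝ≥0∞))).comp_aemeasurable hae
    have h4 : (m ! : ℝ≥0∞) * P {ω | m ≤ eigCount (H₀ + hermBlockDiag fun j => V j ω) I}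
        ≤ (192 * (∑ j, (N j : ℝ≥0∞)) * volume I) ^ m := by
      -- Markov's inequality: the descending factorial is at least `m !` once the count reaches `m`.
      refine le_trans (mul_le_mul' le_rfl (measure_mono fun ω hω => ?_))
        ((mul_meas_ge_le_lintegral₀ h3 (m ! : ℝ≥0∞)).trans hmoment)
      rw [Set.mem_ofPred_eq, ← Nat.descFactorial_self]
      exact_mod_cast Nat.descFactorial_le m hω
    have h5 : (m ! : ℝ≥0∞) ≠ 0 := by exact_mod_cast m.factorial_ne_zero
    rw [← ENNReal.div_eq_inv_mul, ENNReal.le_div_iff_mul_le (Or.inl h5)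
      (Or.inl (ENNReal.natCast_ne_top _)), mul_comm]
    exact h4

end Wegner

theorem theorem3 :
    ∃ C : ℝ≥0, 0 < C ∧
      -- orthogonal case
      (∀ (k : ℕ) (N : Fin k → ℕ), 0 < k → (∀ j, 0 < N j) →
        ∀ (H₀ : HermMat (Σ j, Fin (N j)) ℝ)
          (Ω : Type*) [MeasurableSpace Ω] (P : Measure Ω) [IsProbabilityMeasure P]
          (V : ∀ j, Ω → HermMat (Fin (N j)) ℝ),
          iIndepFun V P → (∀ j, HasLaw (V j) (GOE (N j)) P) →
        ∀ (m : ℕ) (I : Set ℝ), 1 ≤ m → I.OrdConnected →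
          AEMeasurable (fun ω => eigCount (H₀ + hermBlockDiag fun j => V j ω) I) P ∧
          ∫⁻ ω, ENNReal.ofReal (∏ l ∈ Finset.range m,
              ((eigCount (H₀ + hermBlockDiag fun j => V j ω) I : ℝ) - (l : ℝ))) ∂P
            ≤ (C * (∑ j, (N j : ℝ≥0∞)) * volume I) ^ m ∧
          P {ω | m ≤ eigCount (H₀ + hermBlockDiag fun j => V j ω) I}
            ≤ (m ! : ℝ≥0∞)⁻¹ * (C * (∑ j, (N j : ℝ≥0∞)) * volume I) ^ m) ∧
      -- unitary case
      (∀ (k : ℕ) (N : Fin k → ℕ), 0 < k → (∀ j, 0 < N j) →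
        ∀ (H₀ : HermMat (Σ j, Fin (N j)) ℂ)
          (Ω : Type*) [MeasurableSpace Ω] (P : Measure Ω) [IsProbabilityMeasure P]
          (V : ∀ j, Ω → HermMat (Fin (N j)) ℂ),
          iIndepFun V P → (∀ j, HasLaw (V j) (GUE (N j)) P) →
        ∀ (m : ℕ) (I : Set ℝ), 1 ≤ m → I.OrdConnected →
          AEMeasurable (fun ω => eigCount (H₀ + hermBlockDiag fun j => V j ω) I) P ∧
          ∫⁻ ω, ENNReal.ofReal (∏ l ∈ Finset.range m,
              ((eigCount (H₀ + hermBlockDiag fun j => V j ω) I : ℝ) - (l : ℝ))) ∂P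
            ≤ (C * (∑ j, (N j : ℝ≥0∞)) * volume I) ^ m ∧
          P {ω | m ≤ eigCount (H₀ + hermBlockDiag fun j => V j ω) I}
            ≤ (m ! : ℝ≥0∞)⁻¹ * (C * (∑ j, (N j : ℝ≥0∞)) * volume I) ^ m) := by
  -- The two ensembles have Gaussian parameters `N / 4` and `N / 2`, both positive and at most `N`,
  -- so one constant serves both.
  refine ⟨192, by norm_num, ?_, ?_⟩
  · intro k N hk hN H₀ Ω _ P _ V hV hlaw m I hm hI
    exact wegner_of_hasLaw_gaussHerm Complex.ofRealHom (fun x => by simp) (fun x => by simp) hk hN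
      (a := fun j => (N j : ℝ) / 4) (fun j => by have := hN j; positivity)
      (fun j => by linarith [(N j).cast_nonneg (α := ℝ)]) H₀ P V hV hlaw hm hI
  · intro k N hk hN H₀ Ω _ P _ V hV hlaw m I hm hI
    exact wegner_of_hasLaw_gaussHerm (RingHom.id ℂ) (fun x => rfl) (fun x => rfl) hk hN
      (a := fun j => (N j : ℝ) / 2) (fun j => by have := hN j; positivity)
      (fun j => by linarith [(N j).cast_nonneg (α := ℝ)]) H₀ P V hV hlaw hm hI
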